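/- Let $V:\mathbb R\to\mathbb R$ be smooth and exponentially decaying, i.e. $|V(x)|\le Ae^{-\gamma|x|}$ for some $A$ and some $\gamma>0$. Assume that $-\partial_{xx}+V$ has exactly one negative eigenvalue $-\rho^2$ ($\rho>0$), and let $\phi$ be an associated eigenfunction with $\|\phi\|_{L^2}=1$. Write $(a,b)=\int_{\mathbb R}\bar a\,b\,dx$ and $\langle a,b\rangle=\int_{\mathbb R}(\Re a\,\Re b+\Im a\,\Im b)\,dx$. Then there are $\delta>0$ and a family of small nonlinear bound states $Q[z]\in H^2(\mathbb R)$, with $E[z]\in\mathbb R$, for $z\in\mathbb C$, $|z|<\delta$, such that $$-\partial_{xx}Q[z]+VQ[z]-|Q[z]|^2Q[z]=E[z]\,Q[z],\qquad Q[z]=z\phi+h(z),\quad (\phi,h(z))=0,$$ with $\|h(z)\|_{H^2}\le\delta$, $|E[z]+\rho^2|\le\delta$, $\|h(z)\|_{H^2}\lesssim|z|^2$, and $E[z]=-\rho^2+o(z)$ as $z\to0$; for $0<|z|<\delta$, $(Q[z],E[z])$ is the only pair $(Q,E)\in H^2\times\mathbb R$ that solves $-Q''+VQ-|Q|^2Q=EQ$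 with $(\phi,Q-z\phi)=0$, $\|Q-z\phi\|_{H^2}\le\delta$ and $|E+\rho^2|\le\delta$. The map $z=a+ib\mapsto Q[z]$ is real-differentiable into $L^2$ and we put $\mathrm D_1Q[z]=\partial_aQ[z]$, $\mathrm D_2Q[z]=\partial_bQ[z]$. Moreover there are $\epsilon_0>0$ and $C>0$ such that the following holds. Let $I\subseteq\mathbb R$ be an interval containing $0$ and let $u\in C(I;H^1(\mathbb R))$ be a solution of $$i\partial_tu-\partial_{xx}u+Vu=|u|^2u$$ (the equation holding in $H^{-1}$, that is, tested against every function of $H^1$) whose initial data satisfy $\|u(0)\|_{H^1}+\|x\,u(0)\|_{L^2}\le\epsilon_0$. Then there is a differentiable function $z:I\to\{|z|<\delta\}\subset\mathbb C$ such that, with $$u(t)=Q[z(t)]+\eta(t),$$ one has for all $t\in I$ $$\langle i\eta(t),\mathrm D_1Q[z(t)]\rangle=\langle i\eta(t),\mathrm D_2Q[z(t)]\rangle=0 .$$ The decomposition is unique: for each $t\in I$, $z(t)$ is the only $w\in\mathbb C$ with $|w|<\delta$ such that $\langle i(u(t)-Q[w]),\mathrm D_jQ[w]\rangle=0$ for $j=1,2$.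 Finally, for all $t\in I$, $$\bigl|\dot z-iE[z]z\bigr|(t)\le C\,\Bigl|\bigl\langle \overline{Q[z]}\,\eta^2+2Q[z]|\eta|^2+|\eta|^2\eta,\ \mathrm DQ[z]\bigr\rangle\Bigr|(t),$$ where $|\langle N,\mathrm DQ[z]\rangle|=\bigl(\langle N,\mathrm D_1Q[z]\rangle^2+\langle N,\mathrm D_2Q[z]\rangle^2\bigr)^{1/2}$. -/

import Mathlib

open MeasureTheory Filter Topology Asymptotics
open scoped ContDiff ComplexConjugate

/-- The complex Hilbert space `L²(ℝ; ℂ)`. Its inner product `inner ℂ a b` is `∫ conj a * b`. -/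
abbrev L2C : Type := Lp ℂ 2 (volume : Measure ℝ)

/-- `g ∈ L²` is the weak derivative of `f ∈ L²`; in particular `f ∈ H¹(ℝ)`. -/
def HasWeakDerivL2 (f g : L2C) : Prop :=
  ∀ ψ : ℝ → ℝ, ContDiff ℝ ∞ ψ → HasCompactSupport ψ →
    ∫ x, ((deriv ψ x : ℝ) : ℂ) * f x = -∫ x, (ψ x : ℂ) * g x

/-- `f ∈ H²(ℝ)` and `‖f‖_{H²} ≤ r`. -/
def H2NormLE (f : L2C) (r : ℝ) : Prop :=
  ∃ f₁ f₂ : L2C, HasWeakDerivL2 f f₁ ∧ HasWeakDerivL2 f₁ f₂ ∧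
    √(‖f‖ ^ 2 + ‖f₁‖ ^ 2 + ‖f₂‖ ^ 2) ≤ r

/-- `ψ ∈ H²(ℝ)`, `ψ ≠ 0` and `-ψ'' + V ψ = μ ψ`. -/
def IsEigenfunctionSchr (V : ℝ → ℝ) (μ : ℝ) (ψ : L2C) : Prop :=
  ψ ≠ 0 ∧ ∃ ψ₁ ψ₂ : L2C, HasWeakDerivL2 ψ ψ₁ ∧ HasWeakDerivL2 ψ₁ ψ₂ ∧
    ∀ᵐ x : ℝ, -ψ₂ x + (V x : ℂ) * ψ x = (μ : ℂ) * ψ x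

/-- `V` is smooth and exponentially decaying, `-ρ² < 0` is the only negative eigenvalue of
`-∂ₓₓ + V`, and `φ` is an associated eigenfunction, normalized in `L²`. -/
structure PotentialAssumption (V : ℝ → ℝ) (ρ : ℝ) (φ : L2C) : Prop where
  smooth : ContDiff ℝ ∞ V
  decay : ∃ A γ : ℝ, 0 < γ ∧ ∀ x, |V x| ≤ A * Real.exp (-γ * |x|)
  rho_pos : 0 < ρ
  eigen : IsEigenfunctionSchr V (-ρ ^ 2) φ
  normalized : ‖φ‖ = 1
  only : ∀ μ : ℝ, μ < 0 → ∀ ψ : L2C, IsEigenfunctionSchr V μ ψ → μ = -ρ ^ 2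

/-- `Q ∈ H²(ℝ)` solves the nonlinear elliptic equation `-Q'' + V Q - |Q|² Q = E Q`. -/
def IsNonlinearBoundState (V : ℝ → ℝ) (Q : L2C) (E : ℝ) : Prop :=
  ∃ Q₁ Q₂ : L2C, HasWeakDerivL2 Q Q₁ ∧ HasWeakDerivL2 Q₁ Q₂ ∧
    ∀ᵐ x : ℝ, -Q₂ x + (V x : ℂ) * Q x - (‖Q x‖ ^ 2 : ℝ) * Q x = (E : ℂ) * Q x

/-- The small bound state class with parameter `z` and radius `δ`: `Q = z φ + q` with `q ⊥ φ`,
`‖q‖_{H²} ≤ δ` and `|E - (-ρ²)| ≤ δ`, solving the nonlinear elliptic equation. -/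
def InBoundStateClass (V : ℝ → ℝ) (ρ : ℝ) (φ : L2C) (δ : ℝ) (z : ℂ) (Q : L2C) (E : ℝ) : Prop :=
  IsNonlinearBoundState V Q E ∧ inner ℂ φ (Q - z • φ) = 0 ∧
    H2NormLE (Q - z • φ) δ ∧ |E + ρ ^ 2| ≤ δ

/-- `z ↦ (Q[z], E[z])`, for `|z| < δ`, is the family of small nonlinear bound states bifurcating
from `φ`. For `z ≠ 0` the pair is the only one in its class; at `z = 0` the estimates force
`Q[0] = 0` and `E[0] = -ρ²`. -/
structure IsBoundStateFamily (V : ℝ → ℝ) (ρ : ℝ) (φ : L2C) (δ : ℝ)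
    (Q : ℂ → L2C) (E : ℂ → ℝ) : Prop where
  mem : ∀ z : ℂ, ‖z‖ < δ → InBoundStateClass V ρ φ δ z (Q z) (E z)
  unique : ∀ z : ℂ, z ≠ 0 → ‖z‖ < δ → ∀ (Q' : L2C) (E' : ℝ),
    InBoundStateClass V ρ φ δ z Q' E' → Q' = Q z ∧ E' = E z
  remainder : ∃ C : ℝ, ∀ z : ℂ, ‖z‖ < δ → H2NormLE (Q z - z • φ) (C * ‖z‖ ^ 2)
  energy : (fun z : ℂ => E z + ρ ^ 2) =o[𝓝 0] (fun z : ℂ => z)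
  differentiable : ∀ z : ℂ, ‖z‖ < δ → DifferentiableAt ℝ Q z

/-- `D₁Q[z] = ∂Q/∂a` at `z = a + i b`. -/
noncomputable def D1 (Q : ℂ → L2C) (z : ℂ) : L2C := fderiv ℝ Q z 1

/-- `D₂Q[z] = ∂Q/∂b` at `z = a + i b`. -/
noncomputable def D2 (Q : ℂ → L2C) (z : ℂ) : L2C := fderiv ℝ Q z Complex.I

/-- The reduced inner product `⟨a, b⟩ = ∫ (Re a Re b + Im a Im b) dx`. -/
noncomputable def reducedInner (a b : ℝ → ℂ) : ℝ :=
  ∫ x, ((a x).re * (b x).re + (a x).im * (b x).im)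

/-- The symplectic orthogonality conditions `⟨i η, D₁Q[z]⟩ = ⟨i η, D₂Q[z]⟩ = 0`. -/
def SymplecticOrth (Q : ℂ → L2C) (z : ℂ) (η : L2C) : Prop :=
  reducedInner (fun x => Complex.I * η x) (D1 Q z) = 0 ∧
    reducedInner (fun x => Complex.I * η x) (D2 Q z) = 0

/-- The nonlinear terms `conj(q) η² + 2 q |η|² + |η|² η`. -/
noncomputable def nonlinearTerms (q η : ℝ → ℂ) : ℝ → ℂ := fun x =>
  conj (q x) * η x ^ 2 + 2 * q x * (‖η x‖ ^ 2 : ℝ) + (‖η x‖ ^ 2 : ℝ) * η x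

/-- `|⟨N, DQ[z]⟩|`: the Euclidean length of the vector `(⟨N, D₁Q[z]⟩, ⟨N, D₂Q[z]⟩) ∈ ℝ²`. -/
noncomputable def pairingDQ (Q : ℂ → L2C) (z : ℂ) (N : ℝ → ℂ) : ℝ :=
  √(reducedInner N (D1 Q z) ^ 2 + reducedInner N (D2 Q z) ^ 2)

/-- `u ∈ C(I; H¹(ℝ))` solves `i ∂ₜu - ∂ₓₓu + V u = |u|² u` on the time interval `I`, the equation
holding in `H⁻¹(ℝ)`, the dual of `H¹(ℝ)`: for every `v ∈ H¹(ℝ)` and every `t ∈ I`,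
`d/dt (v, u) = i ((∂ₓv, ∂ₓu) + (v, V u) - (v, |u|² u))`. -/
def IsNLSSolution (V : ℝ → ℝ) (I : Set ℝ) (u : ℝ → L2C) : Prop :=
  ∃ ux : ℝ → L2C, (∀ t ∈ I, HasWeakDerivL2 (u t) (ux t)) ∧
    ContinuousOn u I ∧ ContinuousOn ux I ∧
    ∀ t ∈ I, ∀ v vx : L2C, HasWeakDerivL2 v vx →
      HasDerivWithinAt (fun s => inner ℂ v (u s))
        (Complex.I * (inner ℂ vx (ux t) +
          ∫ x, conj (v x) * ((V x : ℂ) * u t x - (‖u t x‖ ^ 2 : ℝ) * u t x))) I t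

/-- `‖u₀‖_{H¹} + ‖x u₀‖_{L²} ≤ ε` (with both norms finite). -/
def SmallData (u₀ : L2C) (ε : ℝ) : Prop :=
  ∃ u₁ m : L2C, HasWeakDerivL2 u₀ u₁ ∧ (∀ᵐ x : ℝ, m x = (x : ℂ) * u₀ x) ∧
    √(‖u₀‖ ^ 2 + ‖u₁‖ ^ 2) + ‖m‖ ≤ ε

/-! The bound states bifurcate from the simple eigenvalue `-ρ²`. With `G = (-∂ₓₓ + ρ²)⁻¹` and the
unknown `W = -Q'' + ρ² Q`, the elliptic equation becomes an equation between elements of `L²`.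
Substituting `Q = z (φ + G w)` and dividing by `z` leaves an equation in which `z` occurs only
through `s = |z|²`. Its linearization `linOp` in `(w, e)` at `s = 0` is the identity minus a compact
operator: multiplication by `V` is Hilbert-Schmidt from `H¹` to `L²`. It is injective because `-∂ₓₓ
+ V` is symmetric and, by the Wronskian, the eigenspace is one-dimensional. Fredholm's alternative
and the implicit function theorem give a local branch (`exists_branch`). An a priori estimate
(`norm_remainder_le`) places every pair of the uniqueness class on this branch
(`exists_boundStateFamily`).

For the decomposition, the two orthogonality conditions form one complex equation `B(u, z) = 0`
(`modulationMap`), with `B(u, 0) = (φ, u)` and `∂_z B(0, 0) = -1`. So near the origin `w ↦ w + B(u,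
w)` is a contraction of ratio 1/2. This one inequality yields existence, uniqueness and continuity
of `z(t)`, and the bound `‖v‖ ≤ 2 ‖∂_z B v‖`. It applies at every time of `I` because the `L²` norm
is conserved (`IsNLSSolution.norm_eq`) and `B` sees `u` only through `L²`.

The solution `u` is differentiable in time only when paired with `H¹` functions. This suffices: with
`z` frozen, `B(u(s), z)` pairs `u(s)` with `DQ[z]`, which lies in `H²`, and
`hasDerivWithinAt_of_implicit` then differentiates `z`. Gauge covariance `Q[e^{iθ} z] = e^{iθ} Q[z]`
gives the derivative of `B` in the direction `i z`. Combined with the bound state equation and its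
linearization (`modulation_identity`), all terms of order zero and one in `η` cancel in `∂_z B (z' -
i E z)`, and only the quadratic and cubic remainder survives. -/

/-! ### Weak derivatives on the line and continuous representatives -/

theorem L2C.locallyIntegrable (f : L2C) : LocallyIntegrable f volume :=
  (Lp.memLp f).locallyIntegrable (by norm_num)

theorem intervalIntegrable_of_locallyIntegrable {E : Type*} [NormedAddCommGroup E] {f : ℝ → E}
    (hf : LocallyIntegrable f volume) (a b : ℝ) : IntervalIntegrable f volume a b :=
  intervalIntegrable_iff.mpr <|
    (hf.integrableOn_isCompact isCompact_uIcc).mono_set Set.uIoc_subset_uIcc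

theorem L2C.intervalIntegrable (f : L2C) (a b : ℝ) : IntervalIntegrable f volume a b :=
  intervalIntegrable_of_locallyIntegrable f.locallyIntegrable a b

theorem testFunction_integrable_mul {ψ : ℝ → ℝ} (hψ : Continuous ψ) (hc : HasCompactSupport ψ)
    {f : ℝ → ℂ} (hf : LocallyIntegrable f volume) : Integrable (fun x => (ψ x : ℂ) * f x) := by
  simpa [Complex.real_smul] using hf.integrable_smul_left_of_hasCompactSupport hψ hc

/-- Integration by parts for absolutely continuous functions on an interval containing the support
of `ψ`. By Lebesgue differentiation the primitive has derivative `g` almost everywhere. -/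
theorem integral_deriv_mul_primitive_real {g : ℝ → ℝ} (hg : LocallyIntegrable g volume)
    {ψ : ℝ → ℝ} (hψ : ContDiff ℝ ∞ ψ) (hc : HasCompactSupport ψ) :
    ∫ x, deriv ψ x * ∫ t in (0 : ℝ)..x, g t = -∫ x, ψ x * g x := by
  obtain ⟨R, hR0, hR⟩ : ∃ R : ℝ, 0 < R ∧ tsupport ψ ⊆ Set.Ioo (-R) R := by
    obtain ⟨R, hR⟩ := hc.isBounded.subset_ball 0
    refine ⟨max R 1, by positivity, fun x hx => ?_⟩
    have := hR hx
    rw [Metric.mem_ball, Real.dist_eq, sub_zero, abs_lt] at this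
    exact ⟨by linarith [le_max_left R 1], by linarith [le_max_left R 1]⟩
  have hψ0 : ∀ x, x ∉ Set.Ioo (-R) R → ψ x = 0 := fun x hx =>
    image_eq_zero_of_notMem_tsupport fun h => hx (hR h)
  have hψ'0 : ∀ x, x ∉ Set.Ioo (-R) R → deriv ψ x = 0 := fun x hx =>
    image_eq_zero_of_notMem_tsupport fun h => hx (hR (tsupport_deriv_subset h))
  have hgi : IntervalIntegrable g volume (-R) R :=
    intervalIntegrable_of_locallyIntegrable hg _ _
  have hac := hgi.absolutelyContinuousOnInterval_intervalIntegral (c := 0)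
    (by rw [Set.uIcc_of_le (by linarith)]; constructor <;> linarith)
  have hψac : AbsolutelyContinuousOnInterval ψ (-R) R :=
    (hψ.of_le (by simp) : ContDiff ℝ 1 ψ).contDiffOn.absolutelyContinuousOnInterval
  have key := hψac.integral_deriv_mul_eq_sub hac
  rw [hψ0 R (by simp), hψ0 (-R) (by simp)] at key
  have hae := LocallyIntegrable.ae_hasDerivAt_integral hg
  have h1 : ∫ x in (-R)..R, deriv ψ x * (∫ t in (0 : ℝ)..x, g t) + ψ x * g x = 0 := by
    simp only [zero_mul, sub_zero] at key
    refine Eq.trans ?_ key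
    apply intervalIntegral.integral_congr_ae
    filter_upwards [hae] with x hx _
    rw [(hx 0).deriv]
  have hψ'c : Continuous (deriv ψ) := hψ.continuous_deriv (by simp)
  have hFc : Continuous fun x => ∫ t in (0 : ℝ)..x, g t :=
    intervalIntegral.continuous_primitive (fun a b => intervalIntegrable_of_locallyIntegrable hg a b) 0
  have hi1 : Integrable (fun x => deriv ψ x * ∫ t in (0 : ℝ)..x, g t) :=
    (hψ'c.mul hFc).integrable_of_hasCompactSupport hc.deriv.mul_right
  have hi2 : Integrable (fun x => ψ x * g x) := by
    simpa using hg.integrable_smul_left_of_hasCompactSupport hψ.continuous hc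
  have h2 : ∫ x, (deriv ψ x * (∫ t in (0 : ℝ)..x, g t) + ψ x * g x) = 0 := by
    refine Eq.trans ?_ h1
    rw [intervalIntegral.integral_of_le (by linarith),
      setIntegral_eq_integral_of_forall_compl_eq_zero]
    intro x hx
    have hx' : x ∉ Set.Ioo (-R) R := fun h => hx ⟨h.1, h.2.le⟩
    simp [hψ0 x hx', hψ'0 x hx']
  rw [integral_add hi1 hi2] at h2
  linarith

theorem integral_deriv_mul_primitive {g : ℝ → ℂ} (hg : LocallyIntegrable g volume)
    {ψ : ℝ → ℝ} (hψ : ContDiff ℝ ∞ ψ) (hc : HasCompactSupport ψ) :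
    ∫ x, ((deriv ψ x : ℝ) : ℂ) * ∫ t in (0 : ℝ)..x, g t = -∫ x, (ψ x : ℂ) * g x := by
  have hψ'c : Continuous (deriv ψ) := hψ.continuous_deriv (by simp)
  have hFc : Continuous fun x => ∫ t in (0 : ℝ)..x, g t :=
    intervalIntegral.continuous_primitive (fun a b => intervalIntegrable_of_locallyIntegrable hg a b) 0
  have hi1 := testFunction_integrable_mul hψ'c hc.deriv hFc.locallyIntegrable
  have hi2 := testFunction_integrable_mul hψ.continuous hc hg
  have hre : LocallyIntegrable (fun x => (g x).re) volume := fun x =>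
    let ⟨s, hs, h⟩ := hg x; ⟨s, hs, h.re⟩
  have him : LocallyIntegrable (fun x => (g x).im) volume := fun x =>
    let ⟨s, hs, h⟩ := hg x; ⟨s, hs, h.im⟩
  have hr := integral_deriv_mul_primitive_real hre hψ hc
  have hm := integral_deriv_mul_primitive_real him hψ hc
  have e1 : ∀ x, (∫ t in (0 : ℝ)..x, g t).re = ∫ t in (0 : ℝ)..x, (g t).re := fun x => by
    simpa using (Complex.reCLM.intervalIntegral_comp_comm
      (intervalIntegrable_of_locallyIntegrable hg 0 x)).symm
  have e2 : ∀ x, (∫ t in (0 : ℝ)..x, g t).im = ∫ t in (0 : ℝ)..x, (g t).im := fun x => by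
    simpa using (Complex.imCLM.intervalIntegral_comp_comm
      (intervalIntegrable_of_locallyIntegrable hg 0 x)).symm
  apply Complex.ext
  · rw [Complex.neg_re, ← Complex.reCLM_apply, ← Complex.reCLM_apply,
      ← Complex.reCLM.integral_comp_comm hi1, ← Complex.reCLM.integral_comp_comm hi2]
    simpa [e1] using hr
  · rw [Complex.neg_im, ← Complex.imCLM_apply, ← Complex.imCLM_apply,
      ← Complex.imCLM.integral_comp_comm hi1, ← Complex.imCLM.integral_comp_comm hi2]
    simpa [e2] using hm

/-- A test function with vanishing integral is the derivative of a test function. -/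
theorem exists_testFunction_deriv_eq {ψ : ℝ → ℝ} (hψ : ContDiff ℝ ∞ ψ) (hc : HasCompactSupport ψ)
    (h0 : ∫ x, ψ x = 0) : ∃ Ψ : ℝ → ℝ, ContDiff ℝ ∞ Ψ ∧ HasCompactSupport Ψ ∧ deriv Ψ = ψ := by
  obtain ⟨R, hR0, hR⟩ : ∃ R : ℝ, 0 < R ∧ tsupport ψ ⊆ Set.Ioo (-R) R := by
    obtain ⟨R, hR⟩ := hc.isBounded.subset_ball 0
    refine ⟨max R 1, by positivity, fun x hx => ?_⟩
    have := hR hx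
    rw [Metric.mem_ball, Real.dist_eq, sub_zero, abs_lt] at this
    exact ⟨by linarith [le_max_left R 1], by linarith [le_max_left R 1]⟩
  have hψ0 : ∀ x, x ∉ Set.Ioo (-R) R → ψ x = 0 := fun x hx =>
    image_eq_zero_of_notMem_tsupport fun h => hx (hR h)
  have hd : ∀ x, HasDerivAt (fun x => ∫ t in (-R)..x, ψ t) (ψ x) x := fun x =>
    intervalIntegral.integral_hasDerivAt_right (hψ.continuous.intervalIntegrable _ _)
      (hψ.continuous.stronglyMeasurableAtFilter _ _) hψ.continuous.continuousAt
  have hderiv : deriv (fun x => ∫ t in (-R)..x, ψ t) = ψ := funext fun x => (hd x).deriv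
  refine ⟨fun x => ∫ t in (-R)..x, ψ t, ?_, ?_, hderiv⟩
  · rw [contDiff_infty_iff_deriv, hderiv]
    exact ⟨fun x => (hd x).differentiableAt, hψ⟩
  · refine HasCompactSupport.intro (K := Set.Icc (-R) R) isCompact_Icc fun x hx => ?_
    rw [Set.mem_Icc, not_and_or, not_le, not_le] at hx
    rcases hx with hx | hx
    · refine (intervalIntegral.integral_congr (g := fun _ => (0 : ℝ)) fun t ht => ?_).trans (by simp)
      rw [Set.uIcc_of_ge hx.le] at ht
      exact hψ0 t fun h => absurd h.1 (not_lt.2 ht.2)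
    · rw [intervalIntegral.integral_of_le (by linarith),
        setIntegral_eq_integral_of_forall_compl_eq_zero, h0]
      intro t ht
      exact hψ0 t fun h => ht ⟨h.1, h.2.le.trans hx.le⟩

/-- Du Bois-Reymond's argument: subtracting `(∫ g) ψ₀` from a test function `g`, with `ψ₀` a bump of
integral one, leaves the derivative of a test function. The constant is therefore `∫ ψ₀ f`. -/
theorem ae_eq_const_of_integral_deriv_mul_eq_zero {f : ℝ → ℂ} (hf : LocallyIntegrable f volume)
    (h : ∀ ψ : ℝ → ℝ, ContDiff ℝ ∞ ψ → HasCompactSupport ψ →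
      ∫ x, ((deriv ψ x : ℝ) : ℂ) * f x = 0) : ∃ c : ℂ, ∀ᵐ x, f x = c := by
  let χ : ContDiffBump (0 : ℝ) := ⟨1, 2, one_pos, one_lt_two⟩
  set ψ₀ : ℝ → ℝ := χ.normed volume with hψ₀
  have hs : ContDiff ℝ ∞ ψ₀ := χ.contDiff_normed
  have hcs : HasCompactSupport ψ₀ := χ.hasCompactSupport_normed
  have hint : ∫ x, ψ₀ x = 1 := χ.integral_normed
  refine ⟨∫ x, (ψ₀ x : ℂ) * f x, ?_⟩
  apply ae_eq_of_integral_contDiff_smul_eq hf (locallyIntegrable_const _)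
  intro g hg hgc
  have hgi : Integrable g := hg.continuous.integrable_of_hasCompactSupport hgc
  have hψi : Integrable ψ₀ := hs.continuous.integrable_of_hasCompactSupport hcs
  have hsc : HasCompactSupport fun x => (∫ y, g y) * ψ₀ x := hcs.mul_left
  obtain ⟨Ψ, hΨ, hΨc, hΨd⟩ := exists_testFunction_deriv_eq
    (ψ := fun x => g x - (∫ y, g y) * ψ₀ x) (hg.sub (contDiff_const.mul hs))
    (by simpa only [sub_eq_add_neg] using! hgc.add hsc.neg)
    (by rw [integral_sub hgi (hψi.const_mul _), integral_const_mul, hint]; ring)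
  have := h Ψ hΨ hΨc
  rw [hΨd] at this
  have i1 := testFunction_integrable_mul hg.continuous hgc hf
  have i2 := testFunction_integrable_mul hs.continuous hcs hf
  have e : ∀ x, ((g x - (∫ y, g y) * ψ₀ x : ℝ) : ℂ) * f x
      = (g x : ℂ) * f x - ((∫ y, g y : ℝ) : ℂ) * ((ψ₀ x : ℂ) * f x) := fun x => by push_cast; ring
  simp_rw [e] at this
  rw [integral_sub i1 (i2.const_mul _), integral_const_mul, sub_eq_zero] at this
  simp only [Complex.real_smul]
  rw [this, integral_mul_const, integral_complex_ofReal]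

/-- An element of `H¹(ℝ)` has a continuous representative, the primitive of its weak derivative. -/
theorem HasWeakDerivL2.exists_rep {f g : L2C} (h : HasWeakDerivL2 f g) :
    ∃ F : ℝ → ℂ, Continuous F ∧ f =ᵐ[volume] F ∧ ∀ x y, F y - F x = ∫ t in x..y, g t := by
  have hFc : Continuous fun x => ∫ t in (0 : ℝ)..x, g t :=
    intervalIntegral.continuous_primitive (fun a b => g.intervalIntegrable a b) 0
  obtain ⟨c, hc⟩ := ae_eq_const_of_integral_deriv_mul_eq_zero
    (f := fun x => f x - ∫ t in (0 : ℝ)..x, g t) (f.locallyIntegrable.sub hFc.locallyIntegrable) <| by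
      intro ψ hψ hψc
      have hψ'c : Continuous (deriv ψ) := hψ.continuous_deriv (by simp)
      simp_rw [mul_sub]
      rw [integral_sub (testFunction_integrable_mul hψ'c hψc.deriv f.locallyIntegrable)
        (testFunction_integrable_mul hψ'c hψc.deriv hFc.locallyIntegrable), h ψ hψ hψc,
        integral_deriv_mul_primitive g.locallyIntegrable hψ hψc, sub_self]
  refine ⟨fun x => c + ∫ t in (0 : ℝ)..x, g t, continuous_const.add hFc, ?_, fun x y => ?_⟩
  · filter_upwards [hc] with x hx
    rw [← hx]; ring
  · rw [add_sub_add_left_eq_sub, intervalIntegral.integral_interval_sub_left] <;>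
      exact g.intervalIntegrable _ _

theorem L2C.integral_norm_le (f : L2C) (x : ℝ) : ∫ t in x..(x+1), ‖f t‖ ≤ ‖f‖ := by
  have hind : MemLp (Set.indicator (Set.Ioc x (x+1)) fun _ => (1 : ℝ)) 2 volume :=
    memLp_indicator_const 2 measurableSet_Ioc 1 (by simp)
  have hn : MemLp (fun t => ‖f t‖) 2 volume := (Lp.memLp f).norm
  have e : ∫ t in x..(x+1), ‖f t‖ = inner ℝ (hind.toLp _) (hn.toLp _) := by
    rw [L2.inner_def, intervalIntegral.integral_of_le (by linarith),
      ← integral_indicator measurableSet_Ioc]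
    apply integral_congr_ae
    filter_upwards [hind.coeFn_toLp, hn.coeFn_toLp] with t h1 h2
    rw [h1, h2]
    by_cases ht : t ∈ Set.Ioc x (x+1) <;> simp [ht]
  rw [e]
  refine (real_inner_le_norm _ _).trans ?_
  have h1 : ‖hind.toLp _‖ = 1 := by
    rw [Lp.norm_toLp, eLpNorm_indicator_const measurableSet_Ioc (by norm_num) (by norm_num)]
    simp
  have h2 : ‖hn.toLp _‖ = ‖f‖ := by
    rw [Lp.norm_toLp, eLpNorm_norm, ← Lp.norm_def]
  rw [h1, h2, one_mul]

/-- On an interval of length one, `‖F x‖` is at most `‖F y‖` plus the oscillation, which is bounded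
by `∫ ‖g‖ ≤ ‖g‖_{L²}`. Averaging over `y` gives the Sobolev bound. -/
theorem norm_rep_le {f g : L2C} {F : ℝ → ℂ} (hF : Continuous F) (hf : f =ᵐ[volume] F)
    (hFg : ∀ x y, F y - F x = ∫ t in x..y, g t) (x : ℝ) : ‖F x‖ ≤ ‖f‖ + ‖g‖ := by
  have h1 : ∀ y ∈ Set.Icc x (x+1), ‖F x‖ ≤ ‖F y‖ + ‖g‖ := fun y hy => by
    have hle : ‖∫ t in x..y, g t‖ ≤ ‖g‖ :=
      (intervalIntegral.norm_integral_le_integral_norm hy.1).trans <|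
        (intervalIntegral.integral_mono_interval le_rfl hy.1 hy.2
          (Eventually.of_forall fun _ => norm_nonneg _)
          (g.intervalIntegrable _ _).norm).trans (g.integral_norm_le x)
    rw [← hFg x y] at hle
    have := norm_sub_norm_le (F x) (F y)
    rw [norm_sub_rev] at this
    linarith
  have h2 : ∫ y in x..(x+1), ‖F x‖ ≤ ∫ y in x..(x+1), (‖F y‖ + ‖g‖) :=
    intervalIntegral.integral_mono_on (by linarith) (by simp)
      ((hF.norm.add continuous_const).intervalIntegrable _ _) h1
  rw [intervalIntegral.integral_add (hF.norm.intervalIntegrable _ _) (by simp)] at h2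
  have h3 : ∫ y in x..(x+1), ‖F y‖ = ∫ y in x..(x+1), ‖f y‖ := by
    apply intervalIntegral.integral_congr_ae
    filter_upwards [hf] with y hy _
    rw [hy]
  have := f.integral_norm_le x
  rw [h3] at h2
  simp at h2
  linarith

theorem HasWeakDerivL2.unique {f g g' : L2C} (h : HasWeakDerivL2 f g) (h' : HasWeakDerivL2 f g') :
    g = g' := by
  apply Lp.ext
  apply ae_eq_of_integral_contDiff_smul_eq g.locallyIntegrable g'.locallyIntegrable
  intro ψ hψ hc
  have := (h ψ hψ hc).symm.trans (h' ψ hψ hc)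
  simpa [Complex.real_smul] using this

theorem testFunction_integral_eq_inner {ψ : ℝ → ℝ} (hψ : MemLp (fun x => (ψ x : ℂ)) 2 volume)
    (f : L2C) : ∫ x, (ψ x : ℂ) * f x = inner ℂ (hψ.toLp _) f := by
  rw [L2.inner_def]
  apply integral_congr_ae
  filter_upwards [hψ.coeFn_toLp] with x hx
  simp [hx, mul_comm]

theorem testFunction_memLp {ψ : ℝ → ℝ} (hψ : Continuous ψ) (hc : HasCompactSupport ψ) :
    MemLp (fun x => (ψ x : ℂ)) 2 volume :=
  (Complex.continuous_ofReal.comp hψ).memLp_of_hasCompactSupport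
    (hc.comp_left (g := fun r : ℝ => (r : ℂ)) (by simp))

/-- Linearity and closedness of the weak derivative follow from those of the inner product in this
form. -/
theorem hasWeakDerivL2_iff_inner {f g : L2C} : HasWeakDerivL2 f g ↔
    ∀ (ψ : ℝ → ℝ) (hψ : ContDiff ℝ ∞ ψ) (hc : HasCompactSupport ψ),
      inner ℂ ((testFunction_memLp (hψ.continuous_deriv (by simp))
        hc.deriv).toLp _) f = - inner ℂ ((testFunction_memLp hψ.continuous hc).toLp _) g := by
  refine forall₃_congr fun ψ hψ hc => ?_
  rw [← testFunction_integral_eq_inner, ← testFunction_integral_eq_inner]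

theorem hasWeakDerivL2_zero : HasWeakDerivL2 0 0 := by
  rw [hasWeakDerivL2_iff_inner]; simp

theorem HasWeakDerivL2.add {f g f' g' : L2C} (h : HasWeakDerivL2 f g) (h' : HasWeakDerivL2 f' g') :
    HasWeakDerivL2 (f + f') (g + g') := by
  rw [hasWeakDerivL2_iff_inner] at *
  intro ψ hψ hc
  rw [inner_add_right, inner_add_right, h ψ hψ hc, h' ψ hψ hc, neg_add]

theorem HasWeakDerivL2.smul {f g : L2C} (h : HasWeakDerivL2 f g) (c : ℂ) :
    HasWeakDerivL2 (c • f) (c • g) := by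
  rw [hasWeakDerivL2_iff_inner] at *
  intro ψ hψ hc
  rw [inner_smul_right, inner_smul_right, h ψ hψ hc, mul_neg]

theorem HasWeakDerivL2.sub {f g f' g' : L2C} (h : HasWeakDerivL2 f g) (h' : HasWeakDerivL2 f' g') :
    HasWeakDerivL2 (f - f') (g - g') := by
  simpa [sub_eq_add_neg] using h.add (h'.smul (-1))

theorem testFunction_hasWeakDerivL2 {ψ : ℝ → ℝ} (hψ : ContDiff ℝ ∞ ψ) (hc : HasCompactSupport ψ) :
    HasWeakDerivL2 ((testFunction_memLp hψ.continuous hc).toLp _)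
      ((testFunction_memLp (hψ.continuous_deriv (by simp)) hc.deriv).toLp _) := by
  intro χ hχ hχc
  have hd : ∀ x, HasDerivAt (fun x => (ψ x : ℂ)) ((deriv ψ x : ℝ) : ℂ) x := fun x =>
    ((hψ.differentiable (by simp)) x).hasDerivAt.ofReal_comp
  have hd' : ∀ x, HasDerivAt (fun x => (χ x : ℂ)) ((deriv χ x : ℝ) : ℂ) x := fun x =>
    ((hχ.differentiable (by simp)) x).hasDerivAt.ofReal_comp
  have hψ'c : Continuous (deriv ψ) := hψ.continuous_deriv (by simp)
  have hχ'c : Continuous (deriv χ) := hχ.continuous_deriv (by simp)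
  have cψ := Complex.continuous_ofReal.comp hψ.continuous
  have cψ' := Complex.continuous_ofReal.comp hψ'c
  have e := integral_mul_deriv_eq_deriv_mul_of_integrable
    (u := fun x => (χ x : ℂ)) (v := fun x => (ψ x : ℂ)) (fun x _ => hd' x) (fun x _ => hd x)
    (testFunction_integrable_mul hχ.continuous hχc cψ'.locallyIntegrable)
    (testFunction_integrable_mul hχ'c hχc.deriv cψ.locallyIntegrable)
    (testFunction_integrable_mul hχ.continuous hχc cψ.locallyIntegrable)
  have e1 : ∫ x, ((deriv χ x : ℝ) : ℂ) * ((testFunction_memLp hψ.continuous hc).toLp _ : L2C) x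
      = ∫ x, ((deriv χ x : ℝ) : ℂ) * (ψ x : ℂ) := by
    apply integral_congr_ae
    filter_upwards [(testFunction_memLp hψ.continuous hc).coeFn_toLp] with x hx
    rw [hx]
  have e2 : ∫ x, (χ x : ℂ) * ((testFunction_memLp hψ'c hc.deriv).toLp _ : L2C) x
      = ∫ x, (χ x : ℂ) * ((deriv ψ x : ℝ) : ℂ) := by
    apply integral_congr_ae
    filter_upwards [(testFunction_memLp hψ'c hc.deriv).coeFn_toLp] with x hx
    rw [hx]
  rw [e1, e2, ← neg_eq_iff_eq_neg]
  exact e.symm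

/-! ### The Hilbert space `H¹` and its embedding into `L^∞` -/

theorem isClosed_hasWeakDerivL2 : IsClosed {p : L2C × L2C | HasWeakDerivL2 p.1 p.2} := by
  simp only [hasWeakDerivL2_iff_inner, Set.ofPred_forall]
  refine isClosed_iInter fun ψ => isClosed_iInter fun hψ => isClosed_iInter fun hc => ?_
  exact isClosed_eq (by fun_prop) (by fun_prop)

/-- The graph of the weak derivative, with the derivative scaled by `ρ⁻¹`: a copy of `H¹(ℝ)` with
the norm `(‖f‖² + ρ⁻² ‖f'‖²)^{1/2}`. -/
noncomputable def h1Submodule (ρ : ℝ) : Submodule ℂ (WithLp 2 (L2C × L2C)) where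
  carrier := {p | HasWeakDerivL2 p.fst ((ρ : ℂ) • p.snd)}
  zero_mem' := by
    change HasWeakDerivL2 0 ((ρ : ℂ) • (0 : L2C))
    rw [smul_zero]
    exact hasWeakDerivL2_zero
  add_mem' := fun {a b} ha hb => by
    have := HasWeakDerivL2.add ha hb
    rw [← smul_add] at this
    exact this
  smul_mem' := fun c a ha => by
    have := HasWeakDerivL2.smul ha c
    rw [smul_comm] at this
    exact this

theorem isClosed_h1Submodule (ρ : ℝ) : IsClosed (h1Submodule ρ : Set (WithLp 2 (L2C × L2C))) := by
  have hc : Continuous fun p : WithLp 2 (L2C × L2C) => (p.fst, (ρ : ℂ) • p.snd) := by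
    fun_prop
  exact isClosed_hasWeakDerivL2.preimage hc

/-- The Sobolev space `H¹(ℝ)` with the norm `(‖f‖² + ρ⁻² ‖f'‖²)^{1/2}`. -/
def H1 (ρ : ℝ) : Type := h1Submodule ρ

noncomputable instance (ρ : ℝ) : NormedAddCommGroup (H1 ρ) :=
  inferInstanceAs (NormedAddCommGroup (h1Submodule ρ))

noncomputable instance (ρ : ℝ) : InnerProductSpace ℂ (H1 ρ) :=
  inferInstanceAs (InnerProductSpace ℂ (h1Submodule ρ))

instance (ρ : ℝ) : CompleteSpace (H1 ρ) := (isClosed_h1Submodule ρ).completeSpace_coe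

namespace H1

variable {ρ : ℝ}

/-- The inclusion of `H¹` into `L² × L²`. -/
noncomputable def graph : H1 ρ →ₗᵢ[ℂ] WithLp 2 (L2C × L2C) := (h1Submodule ρ).subtypeₗᵢ

/-- The inclusion `H¹ → L²`. -/
noncomputable def val : H1 ρ →L[ℂ] L2C :=
  (WithLp.fstL 2 ℂ L2C L2C).comp graph.toContinuousLinearMap

/-- The weak derivative `H¹ → L²`. -/
noncomputable def der : H1 ρ →L[ℂ] L2C :=
  (ρ : ℂ) • (WithLp.sndL 2 ℂ L2C L2C).comp graph.toContinuousLinearMap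

theorem val_apply (f : H1 ρ) : val f = (graph f).fst := rfl

theorem der_apply (f : H1 ρ) : der f = (ρ : ℂ) • (graph f).snd := rfl

theorem hasWeakDeriv (f : H1 ρ) : HasWeakDerivL2 (val f) (der f) := f.2

theorem val_injective (hρ : ρ ≠ 0) : Function.Injective (val : H1 ρ → L2C) := by
  intro f g h
  have h1 := hasWeakDeriv f
  rw [h] at h1
  have h2 := h1.unique (hasWeakDeriv g)
  rw [der_apply, der_apply] at h2
  have h3 := smul_right_injective L2C (Complex.ofReal_ne_zero.2 hρ) h2
  exact graph.injective (WithLp.ofLp_injective 2 (Prod.ext h h3))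

theorem exists_of_hasWeakDeriv (hρ : ρ ≠ 0) {f g : L2C} (h : HasWeakDerivL2 f g) :
    ∃ p : H1 ρ, val p = f ∧ der p = g := by
  have e : (ρ : ℂ) • (ρ : ℂ)⁻¹ • g = g := smul_inv_smul₀ (Complex.ofReal_ne_zero.2 hρ) g
  refine ⟨⟨WithLp.toLp 2 (f, (ρ : ℂ)⁻¹ • g), ?_⟩, rfl, e⟩
  change HasWeakDerivL2 f ((ρ : ℂ) • (ρ : ℂ)⁻¹ • g)
  rwa [e]

theorem inner_eq (f g : H1 ρ) : (ρ : ℂ) ^ 2 * inner ℂ f g =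
    (ρ : ℂ) ^ 2 * inner ℂ (val f) (val g) + inner ℂ (der f) (der g) := by
  rw [← graph.inner_map_map, WithLp.prod_inner_apply, der_apply, der_apply, inner_smul_left,
    inner_smul_right, Complex.conj_ofReal, val_apply, val_apply, mul_add]
  ring_nf
  rfl

theorem norm_sq_eq (f : H1 ρ) : ρ ^ 2 * ‖f‖ ^ 2 = ρ ^ 2 * ‖val f‖ ^ 2 + ‖der f‖ ^ 2 := by
  have := inner_eq f f
  have e := inner_self_eq_norm_sq_to_K (𝕜 := ℂ) f
  rw [e, inner_self_eq_norm_sq_to_K, inner_self_eq_norm_sq_to_K] at this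
  apply Complex.ofReal_injective
  push_cast
  exact this

theorem norm_val_le (f : H1 ρ) : ‖val f‖ ≤ ‖f‖ :=
  (WithLp.norm_fst_le L2C (graph f)).trans_eq (graph.norm_map f)

theorem norm_der_le (f : H1 ρ) : ‖der f‖ ≤ |ρ| * ‖f‖ := by
  rw [der_apply, norm_smul, Complex.norm_real, Real.norm_eq_abs]
  gcongr
  exact (WithLp.norm_snd_le L2C (graph f)).trans_eq (graph.norm_map f)

theorem exists_rep (f : H1 ρ) : ∃ F : ℝ → ℂ, Continuous F ∧ val f =ᵐ[volume] F ∧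
    ∀ x y, F y - F x = ∫ t in x..y, der f t := (hasWeakDeriv f).exists_rep

/-- The continuous representative of an element of `H¹`. -/
noncomputable def rep (f : H1 ρ) : ℝ → ℂ := f.exists_rep.choose

theorem continuous_rep (f : H1 ρ) : Continuous f.rep := f.exists_rep.choose_spec.1

theorem val_ae_eq_rep (f : H1 ρ) : val f =ᵐ[volume] f.rep := f.exists_rep.choose_spec.2.1

theorem rep_sub_rep (f : H1 ρ) (x y : ℝ) : f.rep y - f.rep x = ∫ t in x..y, der f t :=
  f.exists_rep.choose_spec.2.2 x y

theorem rep_eq_of_ae_eq (f : H1 ρ) {F : ℝ → ℂ} (hF : Continuous F) (h : val f =ᵐ[volume] F) :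
    f.rep = F :=
  (f.continuous_rep.ae_eq_iff_eq volume hF).1 (f.val_ae_eq_rep.symm.trans h)

theorem rep_add (f g : H1 ρ) : (f + g).rep = f.rep + g.rep := by
  apply rep_eq_of_ae_eq _ (f.continuous_rep.add g.continuous_rep)
  rw [map_add]
  exact (Lp.coeFn_add _ _).trans (f.val_ae_eq_rep.add g.val_ae_eq_rep)

theorem rep_smul (c : ℂ) (f : H1 ρ) : (c • f).rep = c • f.rep := by
  apply rep_eq_of_ae_eq _ (f.continuous_rep.const_smul c)
  rw [map_smul]
  exact (Lp.coeFn_smul _ _).trans (f.val_ae_eq_rep.const_smul c)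

theorem norm_rep_le (f : H1 ρ) (x : ℝ) : ‖f.rep x‖ ≤ (1 + |ρ|) * ‖f‖ := by
  have := _root_.norm_rep_le f.continuous_rep f.val_ae_eq_rep f.rep_sub_rep x
  have h1 := f.norm_val_le
  have h2 := f.norm_der_le
  linarith

/-- Evaluation at a point, a bounded functional on `H¹`. -/
noncomputable def eval (x : ℝ) : H1 ρ →L[ℂ] ℂ :=
  LinearMap.mkContinuous
    { toFun := fun f => f.rep x
      map_add' := fun f g => by rw [rep_add]; rfl
      map_smul' := fun c f => by rw [rep_smul]; rfl } (1 + |ρ|) fun f => f.norm_rep_le x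

theorem eval_apply (x : ℝ) (f : H1 ρ) : eval x f = f.rep x := rfl

theorem norm_eval_le (x : ℝ) : ‖(eval x : H1 ρ →L[ℂ] ℂ)‖ ≤ 1 + |ρ| :=
  LinearMap.mkContinuous_norm_le _ (by positivity) _

theorem norm_val_ae_le (f : H1 ρ) : ∀ᵐ x, ‖val f x‖ ≤ (1 + |ρ|) * ‖f‖ := by
  filter_upwards [f.val_ae_eq_rep] with x hx
  rw [hx]; exact f.norm_rep_le x

theorem memLp_top (f : H1 ρ) : MemLp (val f) ⊤ volume :=
  memLp_top_of_bound (Lp.aestronglyMeasurable _) _ f.norm_val_ae_le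

/-- The Sobolev embedding `H¹ → L^∞`. -/
noncomputable def toLinf : H1 ρ →L[ℂ] Lp ℂ ⊤ (volume : Measure ℝ) :=
  LinearMap.mkContinuous
    { toFun := fun f => f.memLp_top.toLp _
      map_add' := fun f g => by
        rw [← MemLp.toLp_add]
        apply MemLp.toLp_congr
        rw [map_add]
        exact Lp.coeFn_add _ _
      map_smul' := fun c f => by
        rw [RingHom.id_apply, ← MemLp.toLp_const_smul]
        apply MemLp.toLp_congr
        rw [map_smul]
        exact Lp.coeFn_smul _ _ } (1 + |ρ|) fun f => by
    change ‖(f.memLp_top.toLp _ : Lp ℂ ⊤ (volume : Measure ℝ))‖ ≤ _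
    rw [Lp.norm_toLp, eLpNorm_exponent_top]
    exact ENNReal.toReal_le_of_le_ofReal (by positivity)
      (eLpNormEssSup_le_of_ae_bound f.norm_val_ae_le)

theorem toLinf_ae_eq (f : H1 ρ) : toLinf f =ᵐ[volume] val f := f.memLp_top.coeFn_toLp

/-- The real trilinear expression `(a, b, c) ↦ a * conj b * c`. -/
noncomputable def tri (a b c : H1 ρ) : L2C :=
  (ContinuousLinearMap.mul ℝ ℂ).holderL volume ⊤ 2 2 (toLinf a)
    ((ContinuousLinearMap.mul ℝ ℂ).holderL volume ⊤ 2 2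
      ((Complex.conjCLE : ℂ →L[ℝ] ℂ).compLpL ⊤ volume (toLinf b)) (val c))

theorem tri_ae_eq (a b c : H1 ρ) :
    tri a b c =ᵐ[volume] fun x => val a x * (conj (val b x) * val c x) := by
  refine (ContinuousLinearMap.coeFn_holder _ _ _).trans ?_
  filter_upwards [ContinuousLinearMap.coeFn_holder (r := 2) (ContinuousLinearMap.mul ℝ ℂ)
    ((Complex.conjCLE : ℂ →L[ℝ] ℂ).compLpL ⊤ volume (toLinf b)) (val c), toLinf_ae_eq a,
    toLinf_ae_eq b, (Complex.conjCLE : ℂ →L[ℝ] ℂ).coeFn_compLpL (toLinf b)] with x h1 h2 h3 h4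
  simp only [ContinuousLinearMap.holderL_apply_apply] at h1 ⊢
  rw [h1, h2, h4, h3]
  rfl

end H1

/-! ### The resolvent of `-∂ₓₓ` at `-ρ²` -/

theorem eq_zero_of_hasDerivAt_mul_of_bounded {u : ℝ → ℂ} {c M : ℝ} (hc : c ≠ 0)
    (hu : ∀ x, HasDerivAt u (c * u x) x) (hM : ∀ x, ‖u x‖ ≤ M) (x : ℝ) : u x = 0 := by
  have hexp : ∀ x : ℝ, HasDerivAt (fun x : ℝ => Complex.exp (-(c * x : ℝ)))
      (Complex.exp (-(c * x : ℝ)) * (-c : ℂ)) x := fun x => by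
    have h := ((hasDerivAt_id x).const_mul c).ofReal_comp.neg.cexp
    simpa using! h
  have hd : ∀ x : ℝ, HasDerivAt (fun x : ℝ => u x * Complex.exp (-(c * x : ℝ))) 0 x := fun x => by
    convert! (hu x).mul (hexp x) using 1
    ring
  have hconst : ∀ x y : ℝ, u x * Complex.exp (-(c * x : ℝ)) = u y * Complex.exp (-(c * y : ℝ)) :=
    is_const_of_deriv_eq_zero (fun x => (hd x).differentiableAt) fun x => (hd x).deriv
  by_contra hx
  have hpos : 0 < ‖u x‖ := norm_pos_iff.2 hx
  -- The shift makes the growth factor `exp (M / ‖u x‖) ≥ M / ‖u x‖ + 1`, so the norm there is at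
  -- least `M + ‖u x‖ > M`.
  have h1 := congrArg norm (hconst (x + M / ‖u x‖ / c) x)
  rw [norm_mul, norm_mul, Complex.norm_exp, Complex.norm_exp] at h1
  simp only [← Complex.ofReal_neg, Complex.ofReal_re] at h1
  have e : -(c * (x + M / ‖u x‖ / c)) = -(c * x) - M / ‖u x‖ := by field_simp; ring
  rw [e, sub_eq_add_neg, Real.exp_add, ← mul_assoc, mul_right_comm] at h1
  have h2 := mul_right_cancel₀ (Real.exp_pos _).ne' h1
  rw [Real.exp_neg, ← div_eq_mul_inv, div_eq_iff (Real.exp_pos _).ne'] at h2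
  have h3 := Real.add_one_le_exp (M / ‖u x‖)
  have h4 := hM (x + M / ‖u x‖ / c)
  have h5 : ‖u x‖ * (M / ‖u x‖ + 1) ≤ M := (mul_le_mul_of_nonneg_left h3 hpos.le).trans (h2 ▸ h4)
  rw [mul_add, mul_div_cancel₀ _ hpos.ne'] at h5
  linarith

namespace H1

variable {ρ : ℝ}

theorem hasDerivAt_rep (f : H1 ρ) {F : ℝ → ℂ} (hF : Continuous F) (h : der f =ᵐ[volume] F) (x : ℝ) :
    HasDerivAt f.rep (F x) x := by
  have h1 : f.rep = fun y => f.rep 0 + ∫ t in (0 : ℝ)..y, F t := by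
    funext y
    have := f.rep_sub_rep 0 y
    rw [sub_eq_iff_eq_add'] at this
    rw [this]
    congr 1
    apply intervalIntegral.integral_congr_ae
    filter_upwards [h] with t ht _
    exact ht
  rw [h1]
  exact (intervalIntegral.integral_hasDerivAt_right (hF.intervalIntegrable _ _)
    (hF.stronglyMeasurableAtFilter _ _) hF.continuousAt).const_add _

/-- If `f'` is the `H¹` function `g`, then `f` is classically differentiable. -/
theorem hasDerivAt_rep_of_der_eq {f g : H1 ρ} (h : der f = val g) (x : ℝ) :
    HasDerivAt f.rep (g.rep x) x :=
  f.hasDerivAt_rep g.continuous_rep (h ▸ g.val_ae_eq_rep) x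

/-- Factor `∂² - ρ² = (∂ - ρ)(∂ + ρ)`: the bounded function `f' + ρ f` solves `u' = ρ u`, hence
vanishes, and then the bounded `f` solves `f' = -ρ f`. -/
theorem eq_zero_of_second_deriv_eq (hρ : 0 < ρ) (f : H1 ρ)
    (h : HasWeakDerivL2 (der f) ((ρ : ℂ) ^ 2 • val f)) : f = 0 := by
  obtain ⟨g, hg, hg'⟩ := exists_of_hasWeakDeriv hρ.ne' h
  have d1 := fun x => hasDerivAt_rep_of_der_eq hg.symm x
  have hg2 : der g = val ((ρ : ℂ) ^ 2 • f) := by rw [hg', map_smul]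
  have d2 := fun x => hasDerivAt_rep_of_der_eq hg2 x
  have hs : ∀ x, ((ρ : ℂ) ^ 2 • f).rep x = (ρ : ℂ) ^ 2 * f.rep x := fun x => by
    rw [rep_smul]; rfl
  have hu := eq_zero_of_hasDerivAt_mul_of_bounded (u := fun x => g.rep x + ρ * f.rep x)
    (M := (1 + |ρ|) * ‖g‖ + ρ * ((1 + |ρ|) * ‖f‖)) hρ.ne' (fun x => by
      convert! (d2 x).add ((d1 x).const_mul (ρ : ℂ)) using 1
      rw [hs]; ring) (fun x => by
      refine (norm_add_le _ _).trans (add_le_add (g.norm_rep_le x) ?_)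
      rw [norm_mul, Complex.norm_real, Real.norm_of_nonneg hρ.le]
      exact mul_le_mul_of_nonneg_left (f.norm_rep_le x) hρ.le)
  have hf := eq_zero_of_hasDerivAt_mul_of_bounded (u := f.rep) (c := -ρ)
    (M := (1 + |ρ|) * ‖f‖) (neg_ne_zero.2 hρ.ne') (fun x => by
      convert! d1 x using 1
      rw [eq_neg_of_add_eq_zero_left (hu x)]; push_cast; ring) f.norm_rep_le
  apply val_injective hρ.ne'
  rw [map_zero]
  apply Lp.ext
  filter_upwards [f.val_ae_eq_rep, Lp.coeFn_zero ℂ 2 (volume : Measure ℝ)] with x h1 h2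
  rw [h1, hf x, h2]; rfl

end H1

/-- The resolvent `(-∂ₓₓ + ρ²)⁻¹ : L² → H¹`. -/
noncomputable def resolventG (ρ : ℝ) : L2C →L[ℂ] H1 ρ :=
  ((ρ : ℂ) ^ 2)⁻¹ • ContinuousLinearMap.adjoint H1.val

section Resolvent

open H1

variable {ρ : ℝ}

/-- The weak form of `(-∂ₓₓ + ρ²) G w = w`. It is the Riesz representation property of the adjoint
of `val`, since `ρ²` times the inner product of `H1 ρ` is the quadratic form of `-∂ₓₓ + ρ²`. -/
theorem inner_der_resolventG (hρ : ρ ≠ 0) (f : H1 ρ) (w : L2C) :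
    inner ℂ (der f) (der (resolventG ρ w)) + (ρ : ℂ) ^ 2 * inner ℂ (val f) (val (resolventG ρ w))
      = inner ℂ (val f) w := by
  have hρ' : (ρ : ℂ) ^ 2 ≠ 0 := pow_ne_zero 2 (Complex.ofReal_ne_zero.2 hρ)
  rw [add_comm, ← H1.inner_eq, resolventG, smul_apply, inner_smul_right,
    ContinuousLinearMap.adjoint_inner_right, mul_inv_cancel_left₀ hρ']

theorem hasWeakDeriv_der_resolventG (hρ : ρ ≠ 0) (w : L2C) :
    HasWeakDerivL2 (der (resolventG ρ w)) ((ρ : ℂ) ^ 2 • val (resolventG ρ w) - w) := by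
  rw [hasWeakDerivL2_iff_inner]
  intro ψ hψ hc
  obtain ⟨p, hp, hp'⟩ := exists_of_hasWeakDeriv hρ (testFunction_hasWeakDerivL2 hψ hc)
  have := inner_der_resolventG hρ p w
  rw [hp, hp'] at this
  rw [inner_sub_right, inner_smul_right, ← this]
  ring

/-- Both sides have the same image under `-∂ₓₓ + ρ²`, and their difference is an `H¹` solution of
`f'' = ρ² f`. -/
theorem eq_resolventG (hρ : 0 < ρ) (f : H1 ρ) {f₂ : L2C} (h : HasWeakDerivL2 (der f) f₂) :
    f = resolventG ρ ((ρ : ℂ) ^ 2 • val f - f₂) := by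
  rw [← sub_eq_zero]
  apply eq_zero_of_second_deriv_eq hρ
  rw [map_sub]
  convert! h.sub (hasWeakDeriv_der_resolventG hρ.ne' ((ρ : ℂ) ^ 2 • val f - f₂)) using 1
  rw [map_sub, smul_sub]
  abel

end Resolvent

/-! ### Compactness of multiplication by the potential -/

theorem isCompactOperator_finset_sum_smulRight {E F ι : Type*} [NormedAddCommGroup E]
    [NormedSpace ℂ E] [NormedAddCommGroup F] [NormedSpace ℂ F] (s : Finset ι) (ℓ : ι → E →L[ℂ] ℂ)
    (v : ι → F) :
    IsCompactOperator (∑ i ∈ s, (ℓ i).smulRight (v i) : E →L[ℂ] F) := by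
  classical
  induction s using Finset.induction_on with
  | empty => simpa using! isCompactOperator_zero
  | insert i s hi ih =>
    rw [Finset.sum_insert hi]
    refine IsCompactOperator.add ?_ ih
    have h : IsCompactOperator ((1 : ℂ →L[ℂ] ℂ).smulRight (v i)) :=
      isCompactOperator_of_locallyCompactSpace_rng
        ((1 : ℂ →L[ℂ] ℂ).smulRight (v i))
    simpa [Function.comp_def] using! h.comp_clm (ℓ i)

/-- A Hilbert–Schmidt operator is compact. -/
theorem isCompactOperator_of_sum_norm_sq_le {E F ι : Type*} [NormedAddCommGroup E]
    [InnerProductSpace ℂ E] [NormedAddCommGroup F] [NormedSpace ℂ F] [CompleteSpace F]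
    (b : HilbertBasis ι ℂ E) (T : E →L[ℂ] F) (C : ℝ)
    (h : ∀ s : Finset ι, ∑ i ∈ s, ‖T (b i)‖ ^ 2 ≤ C) : IsCompactOperator T := by
  classical
  have hsum : Summable fun i => ‖T (b i)‖ ^ 2 :=
    summable_of_sum_le (fun _ => sq_nonneg _) h
  -- Finite-rank truncations converge in operator norm: by Cauchy-Schwarz and Bessel the error is
  -- controlled by a tail of `∑ ‖T (b i)‖²`.
  refine isCompactOperator_of_tendsto (l := (atTop : Filter (Finset ι)))
    (F := fun s => ∑ i ∈ s, (innerSL ℂ (b i)).smulRight (T (b i))) ?_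
    (Eventually.of_forall fun s => isCompactOperator_finset_sum_smulRight s _ _)
  rw [Metric.tendsto_atTop]
  intro ε hε
  obtain ⟨s₀, hs₀⟩ := summable_iff_vanishing_norm.1 hsum ((ε / 2) ^ 2) (by positivity)
  refine ⟨s₀, fun s hs => ?_⟩
  rw [dist_comm, dist_eq_norm]
  refine lt_of_le_of_lt (ContinuousLinearMap.opNorm_le_bound _ (half_pos hε).le fun x => ?_)
    (half_lt_self hε)
  have hx := (b.hasSum_repr x).mapL T
  have hlim : Tendsto (fun t : Finset ι => ‖∑ i ∈ t, T (b.repr x i • b i) -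
      ∑ i ∈ s, T (b.repr x i • b i)‖) atTop (𝓝 ‖T x - ∑ i ∈ s, T (b.repr x i • b i)‖) :=
    (Tendsto.sub_const hx _).norm
  have e : (T - ∑ i ∈ s, (innerSL ℂ (b i)).smulRight (T (b i))) x
      = T x - ∑ i ∈ s, T (b.repr x i • b i) := by
    simp [b.repr_apply_apply]
  rw [e]
  refine le_of_tendsto hlim ?_
  filter_upwards [eventually_ge_atTop s] with t ht
  rw [← Finset.sum_sdiff ht, add_sub_cancel_right]
  have hT : ‖∑ i ∈ t \ s, T (b.repr x i • b i)‖ ≤ ∑ i ∈ t \ s, ‖b.repr x i‖ * ‖T (b i)‖ :=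
    (norm_sum_le _ _).trans (Finset.sum_le_sum fun i _ => by rw [map_smul, norm_smul])
  refine hT.trans ?_
  have hcs := Finset.sum_mul_sq_le_sq_mul_sq (t \ s) (fun i => ‖b.repr x i‖) fun i => ‖T (b i)‖
  have h1 : ∑ i ∈ t \ s, ‖b.repr x i‖ ^ 2 ≤ ‖x‖ ^ 2 := by
    simp only [b.repr_apply_apply]
    exact b.orthonormal.sum_inner_products_le x
  have h2 : ∑ i ∈ t \ s, ‖T (b i)‖ ^ 2 ≤ (ε / 2) ^ 2 := by
    have := hs₀ (t \ s) (Finset.disjoint_of_subset_right hs Finset.sdiff_disjoint)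
    rw [Real.norm_eq_abs] at this
    exact (le_abs_self _).trans this.le
  refine abs_le_of_sq_le_sq' ?_ (by positivity) |>.2
  rw [mul_comm (ε / 2), mul_pow]
  exact hcs.trans (mul_le_mul h1 h2 (Finset.sum_nonneg fun _ _ => sq_nonneg _) (sq_nonneg _))

/-- Multiplication by a bounded real function on `L²`. -/
noncomputable def mulOp (V : ℝ → ℝ) (h : MemLp (fun x => (V x : ℂ)) ⊤ volume) : L2C →L[ℂ] L2C :=
  (ContinuousLinearMap.mul ℂ ℂ).holderL volume ⊤ 2 2 (h.toLp _)

theorem mulOp_ae_eq {V : ℝ → ℝ} (h : MemLp (fun x => (V x : ℂ)) ⊤ volume) (f : L2C) :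
    mulOp V h f =ᵐ[volume] fun x => (V x : ℂ) * f x := by
  refine (ContinuousLinearMap.coeFn_holder _ _ _).trans ?_
  filter_upwards [h.coeFn_toLp] with x hx
  rw [hx]; rfl

theorem inner_mulOp {V : ℝ → ℝ} (h : MemLp (fun x => (V x : ℂ)) ⊤ volume) (f g : L2C) :
    inner ℂ (mulOp V h f) g = inner ℂ f (mulOp V h g) := by
  rw [L2.inner_def, L2.inner_def]
  apply integral_congr_ae
  filter_upwards [mulOp_ae_eq h f, mulOp_ae_eq h g] with x h1 h2
  rw [h1, h2]
  simp only [RCLike.inner_apply, map_mul, Complex.conj_ofReal]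
  ring

namespace H1

variable {ρ : ℝ}

/-- Bessel's inequality for the Riesz representative of evaluation at `x`. Integrated against `V²`,
it bounds the Hilbert-Schmidt norm of multiplication by `V`. -/
theorem sum_norm_rep_sq_le {ι : Type*} {b : ι → H1 ρ} (hb : Orthonormal ℂ b) (s : Finset ι)
    (x : ℝ) : ∑ i ∈ s, ‖(b i).rep x‖ ^ 2 ≤ (1 + |ρ|) ^ 2 := by
  set k := (InnerProductSpace.toDual ℂ (H1 ρ)).symm (eval x) with hk
  have h1 : ∀ i, ‖(b i).rep x‖ = ‖inner ℂ (b i) k‖ := fun i => by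
    rw [norm_inner_symm, hk, InnerProductSpace.toDual_symm_apply, eval_apply]
  simp_rw [h1]
  refine (hb.sum_inner_products_le k).trans ?_
  gcongr
  rw [hk, LinearIsometryEquiv.norm_map]
  exact norm_eval_le x

/-- Multiplication by a bounded square-integrable potential is compact from `H¹` to `L²`. -/
theorem isCompactOperator_mulOp_val {V : ℝ → ℝ} (h : MemLp (fun x => (V x : ℂ)) ⊤ volume)
    (h2 : MemLp (fun x => (V x : ℂ)) 2 volume) :
    IsCompactOperator ((mulOp V h).comp (val : H1 ρ →L[ℂ] L2C)) := by
  obtain ⟨w, b, -⟩ := exists_hilbertBasis ℂ (H1 ρ)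
  have hV2 : Integrable fun x => V x ^ 2 := by
    have := h2.integrable_norm_pow (by norm_num)
    simpa using this
  refine isCompactOperator_of_sum_norm_sq_le b _ ((∫ x, V x ^ 2) * (1 + |ρ|) ^ 2) fun s => ?_
  have hnorm : ∀ i, ‖mulOp V h (val (b i))‖ ^ 2 = ∫ x, V x ^ 2 * ‖(b i).rep x‖ ^ 2 := fun i => by
    rw [← inner_self_eq_norm_sq (𝕜 := ℂ), L2.inner_def, ← integral_re (L2.integrable_inner _ _)]
    apply integral_congr_ae
    filter_upwards [mulOp_ae_eq h (val (b i)), (b i).val_ae_eq_rep] with x h1 h2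
    rw [inner_self_eq_norm_sq, h1, h2, norm_mul, mul_pow, Complex.norm_real, Real.norm_eq_abs,
      sq_abs]
  have hint : ∀ i, Integrable fun x => V x ^ 2 * ‖(b i).rep x‖ ^ 2 := fun i =>
    hV2.mul_bdd (c := ((1 + |ρ|) * ‖b i‖) ^ 2)
      ((b i).continuous_rep.norm.pow 2).aestronglyMeasurable (Eventually.of_forall fun x => by
        rw [norm_pow, norm_norm]
        exact pow_le_pow_left₀ (norm_nonneg _) ((b i).norm_rep_le x) 2)
  simp only [ContinuousLinearMap.comp_apply]
  simp_rw [hnorm]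
  rw [← integral_finsetSum _ fun i _ => hint i, ← integral_mul_const]
  refine integral_mono (integrable_finsetSum _ fun i _ => hint i) (hV2.mul_const _) fun x => ?_
  simp only [← Finset.mul_sum]
  exact mul_le_mul_of_nonneg_left (sum_norm_rep_sq_le b.orthonormal s x) (sq_nonneg _)

end H1

/-! ### Simplicity of the eigenvalue -/

theorem eq_zero_of_linear_second_order_ode {a : ℝ → ℝ} {K : ℝ} (ha : ∀ x, |a x| ≤ K) {u v : ℝ → ℂ}
    (hu : ∀ x, HasDerivAt u (v x) x) (hv : ∀ x, HasDerivAt v (a x * u x) x) {x₀ : ℝ}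
    (hu0 : u x₀ = 0) (hv0 : v x₀ = 0) : u = 0 := by
  let F : ℝ → ℂ × ℂ → ℂ × ℂ := fun t p => (p.2, a t * p.1)
  have hK : 0 ≤ K := (abs_nonneg _).trans (ha 0)
  have hF : ∀ t, LipschitzWith (max 1 K).toNNReal (F t) := fun t => by
    refine LipschitzWith.of_dist_le_mul fun p q => ?_
    rw [Real.coe_toNNReal _ (by positivity), Prod.dist_eq, Prod.dist_eq]
    refine max_le ?_ ?_
    · calc dist p.2 q.2 ≤ 1 * max (dist p.1 q.1) (dist p.2 q.2) := by simp
        _ ≤ _ := by gcongr; exact le_max_left _ _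
    · change dist ((a t : ℂ) * p.1) ((a t : ℂ) * q.1) ≤ _
      rw [dist_eq_norm, ← mul_sub, norm_mul, Complex.norm_real, Real.norm_eq_abs, ← dist_eq_norm]
      gcongr
      · exact (ha t).trans (le_max_right _ _)
      · exact le_max_left _ _
  have h := ODE_solution_unique_univ (v := F) (s := fun _ => Set.univ) (t₀ := x₀)
    (f := fun x => (u x, v x)) (g := fun _ => 0) (fun t => (hF t).lipschitzOnWith)
    (fun t => ⟨(hu t).prodMk (hv t), trivial⟩)
    (fun t => ⟨by simpa [F] using! hasDerivAt_const t (0 : ℂ × ℂ), trivial⟩) (by simp [hu0, hv0])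
  funext x
  exact congrArg Prod.fst (congrFun h x)

namespace H1

variable {ρ : ℝ}

theorem memLp_rep (f : H1 ρ) : MemLp f.rep 2 volume :=
  (memLp_congr_ae f.val_ae_eq_rep).1 (Lp.memLp _)

/-- The eigenspace of a one-dimensional Schrödinger operator is one-dimensional. -/
theorem exists_eq_smul_of_second_deriv {V : ℝ → ℝ} (hVc : Continuous V) {A : ℝ}
    (hVA : ∀ x, |V x| ≤ A) (h : MemLp (fun x => (V x : ℂ)) ⊤ volume) (hρ : ρ ≠ 0)
    {f k : H1 ρ} (hf0 : f ≠ 0)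
    (hf : HasWeakDerivL2 (der f) ((ρ : ℂ) ^ 2 • val f + mulOp V h (val f)))
    (hk : HasWeakDerivL2 (der k) ((ρ : ℂ) ^ 2 • val k + mulOp V h (val k))) :
    ∃ c : ℂ, k = c • f := by
  have classical : ∀ {f g : H1 ρ}, val g = der f →
      der g = (ρ : ℂ) ^ 2 • val f + mulOp V h (val f) →
      (∀ x, HasDerivAt f.rep (g.rep x) x) ∧
      ∀ x, HasDerivAt g.rep (((ρ ^ 2 + V x : ℝ) : ℂ) * f.rep x) x := by
    intro f g hg hg'
    refine ⟨hasDerivAt_rep_of_der_eq hg.symm, g.hasDerivAt_rep (F := fun x =>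
      ((ρ ^ 2 + V x : ℝ) : ℂ) * f.rep x) ?_ ?_⟩
    · exact (Complex.continuous_ofReal.comp (continuous_const.add hVc)).mul f.continuous_rep
    · rw [hg']
      filter_upwards [Lp.coeFn_add ((ρ : ℂ) ^ 2 • val f) (mulOp V h (val f)),
        Lp.coeFn_smul ((ρ : ℂ) ^ 2) (val f), mulOp_ae_eq h (val f), f.val_ae_eq_rep]
        with x h1 h2 h3 h4
      rw [h1, Pi.add_apply, h2, Pi.smul_apply, h3, h4, smul_eq_mul]
      push_cast
      ring
  obtain ⟨g, hg, hg'⟩ := exists_of_hasWeakDeriv hρ hf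
  obtain ⟨l, hl, hl'⟩ := exists_of_hasWeakDeriv hρ hk
  obtain ⟨f1, f2⟩ := classical hg hg'
  obtain ⟨k1, k2⟩ := classical hl hl'
  -- The Wronskian is constant, and it is integrable as a combination of products of `L²` functions,
  -- so it is zero.
  have hWd : ∀ x, HasDerivAt (fun x => f.rep x * l.rep x - k.rep x * g.rep x) 0 x := fun x => by
    convert! ((f1 x).mul (k2 x)).sub ((k1 x).mul (f2 x)) using 1
    ring
  have hWc : ∀ x y, f.rep x * l.rep x - k.rep x * g.rep x
      = f.rep y * l.rep y - k.rep y * g.rep y :=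
    is_const_of_deriv_eq_zero (fun x => (hWd x).differentiableAt) fun x => (hWd x).deriv
  have hWi : Integrable fun x => f.rep x * l.rep x - k.rep x * g.rep x :=
    (f.memLp_rep.integrable_mul l.memLp_rep).sub (k.memLp_rep.integrable_mul g.memLp_rep)
  have hW : ∀ x, f.rep x * l.rep x - k.rep x * g.rep x = 0 := fun x => by
    have : (fun y => f.rep y * l.rep y - k.rep y * g.rep y) =
        fun _ => f.rep x * l.rep x - k.rep x * g.rep x := funext fun y => hWc y x
    rw [this, integrable_const_iff] at hWi
    rcases hWi with h | h
    · exact h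
    · exact absurd h.measure_univ_lt_top (by simp)
  obtain ⟨x₀, hx₀⟩ : ∃ x, f.rep x ≠ 0 := by
    by_contra! hcon
    apply hf0
    apply val_injective hρ
    rw [map_zero]
    apply Lp.ext
    filter_upwards [f.val_ae_eq_rep, Lp.coeFn_zero ℂ 2 (volume : Measure ℝ)] with x h1 h2
    rw [h1, hcon x, h2]; rfl
  -- With this `c`, `k - c f` vanishes at `x₀`. Its derivative vanishes there too, because the
  -- Wronskian does and `f.rep x₀ ≠ 0`.
  set c := k.rep x₀ / f.rep x₀ with hc
  have hc0 : k.rep x₀ = c * f.rep x₀ := by rw [hc, div_mul_cancel₀ _ hx₀]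
  have hz := eq_zero_of_linear_second_order_ode (a := fun x => ρ ^ 2 + V x) (K := ρ ^ 2 + A)
    (u := fun x => k.rep x - c * f.rep x) (v := fun x => l.rep x - c * g.rep x) (x₀ := x₀)
    (fun x => (abs_add_le _ _).trans (by rw [abs_of_nonneg (sq_nonneg ρ)]; linarith [hVA x]))
    (fun x => (k1 x).sub ((f1 x).const_mul c))
    (fun x => by
      convert! (k2 x).sub ((f2 x).const_mul c) using 1
      ring) (by rw [hc0, sub_self])
    (by
      have := hW x₀
      rw [hc0] at this
      apply mul_left_cancel₀ hx₀
      linear_combination this)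
  refine ⟨c, val_injective hρ ?_⟩
  apply Lp.ext
  rw [map_smul]
  filter_upwards [f.val_ae_eq_rep, k.val_ae_eq_rep, Lp.coeFn_smul c (val f)] with x h1 h2 h3
  rw [h2, h3, Pi.smul_apply, h1, smul_eq_mul]
  exact sub_eq_zero.1 (congrFun hz x)

end H1

/-! ### Invertibility of the linearized bound state operator -/

section Linearization

open H1

variable {ρ : ℝ}

theorem second_deriv_of_eq_resolventG (hρ : ρ ≠ 0) {V : ℝ → ℝ}
    {h : MemLp (fun x => (V x : ℂ)) ⊤ volume} {f : H1 ρ}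
    (hf : f = resolventG ρ (-mulOp V h (val f))) :
    HasWeakDerivL2 (der f) ((ρ : ℂ) ^ 2 • val f + mulOp V h (val f)) := by
  have := hasWeakDeriv_der_resolventG hρ (-mulOp V h (val f))
  rwa [← hf, sub_neg_eq_add] at this

/-- The linearization at the eigenfunction `φ` of the bound state equation, in the unknowns `(w, e)`
with `k = (-∂ₓₓ + ρ²)⁻¹ w`: `(w, e) ↦ ((-∂ₓₓ + ρ² + V) k - e φ, (φ, k))`. -/
noncomputable def linOp (V : ℝ → ℝ) (h : MemLp (fun x => (V x : ℂ)) ⊤ volume) (φ : H1 ρ) :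
    L2C × ℂ →L[ℂ] L2C × ℂ :=
  (ContinuousLinearMap.fst ℂ L2C ℂ +
      (mulOp V h ∘L val) ∘L (resolventG ρ ∘L ContinuousLinearMap.fst ℂ L2C ℂ) -
      (ContinuousLinearMap.snd ℂ L2C ℂ).smulRight (val φ)).prod
    (innerSL ℂ (val φ) ∘L val ∘L resolventG ρ ∘L ContinuousLinearMap.fst ℂ L2C ℂ)

theorem linOp_apply (V : ℝ → ℝ) (h : MemLp (fun x => (V x : ℂ)) ⊤ volume) (φ : H1 ρ)
    (w : L2C) (e : ℂ) : linOp V h φ (w, e) =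
      (w + mulOp V h (val (resolventG ρ w)) - e • val φ,
        inner ℂ (val φ) (val (resolventG ρ w))) := rfl

/-- Taking `w` rather than `k = G w` as unknown makes the principal part the identity. What remains
is `V G`, a rank-one term, and a second component with values in `ℂ`. -/
theorem isCompactOperator_one_sub_linOp {V : ℝ → ℝ} (h : MemLp (fun x => (V x : ℂ)) ⊤ volume)
    (h2 : MemLp (fun x => (V x : ℂ)) 2 volume) (φ : H1 ρ) :
    IsCompactOperator (1 - linOp V h φ : L2C × ℂ →L[ℂ] L2C × ℂ) := by
  have c1 : IsCompactOperator ((mulOp V h ∘L val) ∘L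
      (resolventG ρ ∘L ContinuousLinearMap.fst ℂ L2C ℂ)) :=
    IsCompactOperator.comp_clm (isCompactOperator_mulOp_val h h2)
      (resolventG ρ ∘L ContinuousLinearMap.fst ℂ L2C ℂ)
  have c2 := isCompactOperator_finset_sum_smulRight {()}
    (fun _ => ContinuousLinearMap.snd ℂ L2C ℂ) (fun _ => val φ)
  have c3 := isCompactOperator_of_locallyCompactSpace_dom (ContinuousLinearMap.snd ℂ L2C ℂ -
    innerSL ℂ (val φ) ∘L val ∘L resolventG ρ ∘L ContinuousLinearMap.fst ℂ L2C ℂ)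
  have c := ((c2.sub c1).clm_comp (ContinuousLinearMap.inl ℂ L2C ℂ)).add
    (c3.clm_comp (ContinuousLinearMap.inr ℂ L2C ℂ))
  refine Eq.mp (congrArg IsCompactOperator (funext fun p => ?_)) c
  refine Prod.ext ?_ ?_
  · simp [linOp]
    abel
  · simp [linOp]

/-- Pairing the first component with `φ` removes `(-∂ₓₓ + ρ² + V) k` by symmetry and leaves `e ‖φ‖²
= 0`. Then `k` is a multiple of `φ` by simplicity, and the second component says that it is
orthogonal to `φ`. -/
theorem linOp_injective {V : ℝ → ℝ} (hVc : Continuous V) {A : ℝ}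
    (hVA : ∀ x, |V x| ≤ A) (h : MemLp (fun x => (V x : ℂ)) ⊤ volume) (hρ : 0 < ρ) {φ : H1 ρ}
    (hφ0 : φ ≠ 0) (hφ : φ = resolventG ρ (-mulOp V h (val φ))) {w : L2C} {e : ℂ}
    (hw : linOp V h φ (w, e) = 0) : w = 0 ∧ e = 0 := by
  rw [linOp_apply, Prod.mk_eq_zero] at hw
  obtain ⟨hw1, hw2⟩ := hw
  set k := resolventG ρ w with hk
  have hv0 : val φ ≠ 0 := fun h0 => hφ0 (val_injective hρ.ne' (by rw [h0, map_zero]))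
  have s1 := inner_der_resolventG hρ.ne' φ w
  have s2 := inner_der_resolventG hρ.ne' k (-mulOp V h (val φ))
  rw [← hφ] at s2
  rw [← hk] at s1
  have s3 := congrArg (starRingEnd ℂ) s2
  simp only [map_add, map_mul, inner_conj_symm, map_pow, Complex.conj_ofReal] at s3
  rw [s1, inner_neg_left, inner_mulOp] at s3
  have s4 : inner ℂ (val φ) (w + mulOp V h (val k) - e • val φ) = 0 := by rw [hw1, inner_zero_right]
  rw [inner_sub_right, inner_add_right, s3, neg_add_cancel, zero_sub, neg_eq_zero,
    inner_smul_right, mul_eq_zero, inner_self_eq_zero] at s4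
  have he : e = 0 := s4.resolve_right hv0
  rw [he, zero_smul, sub_zero] at hw1
  have hwk : w = -mulOp V h (val k) := eq_neg_of_add_eq_zero_left hw1
  have hkk : k = resolventG ρ (-mulOp V h (val k)) := by rw [← hwk]
  obtain ⟨c, hc⟩ := exists_eq_smul_of_second_deriv hVc hVA h hρ.ne' hφ0
    (second_deriv_of_eq_resolventG hρ.ne' hφ) (second_deriv_of_eq_resolventG hρ.ne' hkk)
  rw [hc, map_smul, inner_smul_right, mul_eq_zero, inner_self_eq_zero] at hw2
  rw [hw2.resolve_right hv0, zero_smul] at hc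
  rw [hc, map_zero, map_zero, neg_zero] at hwk
  exact ⟨hwk, he⟩

/-- Fredholm alternative for the compact operator `1 - linOp`: either 1 is an eigenvalue, which
injectivity excludes, or `linOp` is invertible. -/
theorem exists_continuousLinearEquiv_linOp {V : ℝ → ℝ} (hVc : Continuous V) {A : ℝ}
    (hVA : ∀ x, |V x| ≤ A) (h : MemLp (fun x => (V x : ℂ)) ⊤ volume)
    (h2 : MemLp (fun x => (V x : ℂ)) 2 volume) (hρ : 0 < ρ) {φ : H1 ρ}
    (hφ0 : φ ≠ 0) (hφ : φ = resolventG ρ (-mulOp V h (val φ))) :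
    ∃ T : (L2C × ℂ) ≃L[ℂ] (L2C × ℂ), (T : L2C × ℂ →L[ℂ] L2C × ℂ) = linOp V h φ := by
  have hc := isCompactOperator_one_sub_linOp h h2 φ
  rcases hc.hasEigenvalue_or_mem_resolventSet (one_ne_zero (α := ℂ)) with hev | hres
  · exfalso
    obtain ⟨p, hp⟩ := hev.exists_hasEigenvector
    have := hp.apply_eq_smul
    rw [one_smul] at this
    have h0 : linOp V h φ (p.1, p.2) = 0 := by
      simpa using! this
    obtain ⟨h1, h2⟩ := linOp_injective hVc hVA h hρ hφ0 hφ h0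
    exact hp.2 (Prod.ext h1 h2)
  · rw [spectrum.mem_resolventSet_iff, map_one, sub_sub_cancel] at hres
    obtain ⟨u, hu⟩ := hres
    exact ⟨ContinuousLinearEquiv.ofUnit u, by rw [← hu]; rfl⟩

end Linearization

/-! ### The cubic nonlinearity from `H¹` to `L²` -/

namespace H1

variable {ρ : ℝ}

/-- The nonlinearity `f ↦ |f|² f`, from `H¹` to `L²`. -/
noncomputable def cubic (f : H1 ρ) : L2C := tri f f f

theorem cubic_ae_eq (f : H1 ρ) :
    cubic f =ᵐ[volume] fun x => ((‖val f x‖ ^ 2 : ℝ) : ℂ) * val f x := by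
  filter_upwards [tri_ae_eq f f f] with x hx
  rw [cubic, hx, ← mul_assoc, Complex.mul_conj, Complex.normSq_eq_norm_sq]

theorem norm_tri_le (a b c : H1 ρ) :
    ‖tri a b c‖ ≤ (1 + |ρ|) ^ 2 * ‖a‖ * ‖b‖ * ‖val c‖ := by
  refine Lp.norm_le_mul_norm_of_ae_le_mul ?_
  filter_upwards [tri_ae_eq a b c, a.norm_val_ae_le, b.norm_val_ae_le] with x h ha hb
  rw [h, norm_mul, norm_mul, RCLike.norm_conj, ← mul_assoc]
  refine mul_le_mul_of_nonneg_right ?_ (norm_nonneg _)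
  refine (mul_le_mul ha hb (norm_nonneg _) (by positivity)).trans_eq ?_
  ring

theorem norm_cubic_le (f : H1 ρ) : ‖cubic f‖ ≤ (1 + |ρ|) ^ 2 * ‖f‖ ^ 3 := by
  refine (norm_tri_le f f f).trans ?_
  have := f.norm_val_le
  calc (1 + |ρ|) ^ 2 * ‖f‖ * ‖f‖ * ‖val f‖ ≤ (1 + |ρ|) ^ 2 * ‖f‖ * ‖f‖ * ‖f‖ := by gcongr
    _ = _ := by ring

/-- Phase covariance and homogeneity together: the equation for `z f` divided by `z` depends on `z`
only through the coupling `|z|²`. -/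
theorem cubic_smul (c : ℂ) (f : H1 ρ) :
    cubic (c • f) = (((‖c‖ ^ 2 : ℝ) : ℂ) * c) • cubic f := by
  apply Lp.ext
  filter_upwards [cubic_ae_eq (c • f), cubic_ae_eq f, Lp.coeFn_smul c (val f),
    Lp.coeFn_smul (((‖c‖ ^ 2 : ℝ) : ℂ) * c) (cubic f)] with x h1 h2 h3 h4
  rw [map_smul] at h1
  rw [h1, h4, Pi.smul_apply, h2, h3, Pi.smul_apply, smul_eq_mul, smul_eq_mul, norm_mul]
  push_cast
  ring

/-- That this pairing is real gives both the reality of the nonlinear eigenvalue and the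
conservation of mass. -/
theorem inner_tri_self (f g : H1 ρ) :
    inner ℂ (val g) (tri f f g) = ((∫ x, ‖val f x‖ ^ 2 * ‖val g x‖ ^ 2 : ℝ) : ℂ) := by
  rw [L2.inner_def, ← integral_complex_ofReal]
  apply integral_congr_ae
  filter_upwards [tri_ae_eq f f g] with x hx
  rw [hx, RCLike.inner_apply, ← mul_assoc, Complex.mul_conj, mul_assoc, Complex.mul_conj,
    Complex.normSq_eq_norm_sq, Complex.normSq_eq_norm_sq]
  push_cast; ring

section Smooth

/-- The bounded real bilinear multiplication `L^∞ × L² → L²`. -/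
noncomputable abbrev mulL : Lp ℂ ⊤ (volume : Measure ℝ) →L[ℝ] L2C →L[ℝ] L2C :=
  (ContinuousLinearMap.mul ℝ ℂ).holderL volume ⊤ 2 2

/-- Complex conjugation on the Sobolev embedding `H¹ → L^∞`. -/
noncomputable def conjLinf : H1 ρ →L[ℝ] Lp ℂ ⊤ (volume : Measure ℝ) :=
  ((Complex.conjCLE : ℂ →L[ℝ] ℂ).compLpL ⊤ volume) ∘L (toLinf.restrictScalars ℝ)

theorem tri_eq (a b c : H1 ρ) : tri a b c =
    mulL (toLinf.restrictScalars ℝ a) (mulL (conjLinf b) (val.restrictScalars ℝ c)) := rfl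

theorem contDiff_cubic {n : ℕ∞ω} : ContDiff ℝ n (cubic : H1 ρ → L2C) := by
  have h1 : ContDiff ℝ n fun f : H1 ρ => mulL (toLinf.restrictScalars ℝ f) :=
    (mulL ∘L (toLinf.restrictScalars ℝ)).contDiff
  have h2 : ContDiff ℝ n fun f : H1 ρ => mulL (conjLinf f) := (mulL ∘L conjLinf).contDiff
  exact h1.clm_apply (h2.clm_apply (val.restrictScalars ℝ).contDiff)

theorem hasDerivAt_cubic {q : ℝ → H1 ρ} {q' : H1 ρ} {t : ℝ} (hq : HasDerivAt q q' t) :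
    HasDerivAt (fun t => cubic (q t))
      (tri q' (q t) (q t) + tri (q t) q' (q t) + tri (q t) (q t) q') t := by
  have h1 : HasDerivAt (fun t => mulL (toLinf.restrictScalars ℝ (q t)))
      (mulL (toLinf.restrictScalars ℝ q')) t :=
    (mulL ∘L (toLinf.restrictScalars ℝ)).hasFDerivAt.comp_hasDerivAt t hq
  have h2 : HasDerivAt (fun t => mulL (conjLinf (q t))) (mulL (conjLinf q')) t :=
    (mulL ∘L conjLinf).hasFDerivAt.comp_hasDerivAt t hq
  have h3 : HasDerivAt (fun t => val.restrictScalars ℝ (q t)) (val.restrictScalars ℝ q') t :=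
    (val.restrictScalars ℝ).hasFDerivAt.comp_hasDerivAt t hq
  convert! h1.clm_apply (h2.clm_apply h3) using 1
  rw [map_add, tri_eq, tri_eq, tri_eq, add_assoc]

end Smooth

end H1

/-! ### The bifurcating branch -/

section Branch

open H1

variable {ρ : ℝ}

/-- The bound state equation for `r (φ + (-∂ₓₓ + ρ²)⁻¹ w)`, energy `-ρ² + e`, divided by `r`, with
`s = r²`. -/
noncomputable def branchMap (V : ℝ → ℝ) (h : MemLp (fun x => (V x : ℂ)) ⊤ volume) (φ : H1 ρ)
    (p : ℝ × L2C × ℂ) : L2C × ℂ :=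
  linOp V h φ p.2 - (p.2.2 • val (resolventG ρ p.2.1) + p.1 • cubic (φ + resolventG ρ p.2.1), 0)

theorem branchMap_eq_zero_iff {V : ℝ → ℝ} {h : MemLp (fun x => (V x : ℂ)) ⊤ volume} {φ : H1 ρ}
    {s : ℝ} {w : L2C} {e : ℂ} : branchMap V h φ (s, w, e) = 0 ↔
      w + mulOp V h (val (resolventG ρ w)) =
        e • val (φ + resolventG ρ w) + s • cubic (φ + resolventG ρ w) ∧
      inner ℂ (val φ) (val (resolventG ρ w)) = 0 := by
  rw [branchMap, linOp_apply, Prod.mk_sub_mk, Prod.mk_eq_zero, sub_zero]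
  refine and_congr ?_ Iff.rfl
  rw [map_add, smul_add, sub_sub, ← add_assoc, sub_eq_zero]

theorem contDiff_branchMap (V : ℝ → ℝ) (h : MemLp (fun x => (V x : ℂ)) ⊤ volume) (φ : H1 ρ)
    {n : ℕ∞ω} : ContDiff ℝ n (branchMap V h φ) := by
  have h1 : ContDiff ℝ n fun p : ℝ × L2C × ℂ => linOp V h φ p.2 :=
    ((linOp V h φ).restrictScalars ℝ).contDiff.comp contDiff_snd
  have h2 : ContDiff ℝ n fun p : ℝ × L2C × ℂ => p.2.1 := contDiff_fst.comp contDiff_snd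
  have h3 : ContDiff ℝ n fun p : ℝ × L2C × ℂ => p.2.2 := contDiff_snd.comp contDiff_snd
  have h4 : ContDiff ℝ n fun p : ℝ × L2C × ℂ => resolventG ρ p.2.1 :=
    ((resolventG ρ).restrictScalars ℝ).contDiff.comp h2
  have h5 : ContDiff ℝ n fun p : ℝ × L2C × ℂ => val (resolventG ρ p.2.1) :=
    (val.restrictScalars ℝ).contDiff.comp h4
  exact h1.sub (((h3.smul h5).add (contDiff_fst.smul
    (contDiff_cubic.comp (contDiff_const.add h4)))).prodMk contDiff_const)

/-- At `s = 0` the only nonlinear term left is `e • G w`, which is quadratic at the origin. -/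
theorem hasFDerivAt_branchMap_snd (V : ℝ → ℝ) (h : MemLp (fun x => (V x : ℂ)) ⊤ volume) (φ : H1 ρ) :
    HasFDerivAt (fun y : L2C × ℂ => branchMap V h φ (0, y)) ((linOp V h φ).restrictScalars ℝ) 0 := by
  have h1 : HasFDerivAt (fun y : L2C × ℂ => linOp V h φ y) ((linOp V h φ).restrictScalars ℝ) 0 :=
    ((linOp V h φ).restrictScalars ℝ).hasFDerivAt
  have h2 : HasFDerivAt (fun y : L2C × ℂ => ((y.2 • val (resolventG ρ y.1), 0) : L2C × ℂ))
      (0 : L2C × ℂ →L[ℝ] L2C × ℂ) 0 := by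
    set C := ‖(val : H1 ρ →L[ℂ] L2C) ∘L resolventG ρ‖ with hC
    rw [hasFDerivAt_iff_isLittleO_nhds_zero]
    have hb : (fun y : L2C × ℂ => ((y.2 • val (resolventG ρ y.1), 0) : L2C × ℂ)) =O[𝓝 0]
        fun y => ‖y‖ ^ 2 := by
      refine IsBigO.of_bound C (Eventually.of_forall fun y => ?_)
      rw [Prod.norm_mk, norm_zero, max_eq_left (norm_nonneg _), norm_smul, norm_pow, norm_norm]
      have h3 : ‖val (resolventG ρ y.1)‖ ≤ C * ‖y.1‖ :=
        ((val : H1 ρ →L[ℂ] L2C) ∘L resolventG ρ).le_opNorm y.1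
      calc ‖y.2‖ * ‖val (resolventG ρ y.1)‖ ≤ ‖y‖ * (C * ‖y‖) := by
            gcongr
            · exact norm_snd_le y
            · exact h3.trans (by gcongr; exact norm_fst_le y)
        _ = _ := by ring
    have ho : (fun y : L2C × ℂ => ‖y‖ ^ 2) =o[𝓝 0] fun y => y :=
      isLittleO_norm_pow_id one_lt_two
    simpa using hb.trans_isLittleO ho
  have h3 := h1.sub h2
  rw [sub_zero] at h3
  refine h3.congr_of_eventuallyEq (Eventually.of_forall fun y => ?_)
  simp [branchMap]

/-- The implicit function theorem at the origin, where the partial derivative in `(w, e)` is the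
invertible `linOp`. Order 2 is kept because the modulation map contains `DQ` and has to be of class
C¹. -/
theorem exists_branch {V : ℝ → ℝ} (hVc : Continuous V) {A : ℝ}
    (hVA : ∀ x, |V x| ≤ A) (h : MemLp (fun x => (V x : ℂ)) ⊤ volume)
    (h2 : MemLp (fun x => (V x : ℂ)) 2 volume) (hρ : 0 < ρ) {φ : H1 ρ}
    (hφ0 : φ ≠ 0) (hφ : φ = resolventG ρ (-mulOp V h (val φ))) :
    ∃ (w : ℝ → L2C) (e : ℝ → ℂ), ContDiffAt ℝ 2 w 0 ∧ ContDiffAt ℝ 2 e 0 ∧ w 0 = 0 ∧ e 0 = 0 ∧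
      (∀ᶠ s in 𝓝 0, branchMap V h φ (s, w s, e s) = 0) ∧
      ∀ᶠ p in 𝓝 (0 : ℝ × L2C × ℂ), branchMap V h φ p = 0 → w p.1 = p.2.1 ∧ e p.1 = p.2.2 := by
  obtain ⟨T, hT⟩ := exists_continuousLinearEquiv_linOp hVc hVA h h2 hρ hφ0 hφ
  have hcd : ContDiffAt ℝ 2 (branchMap V h φ) 0 := (contDiff_branchMap V h φ).contDiffAt
  have h0 : branchMap V h φ 0 = 0 := by simp [branchMap]
  have hpart : fderiv ℝ (branchMap V h φ) 0 ∘L .inr ℝ ℝ (L2C × ℂ) =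
      (linOp V h φ).restrictScalars ℝ := by
    have hd := (hcd.differentiableAt (by norm_num)).hasFDerivAt
    have hc := HasFDerivAt.comp (0 : L2C × ℂ) (g := branchMap V h φ)
      (f := ContinuousLinearMap.inr ℝ ℝ (L2C × ℂ)) (by rw [map_zero]; exact hd)
      (ContinuousLinearMap.inr ℝ ℝ (L2C × ℂ)).hasFDerivAt
    exact hc.unique (hasFDerivAt_branchMap_snd V h φ)
  have hinv : (fderiv ℝ (branchMap V h φ) 0 ∘L .inr ℝ ℝ (L2C × ℂ)).IsInvertible := by
    rw [hpart]
    refine ⟨T.restrictScalars ℝ, ?_⟩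
    rw [← hT]; rfl
  have two : (2 : ℕ∞ω) ≠ 0 := by norm_num
  set ψ := hcd.implicitFunction two hinv with hψ
  have c1 : ContDiffAt ℝ 2 ψ 0 := hcd.contDiffAt_implicitFunction two hinv
  have c2 : ψ 0 = 0 := hcd.implicitFunction_apply_self two hinv
  have c3 := hcd.eventually_apply_implicitFunction two hinv
  have c4 := hcd.eventually_apply_eq_iff_implicitFunction two hinv
  rw [h0] at c3 c4
  refine ⟨fun s => (ψ s).1, fun s => (ψ s).2, contDiffAt_fst.comp _ c1, contDiffAt_snd.comp _ c1,
    by simp [c2], by simp [c2], c3, ?_⟩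
  filter_upwards [c4] with p hp hp0
  have := hp.1 hp0
  exact ⟨congrArg Prod.fst this, congrArg Prod.snd this⟩

end Branch

/-! ### Integrability of the potential -/

section Potential

variable {V : ℝ → ℝ} {ρ : ℝ} {φ : L2C}

theorem integrable_exp_neg_mul_abs {γ : ℝ} (hγ : 0 < γ) :
    Integrable fun x : ℝ => Real.exp (-γ * |x|) := by
  rw [← integrableOn_univ, ← Set.Iic_union_Ioi (a := (0 : ℝ))]
  refine IntegrableOn.union ?_ ?_
  · refine (integrableOn_exp_mul_Iic hγ 0).congr_fun (fun x hx => ?_) measurableSet_Iic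
    simp only [abs_of_nonpos (Set.mem_Iic.1 hx), neg_mul_neg]
  · refine (integrableOn_exp_mul_Ioi (neg_neg_of_pos hγ) 0).congr_fun (fun x hx => ?_)
      measurableSet_Ioi
    simp only [abs_of_pos (Set.mem_Ioi.1 hx)]

theorem PotentialAssumption.exists_bound (hV : PotentialAssumption V ρ φ) :
    ∃ A : ℝ, ∀ x, |V x| ≤ A := by
  obtain ⟨A, γ, hγ, h⟩ := hV.decay
  have hA : 0 ≤ A := by
    have := (abs_nonneg _).trans (h 0)
    simpa using this
  exact ⟨A, fun x => (h x).trans (mul_le_of_le_one_right hA (Real.exp_le_one_iff.2 (by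
    nlinarith [abs_nonneg x])))⟩

theorem PotentialAssumption.memLp_top (hV : PotentialAssumption V ρ φ) :
    MemLp (fun x => (V x : ℂ)) ⊤ volume := by
  obtain ⟨A, hA⟩ := hV.exists_bound
  exact memLp_top_of_bound
    (Complex.continuous_ofReal.comp hV.smooth.continuous).aestronglyMeasurable A
    (Eventually.of_forall fun x => by simpa using hA x)

theorem PotentialAssumption.memLp_two (hV : PotentialAssumption V ρ φ) :
    MemLp (fun x => (V x : ℂ)) 2 volume := by
  obtain ⟨A, γ, hγ, h⟩ := hV.decay
  have hm := (Complex.continuous_ofReal.comp hV.smooth.continuous).aestronglyMeasurable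
    (μ := (volume : Measure ℝ))
  refine (memLp_two_iff_integrable_sq_norm hm).2 ?_
  refine ((integrable_exp_neg_mul_abs (mul_pos two_pos hγ)).const_mul (A ^ 2)).mono'
    (hm.norm.pow 2) (Eventually.of_forall fun x => ?_)
  have h1 : |V x| ^ 2 ≤ (A * Real.exp (-γ * |x|)) ^ 2 := pow_le_pow_left₀ (abs_nonneg _) (h x) 2
  rw [mul_pow, ← Real.exp_nat_mul] at h1
  simp only [Function.comp_apply, Complex.norm_real, Real.norm_eq_abs, abs_pow, abs_abs]
  refine h1.trans_eq ?_
  congr 2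
  push_cast; ring

end Potential

/-! ### The bound state equation in terms of the resolvent -/

section BoundState

open H1

variable {V : ℝ → ℝ} {ρ : ℝ}

/-- For `q = G W` one has `q'' = ρ² q - W`, so the second-order equation turns into an identity in
`L²` without derivatives. -/
theorem isNonlinearBoundState_of_eq (hρ : ρ ≠ 0) (h : MemLp (fun x => (V x : ℂ)) ⊤ volume)
    {W : L2C} {E : ℝ}
    (hW : W + mulOp V h (val (resolventG ρ W)) =
      ((E + ρ ^ 2 : ℝ) : ℂ) • val (resolventG ρ W) + cubic (resolventG ρ W)) :
    IsNonlinearBoundState V (val (resolventG ρ W)) E := by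
  set q := resolventG ρ W with hq
  refine ⟨der q, (ρ : ℂ) ^ 2 • val q - W, hasWeakDeriv q, hasWeakDeriv_der_resolventG hρ W, ?_⟩
  have hW' : W = ((E + ρ ^ 2 : ℝ) : ℂ) • val q + cubic q - mulOp V h (val q) := by
    rw [← hW, add_sub_cancel_right]
  have e : (ρ : ℂ) ^ 2 • val q - W = mulOp V h (val q) - (E : ℂ) • val q - cubic q := by
    rw [hW']; push_cast; module
  rw [e]
  filter_upwards [Lp.coeFn_sub (mulOp V h (val q) - (E : ℂ) • val q) (cubic q),
    Lp.coeFn_sub (mulOp V h (val q)) ((E : ℂ) • val q), Lp.coeFn_smul (E : ℂ) (val q),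
    mulOp_ae_eq h (val q), cubic_ae_eq q] with x h1 h2 h3 h4 h5
  rw [h1, Pi.sub_apply, h2, Pi.sub_apply, h3, Pi.smul_apply, h4, h5, smul_eq_mul]
  ring

theorem IsNonlinearBoundState.exists_eq (hρ : 0 < ρ) (h : MemLp (fun x => (V x : ℂ)) ⊤ volume)
    {Q : L2C} {E : ℝ} (hQ : IsNonlinearBoundState V Q E) :
    ∃ W : L2C, val (resolventG ρ W) = Q ∧ W + mulOp V h (val (resolventG ρ W)) =
      ((E + ρ ^ 2 : ℝ) : ℂ) • val (resolventG ρ W) + cubic (resolventG ρ W) := by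
  obtain ⟨Q₁, Q₂, h1, h2, h3⟩ := hQ
  obtain ⟨q, rfl, rfl⟩ := exists_of_hasWeakDeriv hρ.ne' h1
  have hq := eq_resolventG hρ q h2
  refine ⟨(ρ : ℂ) ^ 2 • val q - Q₂, by rw [← hq], ?_⟩
  rw [← hq]
  have e : Q₂ = mulOp V h (val q) - (E : ℂ) • val q - cubic q := by
    apply Lp.ext
    filter_upwards [Lp.coeFn_sub (mulOp V h (val q) - (E : ℂ) • val q) (cubic q),
      Lp.coeFn_sub (mulOp V h (val q)) ((E : ℂ) • val q), Lp.coeFn_smul (E : ℂ) (val q),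
      mulOp_ae_eq h (val q), cubic_ae_eq q, h3] with x h1 h2 h3 h4 h5 h6
    rw [h1, Pi.sub_apply, h2, Pi.sub_apply, h3, Pi.smul_apply, h4, h5, smul_eq_mul]
    linear_combination -h6
  rw [e]; push_cast; module

theorem eigenfunction_eq_resolventG (hρ : 0 < ρ) (h : MemLp (fun x => (V x : ℂ)) ⊤ volume)
    {φ : L2C} (hφ : IsEigenfunctionSchr V (-ρ ^ 2) φ) :
    ∃ f : H1 ρ, val f = φ ∧ f = resolventG ρ (-mulOp V h (val f)) := by
  obtain ⟨-, φ₁, φ₂, h1, h2, h3⟩ := hφ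
  obtain ⟨q, rfl, rfl⟩ := exists_of_hasWeakDeriv hρ.ne' h1
  refine ⟨q, rfl, ?_⟩
  have hq := eq_resolventG hρ q h2
  have e : (ρ : ℂ) ^ 2 • val q - φ₂ = -mulOp V h (val q) := by
    apply Lp.ext
    filter_upwards [Lp.coeFn_sub ((ρ : ℂ) ^ 2 • val q) φ₂, Lp.coeFn_smul ((ρ : ℂ) ^ 2) (val q),
      mulOp_ae_eq h (val q), Lp.coeFn_neg (mulOp V h (val q)), h3] with x h1 h2 h3 h4 h5
    rw [h1, Pi.sub_apply, h2, Pi.smul_apply, h4, Pi.neg_apply, h3, smul_eq_mul]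
    push_cast at h5
    linear_combination h5
  rwa [e] at hq

theorem exists_h2NormLE_resolventG (hρ : 0 < ρ) :
    ∃ K : ℝ, 0 < K ∧ ∀ w : L2C, H2NormLE (val (resolventG ρ w)) (K * ‖w‖) := by
  set G := ‖resolventG ρ‖ with hG
  refine ⟨G + ρ * G + (ρ ^ 2 * G + 1), by positivity, fun w => ?_⟩
  refine ⟨_, _, hasWeakDeriv _, hasWeakDeriv_der_resolventG hρ.ne' w, ?_⟩
  set k := resolventG ρ w with hk
  have h0 : ‖k‖ ≤ G * ‖w‖ := (resolventG ρ).le_opNorm w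
  have h1 : ‖val k‖ ≤ G * ‖w‖ := k.norm_val_le.trans h0
  have h2 : ‖der k‖ ≤ ρ * G * ‖w‖ := by
    refine k.norm_der_le.trans ?_
    rw [abs_of_pos hρ, mul_assoc]
    gcongr
  have h3 : ‖(ρ : ℂ) ^ 2 • val k - w‖ ≤ (ρ ^ 2 * G + 1) * ‖w‖ := by
    refine (norm_sub_le _ _).trans ?_
    rw [norm_smul, norm_pow, Complex.norm_real, Real.norm_of_nonneg hρ.le, add_mul, one_mul,
      mul_assoc]
    gcongr
  rw [Real.sqrt_le_left (by positivity)]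
  nlinarith [norm_nonneg (val k), norm_nonneg (der k), norm_nonneg ((ρ : ℂ) ^ 2 • val k - w)]

theorem norm_le_of_h2NormLE (hρ : 0 < ρ) {k : H1 ρ} {r : ℝ} (h : H2NormLE (val k) r) :
    ‖k‖ ≤ (1 + ρ⁻¹) * r := by
  obtain ⟨f₁, f₂, h1, -, h3⟩ := h
  obtain rfl := h1.unique (hasWeakDeriv k)
  have hr : 0 ≤ r := (Real.sqrt_nonneg _).trans h3
  have h4 := (Real.sqrt_le_left hr).1 h3
  have a1 : ‖val k‖ ^ 2 ≤ r ^ 2 := by nlinarith [sq_nonneg ‖der k‖, sq_nonneg ‖f₂‖]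
  have a2 : ‖der k‖ ^ 2 ≤ r ^ 2 := by nlinarith [sq_nonneg ‖val k‖, sq_nonneg ‖f₂‖]
  have e := k.norm_sq_eq
  have e' : ‖k‖ ^ 2 = ‖val k‖ ^ 2 + (ρ⁻¹) ^ 2 * ‖der k‖ ^ 2 := by
    field_simp
    linarith
  have hi : 0 < ρ⁻¹ := inv_pos.2 hρ
  refine abs_le_of_sq_le_sq' ?_ (by positivity) |>.2
  rw [e']
  calc ‖val k‖ ^ 2 + ρ⁻¹ ^ 2 * ‖der k‖ ^ 2 ≤ r ^ 2 + ρ⁻¹ ^ 2 * r ^ 2 := by gcongr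
    _ ≤ _ := by nlinarith [mul_nonneg hi.le (sq_nonneg r)]

/-- The Lagrange multiplier of a bound state is real. -/
theorem im_eq_zero_of_bound_state (hρ : ρ ≠ 0) (h : MemLp (fun x => (V x : ℂ)) ⊤ volume)
    {W : L2C} {e : ℂ} {s : ℝ} (hW : W + mulOp V h (val (resolventG ρ W)) =
      e • val (resolventG ρ W) + s • cubic (resolventG ρ W)) (h0 : val (resolventG ρ W) ≠ 0) :
    e.im = 0 := by
  set q := resolventG ρ W with hq
  -- Tested against `q`, every term other than `e ‖q‖²` is real.
  have h1 := inner_der_resolventG hρ q W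
  rw [← hq] at h1
  have h2 := congrArg (fun f => (inner ℂ (val q) f : ℂ)) hW
  simp only [inner_add_right, inner_smul_right] at h2
  have h3 : (inner ℂ (val q) (s • cubic q) : ℂ) = s * inner ℂ (val q) (cubic q) := by
    rw [← inner_smul_right]; rfl
  rw [h3, cubic, inner_tri_self, ← h1] at h2
  have h4 : (inner ℂ (val q) (mulOp V h (val q)) : ℂ).im = 0 := by
    rw [← Complex.conj_eq_iff_im, inner_conj_symm, inner_mulOp]
  have r1 : (inner ℂ (val q) (val q) : ℂ) = ((‖val q‖ ^ 2 : ℝ) : ℂ) := by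
    rw [inner_self_eq_norm_sq_to_K]; push_cast; rfl
  have r2 : (inner ℂ (der q) (der q) : ℂ) = ((‖der q‖ ^ 2 : ℝ) : ℂ) := by
    rw [inner_self_eq_norm_sq_to_K]; push_cast; rfl
  rw [r1, r2] at h2
  have h5 := congrArg Complex.im h2
  rw [← Complex.ofReal_pow, ← Complex.ofReal_mul, ← Complex.ofReal_mul] at h5
  simp only [Complex.add_im, Complex.ofReal_im, Complex.mul_im, Complex.ofReal_re, h4, mul_zero,
    zero_add, add_zero] at h5
  exact (mul_eq_zero.1 h5.symm).resolve_right (by positivity)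

end BoundState

/-! ### The family of small bound states -/

open H1

/-- A priori estimate for small bound states: the remainder is controlled by `δ² |z|`. -/
theorem norm_remainder_le {V : ℝ → ℝ} {ρ : ℝ} (h : MemLp (fun x => (V x : ℂ)) ⊤ volume) {φ : H1 ρ} (T : (L2C × ℂ) ≃L[ℂ] (L2C × ℂ))
    (hT : (T : L2C × ℂ →L[ℂ] L2C × ℂ) = linOp V h φ) (K : ℝ) {r : ℝ} (hr : 0 < r) :
    ∃ δ₀ : ℝ, 0 < δ₀ ∧ ∀ δ, 0 < δ → δ ≤ δ₀ → ∀ (z : ℂ) (w : L2C) (e : ℂ), ‖z‖ < δ → ‖e‖ ≤ δ →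
      ‖resolventG ρ w‖ ≤ K * δ → inner ℂ (val φ) (val (resolventG ρ w)) = 0 →
      w + mulOp V h (val (resolventG ρ w)) =
        e • val (z • φ + resolventG ρ w) + cubic (z • φ + resolventG ρ w) →
      ‖w‖ ≤ r * ‖z‖ := by
  set CT := ‖(T.symm : L2C × ℂ →L[ℂ] L2C × ℂ)‖ with hCT
  set G := ‖resolventG ρ‖ with hG
  set S := (1 + |ρ|) ^ 2 with hS
  set D := (‖φ‖ + K) ^ 2 with hD
  -- `a δ` and `b δ` are the coefficients of `‖w‖` and `‖z‖` in the bound on `‖w‖`. Both tend to 0,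
  -- so the `a` term can be absorbed on the left.
  let a : ℝ → ℝ := fun δ => CT * (δ * G + S * (D * δ ^ 2) * G)
  let b : ℝ → ℝ := fun δ => CT * (S * (D * δ ^ 2) * ‖φ‖)
  have ha : Tendsto a (𝓝 0) (𝓝 0) := by
    have : Continuous a := by fun_prop
    simpa [a] using this.tendsto 0
  have hb : Tendsto b (𝓝 0) (𝓝 0) := by
    have : Continuous b := by fun_prop
    simpa [b] using this.tendsto 0
  obtain ⟨δ₀, hδ₀, hball⟩ := Metric.eventually_nhds_iff.1
    ((ha.eventually_lt_const (show (0 : ℝ) < 1 / 2 by norm_num)).and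
      (hb.eventually_lt_const (show (0 : ℝ) < r / 2 by positivity)))
  refine ⟨δ₀ / 2, by positivity, fun δ hδ hδ' z w e hz he hw hort heq => ?_⟩
  obtain ⟨ha2, hb2⟩ := hball (y := δ) (by rw [Real.dist_eq, sub_zero, abs_of_pos hδ]; linarith)
  set k := resolventG ρ w with hk
  set q := z • φ + k with hq
  -- The term `e z φ` is taken as the second unknown of `linOp`. Only `e k` and the cubic term
  -- remain on the right, and both are small relative to `‖z‖ + ‖w‖`.
  have hlin : linOp V h φ (w, e * z) = (e • val k + cubic q, 0) := by
    rw [linOp_apply, ← hk, hort, heq, hq, map_add, map_smul, smul_add, smul_smul]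
    congr 1
    abel
  have hTw : (w, e * z) = T.symm (e • val k + cubic q, 0) := by
    rw [← hlin, ← hT]; simp
  have h1 : ‖w‖ ≤ CT * (‖e‖ * ‖k‖ + S * ‖q‖ ^ 3) := by
    calc ‖w‖ ≤ ‖((w, e * z) : L2C × ℂ)‖ := norm_fst_le ((w, e * z) : L2C × ℂ)
      _ = ‖(T.symm : L2C × ℂ →L[ℂ] L2C × ℂ) (e • val k + cubic q, 0)‖ := by rw [hTw]; rfl
      _ ≤ CT * ‖((e • val k + cubic q, 0) : L2C × ℂ)‖ := ContinuousLinearMap.le_opNorm _ _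
      _ ≤ CT * (‖e‖ * ‖k‖ + S * ‖q‖ ^ 3) := by
        rw [Prod.norm_mk, norm_zero, max_eq_left (norm_nonneg _)]
        gcongr
        refine (norm_add_le _ _).trans (add_le_add ?_ (norm_cubic_le q))
        rw [norm_smul]
        gcongr
        exact k.norm_val_le
  have hkw : ‖k‖ ≤ G * ‖w‖ := (resolventG ρ).le_opNorm w
  have hq1 : ‖q‖ ≤ ‖z‖ * ‖φ‖ + ‖k‖ := (norm_add_le _ _).trans_eq (by rw [norm_smul])
  have hq2 : ‖q‖ ≤ (‖φ‖ + K) * δ := hq1.trans (by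
    rw [add_mul, mul_comm ‖φ‖]
    gcongr)
  have hq3 : ‖q‖ ^ 3 ≤ D * δ ^ 2 * (‖z‖ * ‖φ‖ + G * ‖w‖) := by
    calc ‖q‖ ^ 3 = ‖q‖ ^ 2 * ‖q‖ := by ring
      _ ≤ ((‖φ‖ + K) * δ) ^ 2 * (‖z‖ * ‖φ‖ + G * ‖w‖) := by
        gcongr
        exact hq1.trans (by gcongr)
      _ = _ := by rw [hD]; ring
  have h2 : ‖w‖ ≤ a δ * ‖w‖ + b δ * ‖z‖ := by
    calc ‖w‖ ≤ CT * (‖e‖ * ‖k‖ + S * ‖q‖ ^ 3) := h1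
      _ ≤ CT * (δ * (G * ‖w‖) + S * (D * δ ^ 2 * (‖z‖ * ‖φ‖ + G * ‖w‖))) := by gcongr
      _ = _ := by simp only [a, b]; ring
  have h3 : a δ * ‖w‖ ≤ 1 / 2 * ‖w‖ := by gcongr
  have h4 : b δ * ‖z‖ ≤ r / 2 * ‖z‖ := by gcongr
  linarith

/-- Existence, uniqueness and regularity of the family of small bound states
`Q[z] = (-∂ₓₓ + ρ²)⁻¹ W[z]`. -/
theorem exists_boundStateFamily {V : ℝ → ℝ} {ρ : ℝ} {φ : L2C} (hV : PotentialAssumption V ρ φ) :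
    ∃ δ₀ : ℝ, 0 < δ₀ ∧ ∃ (W : ℂ → L2C) (E : ℂ → ℝ),
      (∀ δ, 0 < δ → δ ≤ δ₀ →
        IsBoundStateFamily V ρ φ δ (fun z => val (resolventG ρ (W z))) E) ∧
      (∀ z, ‖z‖ < δ₀ → ContDiffAt ℝ 2 W z) ∧
      (∀ z, ‖z‖ < δ₀ → DifferentiableAt ℝ E z) ∧
      (∀ z, ‖z‖ < δ₀ → W z + mulOp V hV.memLp_top (val (resolventG ρ (W z))) =
        ((E z + ρ ^ 2 : ℝ) : ℂ) • val (resolventG ρ (W z)) + cubic (resolventG ρ (W z))) ∧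
      (∀ c z : ℂ, ‖c‖ = 1 → W (c * z) = c • W z) ∧
      W 0 = 0 ∧
      ∀ v : ℂ, fderiv ℝ (fun z => val (resolventG ρ (W z))) 0 v = v • φ := by
  have hρ := hV.rho_pos
  have h := hV.memLp_top
  have h2 := hV.memLp_two
  obtain ⟨A, hVA⟩ := hV.exists_bound
  have hVc := hV.smooth.continuous
  obtain ⟨φ, rfl, hφ⟩ := eigenfunction_eq_resolventG hρ h hV.eigen
  have hφn : ‖val φ‖ = 1 := hV.normalized
  have hφ0 : φ ≠ 0 := by
    rintro rfl
    rw [map_zero, norm_zero] at hφn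
    exact zero_ne_one hφn
  obtain ⟨T, hT⟩ := exists_continuousLinearEquiv_linOp hVc hVA h h2 hρ hφ0 hφ
  obtain ⟨w, e, hw, he, hw0, he0, hbr, huniq⟩ := exists_branch hVc hVA h h2 hρ hφ0 hφ
  -- radius on which all the local statements hold
  obtain ⟨C, hC, hwC, heC⟩ : ∃ C : ℝ, 0 < C ∧ (∀ᶠ s in 𝓝 (0 : ℝ), ‖w s‖ ≤ C * |s|) ∧
      ∀ᶠ s in 𝓝 (0 : ℝ), ‖e s‖ ≤ C * |s| := by
    have l1 := (hw.differentiableAt (by norm_num)).isBigO_sub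
    have l2 := (he.differentiableAt (by norm_num)).isBigO_sub
    simp only [hw0, he0, sub_zero] at l1 l2
    obtain ⟨C1, hC1, l1⟩ := l1.exists_pos
    obtain ⟨C2, hC2, l2⟩ := l2.exists_pos
    refine ⟨max C1 C2, lt_max_of_lt_left hC1, ?_, ?_⟩
    · filter_upwards [l1.bound] with s hs
      exact hs.trans (by rw [Real.norm_eq_abs]; gcongr; exact le_max_left _ _)
    · filter_upwards [l2.bound] with s hs
      exact hs.trans (by rw [Real.norm_eq_abs]; gcongr; exact le_max_right _ _)
  obtain ⟨r, hr, hball⟩ := Metric.eventually_nhds_iff.1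
    ((hw.eventually (by norm_num)).and ((he.eventually (by norm_num)).and
      (hbr.and (hwC.and heC))))
  obtain ⟨r', hr', huniq⟩ := Metric.eventually_nhds_iff.1 huniq
  obtain ⟨K, hK, hH2⟩ := exists_h2NormLE_resolventG hρ
  obtain ⟨δ₁, hδ₁, hapriori⟩ := norm_remainder_le h T hT (1 + ρ⁻¹) (half_pos hr')
  -- Since `φ = -G (V φ)`, this is the `W` for which `G (W z) = z (φ + G (w (|z|²)))`. It is smooth
  -- also at `z = 0` because `|z|²` is.
  set W : ℂ → L2C := fun z => z • (w (‖z‖ ^ 2) - mulOp V h (val φ)) with hWdef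
  set E : ℂ → ℝ := fun z => (e (‖z‖ ^ 2)).re - ρ ^ 2 with hEdef
  have hGW : ∀ z, resolventG ρ (W z) = z • (φ + resolventG ρ (w (‖z‖ ^ 2))) := fun z => by
    have hφ' : resolventG ρ (mulOp V h (val φ)) = -φ := by
      rw [map_neg] at hφ
      rw [eq_neg_iff_add_eq_zero, add_comm, ← eq_neg_iff_add_eq_zero]
      exact hφ
    rw [hWdef, map_smul, map_sub, hφ', sub_neg_eq_add, add_comm]
  -- The bound 1 gives `|z|² ≤ |z|`; `r` keeps `|z|²` on the branch; `δ₁` serves the a priori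
  -- estimate; `r' / 2` puts competitors in the neighborhood of local uniqueness; the last two give
  -- `K C |z| ≤ 1` and `C |z| ≤ 1` for the bounds on `Q - z φ` and on `E + ρ²`.
  set δ₀ := min (min (min 1 r) (min δ₁ (r' / 2))) (min (1 / (K * C)) (1 / C)) with hδ₀
  have hδ₀pos : 0 < δ₀ := by positivity
  have b1 : δ₀ ≤ 1 := (min_le_left _ _).trans ((min_le_left _ _).trans (min_le_left _ _))
  have b2 : δ₀ ≤ r := (min_le_left _ _).trans ((min_le_left _ _).trans (min_le_right _ _))
  have b3 : δ₀ ≤ δ₁ := (min_le_left _ _).trans ((min_le_right _ _).trans (min_le_left _ _))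
  have b4 : δ₀ ≤ r' / 2 := (min_le_left _ _).trans ((min_le_right _ _).trans (min_le_right _ _))
  have b5 : δ₀ ≤ 1 / (K * C) := (min_le_right _ _).trans (min_le_left _ _)
  have b6 : δ₀ ≤ 1 / C := (min_le_right _ _).trans (min_le_right _ _)
  have hsq : ∀ z : ℂ, ‖z‖ < δ₀ → ‖z‖ ^ 2 ≤ ‖z‖ := fun z hz => by
    nlinarith [norm_nonneg z]
  have hdist : ∀ z : ℂ, ‖z‖ < δ₀ → dist (‖z‖ ^ 2) (0 : ℝ) < r := fun z hz => by
    rw [Real.dist_eq, sub_zero, abs_of_nonneg (sq_nonneg _)]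
    exact (hsq z hz).trans_lt (hz.trans_le b2)
  have hns : ∀ z : ℂ, ContDiffAt ℝ 2 (fun z : ℂ => ‖z‖ ^ 2) z := fun z =>
    (contDiff_norm_sq ℝ).contDiffAt
  have hWsm : ∀ z, ‖z‖ < δ₀ → ContDiffAt ℝ 2 W z := fun z hz => by
    have h1 : ContDiffAt ℝ 2 (fun z : ℂ => w (‖z‖ ^ 2)) z :=
      ContDiffAt.comp z (hball (hdist z hz)).1 (hns z)
    exact contDiffAt_id.smul (h1.sub contDiffAt_const)
  have hEsm : ∀ z, ‖z‖ < δ₀ → DifferentiableAt ℝ E z := fun z hz => by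
    have h1 : ContDiffAt ℝ 2 (fun z : ℂ => e (‖z‖ ^ 2)) z :=
      ContDiffAt.comp z (hball (hdist z hz)).2.1 (hns z)
    exact ((Complex.reCLM.contDiff.contDiffAt.comp z h1).differentiableAt (by norm_num)).sub_const _
  have hbrz : ∀ z : ℂ, ‖z‖ < δ₀ → w (‖z‖ ^ 2) + mulOp V h (val (resolventG ρ (w (‖z‖ ^ 2)))) =
      e (‖z‖ ^ 2) • val (φ + resolventG ρ (w (‖z‖ ^ 2))) +
        (‖z‖ ^ 2) • cubic (φ + resolventG ρ (w (‖z‖ ^ 2))) ∧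
      inner ℂ (val φ) (val (resolventG ρ (w (‖z‖ ^ 2)))) = 0 := fun z hz =>
    branchMap_eq_zero_iff.1 (hball (hdist z hz)).2.2.1
  -- The branch has a complex multiplier `e`, matching the complex orthogonality constraint. Its
  -- imaginary part vanishes a posteriori.
  have hreal : ∀ z : ℂ, ‖z‖ < δ₀ → e (‖z‖ ^ 2) = ((E z + ρ ^ 2 : ℝ) : ℂ) := fun z hz => by
    obtain ⟨g1, g2⟩ := hbrz z hz
    have hG : φ + resolventG ρ (w (‖z‖ ^ 2)) =
        resolventG ρ (w (‖z‖ ^ 2) - mulOp V h (val φ)) := by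
      conv_lhs => rw [hφ, ← map_add]
      congr 1
      abel
    have hne : val (φ + resolventG ρ (w (‖z‖ ^ 2))) ≠ 0 := fun h0 => by
      have := congrArg (fun f => (inner ℂ (val φ) f : ℂ)) h0
      simp only [map_add, inner_add_right, g2, inner_zero_right, add_zero,
        inner_self_eq_zero] at this
      rw [this, norm_zero] at hφn
      exact zero_ne_one hφn
    have him := im_eq_zero_of_bound_state hρ.ne' h (W := w (‖z‖ ^ 2) - mulOp V h (val φ))
      (e := e (‖z‖ ^ 2)) (s := ‖z‖ ^ 2) (by
        rw [← hG, ← g1, map_add, map_add]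
        abel) (by rwa [← hG])
    rw [hEdef]
    apply Complex.ext <;> simp [him]
  have hrs : ∀ (s : ℝ) (f : L2C), s • f = (s : ℂ) • f := fun s f => rfl
  have heq : ∀ z, ‖z‖ < δ₀ → W z + mulOp V h (val (resolventG ρ (W z))) =
      ((E z + ρ ^ 2 : ℝ) : ℂ) • val (resolventG ρ (W z)) + cubic (resolventG ρ (W z)) := by
    intro z hz
    obtain ⟨g1, g2⟩ := hbrz z hz
    rw [hGW, cubic_smul, map_smul, map_smul, ← hreal z hz, mul_comm _ z, mul_smul, smul_comm _ z,
      ← smul_add, ← smul_add, ← hrs, ← g1, map_add, map_add]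
    congr 1
    abel
  have hrem : ∀ z, val (resolventG ρ (W z)) - z • val φ = val (resolventG ρ (z • w (‖z‖ ^ 2))) := by
    intro z
    simp only [hGW, smul_add, map_add, map_smul, add_sub_cancel_left]
  have hwz : ∀ z : ℂ, ‖z‖ < δ₀ → K * ‖z • w (‖z‖ ^ 2)‖ ≤ K * C * ‖z‖ ^ 2 * ‖z‖ := fun z hz => by
    have := (hball (hdist z hz)).2.2.2.1
    rw [abs_of_nonneg (sq_nonneg _)] at this
    rw [norm_smul]
    calc K * (‖z‖ * ‖w (‖z‖ ^ 2)‖) ≤ K * (‖z‖ * (C * ‖z‖ ^ 2)) := by gcongr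
      _ = _ := by ring
  have hH2mono : ∀ {f : L2C} {a b : ℝ}, H2NormLE f a → a ≤ b → H2NormLE f b :=
    fun ⟨f₁, f₂, x1, x2, x3⟩ hab => ⟨f₁, f₂, x1, x2, x3.trans hab⟩
  have hQd : ∀ z, ‖z‖ < δ₀ → DifferentiableAt ℝ (fun z => val (resolventG ρ (W z))) z :=
    fun z hz => ((((val : H1 ρ →L[ℂ] L2C) ∘L resolventG ρ).restrictScalars ℝ).differentiableAt).comp
      z ((hWsm z hz).differentiableAt (by norm_num))
  have hEb : ∀ z, ‖z‖ < δ₀ → |E z + ρ ^ 2| ≤ C * ‖z‖ ^ 2 := fun z hz => by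
    have := (hball (hdist z hz)).2.2.2.2
    rwa [hreal z hz, Complex.norm_real, Real.norm_eq_abs, abs_of_nonneg (sq_nonneg ‖z‖)] at this
  refine ⟨δ₀, hδ₀pos, W, E, fun δ hδ hδ' => ?_, hWsm, hEsm, heq, ?_, by simp [hWdef], ?_⟩
  · constructor
    · intro z hz
      have hz' := hz.trans_le hδ'
      refine ⟨isNonlinearBoundState_of_eq hρ.ne' h (heq z hz'), ?_, ?_, ?_⟩
      · rw [hrem, map_smul, map_smul, inner_smul_right, (hbrz z hz').2, mul_zero]
      · rw [hrem]
        refine hH2mono (hH2 _) ((hwz z hz').trans ?_)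
        have : K * C * ‖z‖ ≤ 1 := by
          have := (hz'.le).trans b5
          rwa [le_div_iff₀ (by positivity), mul_comm] at this
        have hz1 := hsq z hz'
        nlinarith [norm_nonneg z]
      · refine (hEb z hz').trans ?_
        have : C * ‖z‖ ≤ 1 := by
          have := (hz'.le).trans b6
          rwa [le_div_iff₀ (by positivity), mul_comm] at this
        nlinarith [norm_nonneg z]
    · intro z hz0 hz Q' E' ⟨hQ', hort, hQn, hE'⟩
      have hz' := hz.trans_le hδ'
      obtain ⟨W', rfl, hW'⟩ := hQ'.exists_eq hρ h
      -- This undoes the substitution: `G w₁` is the component of the competitor orthogonal to `φ`.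
      set w₁ := W' + z • mulOp V h (val φ) with hw₁
      have hk : resolventG ρ W' = z • φ + resolventG ρ w₁ := by
        rw [hw₁, map_add, map_smul]
        have : φ = -resolventG ρ (mulOp V h (val φ)) := by rw [← map_neg]; exact hφ
        conv_rhs => enter [1]; rw [this]
        rw [smul_neg]; abel
      have hk' : val (resolventG ρ W') - z • val φ = val (resolventG ρ w₁) := by
        rw [hk, map_add, map_smul, add_sub_cancel_left]
      rw [hk'] at hort hQn
      clear_value w₁
      have hw₁eq : w₁ + mulOp V h (val (resolventG ρ w₁)) =
          ((E' + ρ ^ 2 : ℝ) : ℂ) • val (z • φ + resolventG ρ w₁) +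
            cubic (z • φ + resolventG ρ w₁) := by
        rw [← hk, ← hW', hk, map_add, map_add, map_smul, map_smul, ← add_assoc, ← hw₁]
      have hen : ‖((E' + ρ ^ 2 : ℝ) : ℂ)‖ ≤ δ := by
        rw [Complex.norm_real]; exact hE'
      have hsmall := hapriori δ hδ (hδ'.trans b3) z w₁ _ hz hen
        (norm_le_of_h2NormLE hρ hQn) hort hw₁eq
      have hzn : 0 < ‖z‖ := norm_pos_iff.2 hz0
      -- The class bounds `w₁` only by a multiple of `δ`, whereas uniqueness on the branch needs `w₁
      -- / z` small. The a priori estimate `‖w₁‖ ≤ (r' / 2) ‖z‖` bridges this gap.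
      set w₂ := z⁻¹ • w₁ with hw₂
      have hw₁₂ : w₁ = z • w₂ := (smul_inv_smul₀ hz0 w₁).symm
      have hw₂n : ‖w₂‖ ≤ r' / 2 := by
        rw [hw₂, norm_smul, norm_inv, inv_mul_le_iff₀ hzn, mul_comm]
        exact hsmall
      have hb0 : branchMap V h φ (‖z‖ ^ 2, w₂, ((E' + ρ ^ 2 : ℝ) : ℂ)) = 0 := by
        rw [branchMap_eq_zero_iff]
        constructor
        · apply smul_right_injective L2C hz0
          have e1 : z • φ + resolventG ρ w₁ = z • (φ + resolventG ρ w₂) := by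
            rw [hw₁₂, map_smul, smul_add]
          rw [e1, cubic_smul, map_smul, mul_comm _ z, mul_smul, smul_comm _ z, ← smul_add,
            hw₁₂, map_smul, map_smul, map_smul, ← smul_add] at hw₁eq
          exact hw₁eq
        · rw [hw₂, map_smul, map_smul, inner_smul_right, hort, mul_zero]
      have hd : dist ((‖z‖ ^ 2, w₂, ((E' + ρ ^ 2 : ℝ) : ℂ)) : ℝ × L2C × ℂ) 0 < r' := by
        rw [dist_zero_right, Prod.norm_mk, Prod.norm_mk]
        refine max_lt ?_ (max_lt ?_ ?_)
        · rw [Real.norm_of_nonneg (sq_nonneg _)]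
          linarith [hsq z hz']
        · linarith
        · linarith [hen]
      obtain ⟨u1, u2⟩ := huniq hd hb0
      simp only at u1 u2
      constructor
      · rw [hk, hw₁₂, ← u1]
        rw [hGW, smul_add, map_smul (resolventG ρ)]
      · rw [hreal z hz', Complex.ofReal_inj] at u2
        linarith
    · refine ⟨1, fun z hz => ?_⟩
      have hz' := hz.trans_le hδ'
      change H2NormLE (val (resolventG ρ (W z)) - z • val φ) _
      rw [hrem, one_mul]
      refine hH2mono (hH2 _) ((hwz z hz').trans ?_)
      have : K * C * ‖z‖ ≤ 1 := by
        have := (hz'.le).trans b5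
        rwa [le_div_iff₀ (by positivity), mul_comm] at this
      nlinarith [sq_nonneg ‖z‖]
    · have h1 : (fun z : ℂ => E z + ρ ^ 2) =O[𝓝 0] fun z : ℂ => ‖z‖ ^ 2 := by
        refine IsBigO.of_bound C ?_
        filter_upwards [Metric.ball_mem_nhds (0 : ℂ) hδ₀pos] with z hz
        rw [Real.norm_eq_abs, norm_pow, norm_norm]
        exact hEb z (by simpa using hz)
      exact h1.trans_isLittleO (isLittleO_norm_pow_id one_lt_two)
    · exact fun z hz => hQd z (hz.trans_le hδ')
  · intro c z hc
    simp only [hWdef, norm_mul, hc, one_mul, mul_smul]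
  · intro v
    -- In the product rule at `z = 0` the derivative of the second factor is multiplied by 0, and
    -- the second factor itself equals `-V φ` there.
    have h1 : HasFDerivAt W (ContinuousLinearMap.smulRight (1 : ℂ →L[ℝ] ℂ)
        (-mulOp V h (val φ))) 0 := by
      have hd : HasFDerivAt (fun z : ℂ => w (‖z‖ ^ 2) - mulOp V h (val φ))
          (fderiv ℝ (fun z : ℂ => w (‖z‖ ^ 2) - mulOp V h (val φ)) 0) 0 := by
        have g1 : ContDiffAt ℝ 2 (fun z : ℂ => w (‖z‖ ^ 2)) 0 :=
          ContDiffAt.comp 0 (hball (hdist 0 (by simpa using hδ₀pos))).1 (hns 0)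
        exact ((g1.sub contDiffAt_const).differentiableAt (by norm_num)).hasFDerivAt
      have := (hasFDerivAt_id (𝕜 := ℝ) (0 : ℂ)).smul hd
      refine this.congr_fderiv ?_
      ext u
      simp [hw0]
    have h2 := ((((val : H1 ρ →L[ℂ] L2C) ∘L resolventG ρ).restrictScalars ℝ).hasFDerivAt
      (x := W 0)).comp (0 : ℂ) h1
    have h3 : fderiv ℝ (fun z => val (resolventG ρ (W z))) 0 = _ := h2.fderiv
    rw [h3]
    change val (resolventG ρ (v • -mulOp V h (val φ))) = _
    rw [map_smul, map_smul, ← hφ]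

/-! ### Solutions as curves in `H¹` and conservation of mass -/

section

open H1

variable {V : ℝ → ℝ} {ρ : ℝ}

theorem norm_le_norm_val_add_norm_der (hρ : 0 < ρ) (k : H1 ρ) :
    ‖k‖ ≤ ‖val k‖ + ρ⁻¹ * ‖der k‖ := by
  have e := k.norm_sq_eq
  have e' : ‖k‖ ^ 2 = ‖val k‖ ^ 2 + (ρ⁻¹) ^ 2 * ‖der k‖ ^ 2 := by
    field_simp
    linarith
  have hi : 0 < ρ⁻¹ := inv_pos.2 hρ
  refine abs_le_of_sq_le_sq' ?_ (by positivity) |>.2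
  rw [e']
  nlinarith [mul_nonneg (norm_nonneg (val k)) (mul_nonneg hi.le (norm_nonneg (der k)))]

/-- A solution of the nonlinear Schrödinger equation as a curve in `H¹`. -/
theorem IsNLSSolution.exists_h1 (hρ : 0 < ρ) (h : MemLp (fun x => (V x : ℂ)) ⊤ volume)
    {I : Set ℝ} {u : ℝ → L2C} (hu : IsNLSSolution V I u) :
    ∃ U : ℝ → H1 ρ, (∀ t ∈ I, val (U t) = u t) ∧ ContinuousOn U I ∧
      ∀ t ∈ I, ∀ v : H1 ρ, HasDerivWithinAt (fun s => inner ℂ (val v) (u s))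
        (Complex.I * (inner ℂ (der v) (der (U t)) +
          inner ℂ (val v) (mulOp V h (val (U t)) - cubic (U t)))) I t := by
  classical
  obtain ⟨ux, h1, h2, h3, h4⟩ := hu
  have hex : ∀ t : ℝ, ∃ p : H1 ρ, t ∈ I → val p = u t ∧ der p = ux t := fun t => by
    by_cases ht : t ∈ I
    · obtain ⟨p, hp⟩ := exists_of_hasWeakDeriv hρ.ne' (h1 t ht)
      exact ⟨p, fun _ => hp⟩
    · exact ⟨0, fun h => absurd h ht⟩
  choose U hU using hex
  refine ⟨U, fun t ht => (hU t ht).1, fun t ht => ?_, fun t ht v => ?_⟩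
  · have e1 : Tendsto (fun s => ‖u s - u t‖ + ρ⁻¹ * ‖ux s - ux t‖) (𝓝[I] t) (𝓝 0) := by
      have a1 := tendsto_iff_norm_sub_tendsto_zero.1 (h2 t ht)
      have a2 := (tendsto_iff_norm_sub_tendsto_zero.1 (h3 t ht)).const_mul ρ⁻¹
      simpa using a1.add a2
    refine tendsto_iff_norm_sub_tendsto_zero.2 (squeeze_zero' (Eventually.of_forall fun _ =>
      norm_nonneg _) ?_ e1)
    filter_upwards [self_mem_nhdsWithin] with s hs
    have := norm_le_norm_val_add_norm_der hρ (U s - U t)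
    rwa [map_sub, map_sub, (hU s hs).1, (hU s hs).2, (hU t ht).1, (hU t ht).2] at this
  · have := h4 t ht (val v) (der v) (hasWeakDeriv v)
    convert! this using 4
    · exact (hU t ht).2
    · rw [L2.inner_def]
      apply integral_congr_ae
      rw [← (hU t ht).1]
      filter_upwards [Lp.coeFn_sub (mulOp V h (val (U t))) (cubic (U t)), mulOp_ae_eq h (val (U t)),
        cubic_ae_eq (U t)] with x x1 x2 x3
      rw [x1, Pi.sub_apply, x2, x3, RCLike.inner_apply, mul_comm]

theorem inner_der_resolventG_left (hρ : ρ ≠ 0) (f : H1 ρ) (w : L2C) :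
    inner ℂ (der (resolventG ρ w)) (der f) =
      inner ℂ w (val f) - (ρ : ℂ) ^ 2 * inner ℂ (val (resolventG ρ w)) (val f) := by
  have := congrArg (starRingEnd ℂ) (inner_der_resolventG hρ f w)
  simp only [map_add, map_mul, inner_conj_symm, map_pow, Complex.conj_ofReal] at this
  rw [← this, add_sub_cancel_right]

/-- Conservation of the `L²` norm. -/
theorem IsNLSSolution.norm_eq (hρ : 0 < ρ) (h : MemLp (fun x => (V x : ℂ)) ⊤ volume)
    {I : Set ℝ} (hI : I.OrdConnected) {u : ℝ → L2C} (hu : IsNLSSolution V I u) {s t : ℝ}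
    (hs : s ∈ I) (ht : t ∈ I) : ‖u s‖ = ‖u t‖ := by
  obtain ⟨U, hU, hUc, hUd⟩ := hu.exists_h1 hρ h
  -- The equation may be tested only against fixed `H¹` functions. Hence the expansion `‖u s‖² = ‖u
  -- t‖² + 2 Re (u t, u s - u t) + ‖u s - u t‖²`: the middle term is tested with `u t`, and the last
  -- one is shown to be `o(s - t)`.
  have hder : ∀ t ∈ I, HasDerivWithinAt (fun s => ‖u s‖ ^ 2) 0 I t := by
    intro t ht
    obtain ⟨M, hM⟩ : ∃ M, ∀ᶠ s in 𝓝[I] t, ‖U s‖ ≤ M :=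
      ⟨‖U t‖ + 1, (hUc t ht).norm.eventually_le_const (lt_add_one _)⟩
    obtain ⟨r, hr, hball⟩ := Metric.mem_nhdsWithin_iff.1 hM
    set J := Metric.ball t r ∩ I with hJ
    have hJc : Convex ℝ J := (convex_ball t r).inter hI.convex
    have htJ : t ∈ J := ⟨Metric.mem_ball_self hr, ht⟩
    have hM0 : 0 ≤ M := (norm_nonneg _).trans (hball htJ)
    set L := ρ * (ρ * M) + (‖mulOp V h‖ * M + (1 + |ρ|) ^ 2 * M ^ 3) with hL
    -- A Lipschitz bound for `u` in the dual of `H¹`. Taking `v = U s - U t`, which tends to 0 in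
    -- `H¹`, makes `‖u s - u t‖²` of order `o(s - t)`.
    have hlip : ∀ (v : H1 ρ), ∀ s ∈ J,
        ‖(inner ℂ (val v) (u s) - inner ℂ (val v) (u t) : ℂ)‖ ≤ ‖v‖ * L * ‖s - t‖ := by
      intro v s hs
      refine hJc.norm_image_sub_le_of_norm_hasDerivWithin_le
        (fun x hx => (hUd x hx.2 v).mono Set.inter_subset_right) (fun x hx => ?_) htJ hs
      have hx' : ‖U x‖ ≤ M := hball hx
      rw [norm_mul, Complex.norm_I, one_mul, hL, mul_add]
      refine (norm_add_le _ _).trans (add_le_add ?_ ?_)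
      · refine (norm_inner_le_norm _ _).trans ?_
        have a1 := v.norm_der_le
        have a2 := (U x).norm_der_le
        rw [abs_of_pos hρ] at a1 a2
        calc ‖der v‖ * ‖der (U x)‖ ≤ (ρ * ‖v‖) * (ρ * M) :=
              mul_le_mul a1 (a2.trans (by gcongr)) (norm_nonneg _) (by positivity)
          _ = _ := by ring
      · refine (norm_inner_le_norm _ _).trans (mul_le_mul v.norm_val_le ?_ (norm_nonneg _)
          (norm_nonneg _))
        refine (norm_sub_le _ _).trans (add_le_add ?_ ?_)
        · exact ((mulOp V h).le_opNorm _).trans (by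
            gcongr
            exact (U x).norm_val_le.trans hx')
        · exact (norm_cubic_le _).trans (by gcongr)
    have hre : HasDerivWithinAt (fun s => (inner ℂ (u t) (u s)).re) 0 I t := by
      have h1 := hUd t ht (U t)
      have h2 := Complex.reCLM.hasFDerivAt.comp_hasDerivWithinAt t h1
      rw [hU t ht] at h2
      refine h2.congr_deriv ?_
      have h4 : (inner ℂ (u t) (mulOp V h (u t)) : ℂ).im = 0 := by
        rw [← Complex.conj_eq_iff_im, inner_conj_symm, inner_mulOp]
      have h5 : (inner ℂ (u t) (cubic (U t)) : ℂ).im = 0 := by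
        rw [← hU t ht, cubic, inner_tri_self, Complex.ofReal_im]
      have h6 : (inner ℂ (der (U t)) (der (U t)) : ℂ).im = 0 := inner_self_im (𝕜 := ℂ) _
      rw [Complex.reCLM_apply, Complex.I_mul_re, Complex.add_im, inner_sub_right, Complex.sub_im,
        h4, h5, h6]
      simp
    have hsmall : (fun s => ‖u s - u t‖ ^ 2) =o[𝓝[I] t] fun s => s - t := by
      have hb : (fun s => ‖u s - u t‖ ^ 2) =O[𝓝[I] t] fun s => ‖U s - U t‖ * (s - t) := by
        refine IsBigO.of_bound L ?_
        filter_upwards [inter_mem_nhdsWithin I (Metric.ball_mem_nhds t hr)] with s hs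
        have := hlip (U s - U t) s ⟨hs.2, hs.1⟩
        rw [map_sub, hU s hs.1, hU t ht, ← inner_sub_right, inner_self_eq_norm_sq_to_K] at this
        rw [norm_mul, norm_norm]
        have e : ‖((‖u s - u t‖ : ℂ) ^ 2)‖ = ‖‖u s - u t‖ ^ 2‖ := by
          rw [norm_pow, Complex.norm_real, norm_pow]
        rw [← e]
        refine this.trans_eq ?_
        ring
      refine hb.trans_isLittleO ?_
      have hz : Tendsto (fun s => ‖U s - U t‖) (𝓝[I] t) (𝓝 0) :=
        tendsto_iff_norm_sub_tendsto_zero.1 (hUc t ht)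
      simpa using ((isLittleO_one_iff ℝ).2 hz).mul_isBigO (isBigO_refl (fun s => s - t) (𝓝[I] t))
    rw [hasDerivWithinAt_iff_isLittleO] at hre ⊢
    refine ((hre.const_mul_left 2).add hsmall).congr_left fun s => ?_
    have e1 : ‖u s - u t‖ ^ 2 = ‖u s‖ ^ 2 - 2 * (inner ℂ (u t) (u s) : ℂ).re + ‖u t‖ ^ 2 := by
      rw [norm_sub_sq (𝕜 := ℂ), inner_re_symm]; rfl
    have e2 : (inner ℂ (u t) (u t) : ℂ).re = ‖u t‖ ^ 2 := inner_self_eq_norm_sq (𝕜 := ℂ) _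
    rw [e1, e2]
    simp
    ring
  have := hI.convex.norm_image_sub_le_of_norm_hasDerivWithin_le (C := 0) hder (by simp) ht hs
  rw [zero_mul, norm_le_zero_iff, sub_eq_zero] at this
  exact (pow_left_inj₀ (norm_nonneg _) (norm_nonneg _) two_ne_zero).1 this

end

/-! ### Symplectic orthogonality and implicit differentiation -/

theorem reducedInner_eq_re_inner {f : ℝ → ℂ} {a b : L2C} (h : f =ᵐ[volume] a) :
    reducedInner f b = (inner ℂ a b).re := by
  rw [L2.inner_def, reducedInner, ← RCLike.re_eq_complex_re, ← integral_re (L2.integrable_inner a b)]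
  apply integral_congr_ae
  filter_upwards [h] with x hx
  rw [hx, RCLike.inner_apply, RCLike.re_eq_complex_re, Complex.mul_re, Complex.conj_re,
    Complex.conj_im]
  ring

theorem symplecticOrth_iff {Q : ℂ → L2C} {z : ℂ} {η : L2C} : SymplecticOrth Q z η ↔
    ∀ b : ℂ, (inner ℂ (Complex.I • η) (fderiv ℝ Q z b)).re = 0 := by
  have e : (fun x => Complex.I * η x) =ᵐ[volume] (Complex.I • η : L2C) :=
    (Lp.coeFn_smul Complex.I η).symm
  rw [SymplecticOrth, reducedInner_eq_re_inner e, reducedInner_eq_re_inner e, D1, D2]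
  refine ⟨fun ⟨h1, h2⟩ b => ?_, fun h => ⟨h 1, h Complex.I⟩⟩
  have hb : b = b.re • (1 : ℂ) + b.im • Complex.I := by
    apply Complex.ext <;> simp
  have hrs : ∀ (r : ℝ) (f : L2C), r • f = (r : ℂ) • f := fun r f => rfl
  rw [hb, map_add, map_smul, map_smul, inner_add_right, hrs, hrs, inner_smul_right,
    inner_smul_right, Complex.add_re, Complex.re_ofReal_mul, Complex.re_ofReal_mul, h1, h2]
  simp

/-- Differentiability of a function given implicitly by `B (u s, z s) = 0`, where `u` is merely
continuous but `s ↦ B (u s, z t)` is differentiable. -/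
theorem hasDerivWithinAt_of_implicit {E : Type*} [NormedAddCommGroup E] [NormedSpace ℝ E]
    {B : E × ℂ → ℂ} {B' : E × ℂ →L[ℝ] ℂ} {u : ℝ → E} {z : ℝ → ℂ} {I : Set ℝ} {t : ℝ} {β z' : ℂ}
    (hB : HasStrictFDerivAt B B' (u t, z t)) (hu : ContinuousWithinAt u I t)
    (hz : ContinuousWithinAt z I t) (ht : t ∈ I) (h0 : ∀ s ∈ I, B (u s, z s) = 0)
    (hβ : HasDerivWithinAt (fun s => B (u s, z t)) β I t)
    (hA : ∀ v, ‖v‖ ≤ 2 * ‖B' (0, v)‖) (hz' : B' (0, z') = -β) : HasDerivWithinAt z z' I t := by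
  have hpair : Tendsto (fun s => ((u s, z s), (u s, z t))) (𝓝[I] t)
      (𝓝 ((u t, z t), (u t, z t))) :=
    (hu.prodMk hz).tendsto.prodMk_nhds (hu.prodMk continuousWithinAt_const).tendsto
  -- Strict differentiability is what permits the moving base point `u s`: the increment is taken in
  -- `z` alone, so no derivative of `u` in `E` is needed.
  have o1 := hB.isLittleO.comp_tendsto hpair
  rw [hasDerivWithinAt_iff_isLittleO] at hβ ⊢
  rw [isLittleO_iff]
  intro c hc
  set K := 1 + ‖z'‖ with hK
  have hKpos : 0 < K := by positivity
  -- For the error `d` of the linear approximation one gets `‖d‖ ≤ 2ε ‖d‖ + 2ε K |s - t|`. The bound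
  -- `ε ≤ 1/4` absorbs the first term, and then `4 ε K ≤ c` concludes.
  set ε := min (1 / 4) (c / (4 * K + 4)) with hε
  have hεpos : 0 < ε := by positivity
  have hε1 : ε ≤ 1 / 4 := min_le_left _ _
  have hε2 : ε * (4 * K + 4) ≤ c := (le_div_iff₀ (by positivity)).1 (min_le_right _ _)
  filter_upwards [(isLittleO_iff.1 o1) hεpos, (isLittleO_iff.1 hβ) hεpos, self_mem_nhdsWithin]
    with s h1 h2 hs
  simp only [Function.comp_apply, Prod.mk_sub_mk, sub_self] at h1
  rw [h0 s hs] at h1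
  rw [h0 t ht] at h2
  have hn : ‖((0 : E), z s - z t)‖ = ‖z s - z t‖ := by simp [Prod.norm_mk]
  rw [hn] at h1
  set d := z s - z t - (s - t) • z' with hd
  have hBd : B' (0, d) = B' (0, z s - z t) + (s - t) • β := by
    have : ((0 : E), d) = (0, z s - z t) - (s - t) • (0, z') := by simp [hd]
    rw [this, map_sub, map_smul, hz', smul_neg, sub_neg_eq_add]
  have hBn : ‖B' (0, d)‖ ≤ ε * ‖z s - z t‖ + ε * ‖s - t‖ := by
    have e : B' (0, d) = -((0 - B (u s, z t) - B' (0, z s - z t)) +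
        (B (u s, z t) - 0 - (s - t) • β)) := by rw [hBd]; ring
    rw [e, norm_neg]
    exact (norm_add_le _ _).trans (add_le_add h1 h2)
  have hzn : ‖z s - z t‖ ≤ ‖d‖ + ‖s - t‖ * ‖z'‖ := by
    have : z s - z t = d + (s - t) • z' := by rw [hd]; ring
    rw [this]
    exact (norm_add_le _ _).trans_eq (by rw [norm_smul])
  have h3 := hA d
  have h4 : ‖d‖ ≤ 2 * (ε * (‖d‖ + ‖s - t‖ * ‖z'‖) + ε * ‖s - t‖) := by
    refine h3.trans ?_
    gcongr
    exact hBn.trans (by gcongr)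
  have h5 : ε * ‖d‖ ≤ 1 / 4 * ‖d‖ := by gcongr
  have h6 : ε * (4 * K + 4) * ‖s - t‖ ≤ c * ‖s - t‖ := by gcongr
  have h7 : 0 ≤ ε * ‖s - t‖ := by positivity
  nlinarith

/-! ### Expansion of the nonlinearity around a bound state -/

namespace H1

variable {ρ : ℝ}

/-- The real-linear derivative of the nonlinearity `q ↦ |q|² q`. -/
noncomputable def cubicDeriv (q v : H1 ρ) : L2C := tri v q q + tri q v q + tri q q v

/-- The part of `|q + η|² (q + η)` that is at least quadratic in `η`. -/
noncomputable def cubicRemainder (q η : H1 ρ) : L2C :=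
  tri η q η + (2 : ℂ) • tri q η η + cubic η

theorem cubicRemainder_ae_eq (q η : H1 ρ) :
    nonlinearTerms (val q) (val η) =ᵐ[volume] cubicRemainder q η := by
  filter_upwards [Lp.coeFn_add (tri η q η + (2 : ℂ) • tri q η η) (cubic η),
    Lp.coeFn_add (tri η q η) ((2 : ℂ) • tri q η η), Lp.coeFn_smul (2 : ℂ) (tri q η η),
    tri_ae_eq η q η, tri_ae_eq q η η, cubic_ae_eq η] with x h1 h2 h3 h4 h5 h6
  rw [cubicRemainder, h1, Pi.add_apply, h2, Pi.add_apply, h3, Pi.smul_apply, h4, h5, h6,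
    nonlinearTerms, ← Complex.normSq_eq_norm_sq, ← Complex.mul_conj, smul_eq_mul]
  ring

theorem cubic_add (q η : H1 ρ) :
    cubic (q + η) = cubic q + cubicDeriv q η + cubicRemainder q η := by
  apply Lp.ext
  have hn := cubicRemainder_ae_eq q η
  filter_upwards [Lp.coeFn_add (cubic q + cubicDeriv q η) (cubicRemainder q η),
    Lp.coeFn_add (cubic q) (cubicDeriv q η), Lp.coeFn_add (tri η q q + tri q η q) (tri q q η),
    Lp.coeFn_add (tri η q q) (tri q η q), tri_ae_eq η q q, tri_ae_eq q η q, tri_ae_eq q q η,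
    cubic_ae_eq q, cubic_ae_eq (q + η), hn, Lp.coeFn_add (val q) (val η)]
    with x h1 h2 h3 h4 h5 h6 h7 h8 h9 h10 h11
  rw [map_add] at h9
  rw [h1, Pi.add_apply, h2, Pi.add_apply, cubicDeriv, h3, Pi.add_apply, h4, Pi.add_apply, h5, h6,
    h7, h8, h9, ← h10, h11, Pi.add_apply, nonlinearTerms]
  simp only [← Complex.normSq_eq_norm_sq, ← Complex.mul_conj, map_add]
  ring

theorem tri_comm (a b c : H1 ρ) : tri a b c = tri c b a := by
  apply Lp.ext
  filter_upwards [tri_ae_eq a b c, tri_ae_eq c b a] with x h1 h2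
  rw [h1, h2]; ring

theorem inner_tri_left (q a v : H1 ρ) :
    (inner ℂ (val a) (tri v q q) : ℂ) = inner ℂ (tri a q q) (val v) := by
  rw [L2.inner_def, L2.inner_def]
  apply integral_congr_ae
  filter_upwards [tri_ae_eq v q q, tri_ae_eq a q q] with x h1 h2
  rw [h1, h2]
  simp only [RCLike.inner_apply, map_mul, RCLike.conj_conj]
  ring

theorem inner_tri_mid (q a v : H1 ρ) :
    (inner ℂ (val a) (tri q v q) : ℂ) = conj (inner ℂ (tri q a q) (val v)) := by
  rw [inner_conj_symm, L2.inner_def, L2.inner_def]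
  apply integral_congr_ae
  filter_upwards [tri_ae_eq q v q, tri_ae_eq q a q] with x h1 h2
  rw [h1, h2]
  simp only [RCLike.inner_apply]
  ring

/-- Symmetry of the Hessian of `(1/4) ∫ |q|⁴`. It holds for the real part only, because the term
containing `conj v` is antilinear. -/
theorem re_inner_cubicDeriv (q a v : H1 ρ) :
    (inner ℂ (val a) (cubicDeriv q v)).re = (inner ℂ (cubicDeriv q a) (val v)).re := by
  simp only [cubicDeriv, inner_add_right, inner_add_left, Complex.add_re]
  rw [inner_tri_left, inner_tri_mid, tri_comm q q v, inner_tri_left, tri_comm q q a,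
    Complex.conj_re]

theorem cubicDeriv_self (q : H1 ρ) : cubicDeriv q q = (3 : ℂ) • cubic q := by
  rw [cubicDeriv, cubic]; module

end H1

/-! ### The cancellation behind the modulation equation -/

section Modulation

open H1

variable {V : ℝ → ℝ} {ρ : ℝ}

theorem inner_resolventG_symm (hρ : ρ ≠ 0) (y w : L2C) :
    (inner ℂ (val (resolventG ρ y)) w : ℂ) = inner ℂ y (val (resolventG ρ w)) := by
  rw [← inner_der_resolventG hρ, inner_der_resolventG_left hρ, sub_add_cancel]

theorem re_inner_comm (a b : L2C) : (inner ℂ a b).re = (inner ℂ b a).re := by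
  rw [← inner_conj_symm, Complex.conj_re]

theorem inner_ofReal_smul_re (r : ℝ) (a b : L2C) :
    (inner ℂ a ((r : ℂ) • b)).re = r * (inner ℂ a b).re := by
  rw [inner_smul_right, Complex.re_ofReal_mul]

/-- The time derivative of `⟨i u, v⟩` for `v = (-∂ₓₓ + ρ²)⁻¹ y` along the Schrödinger flow. -/
theorem re_inner_schrodinger (hρ : ρ ≠ 0) (h : MemLp (fun x => (V x : ℂ)) ⊤ volume)
    (U : H1 ρ) (y : L2C) :
    (Complex.I * (Complex.I * (inner ℂ (der (resolventG ρ y)) (der U) +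
      inner ℂ (val (resolventG ρ y)) (mulOp V h (val U) - cubic U)))).re =
    (inner ℂ (val (resolventG ρ y)) (cubic U)).re -
      (inner ℂ (val U) (y - ((ρ ^ 2 : ℝ) : ℂ) • val (resolventG ρ y) +
        mulOp V h (val (resolventG ρ y)))).re := by
  -- The derivative on `U` is moved onto `G y`, whose second derivative lies in `L²`.
  rw [← mul_assoc, Complex.I_mul_I, neg_one_mul, Complex.neg_re, inner_der_resolventG_left hρ,
    inner_sub_right, inner_add_right, inner_sub_right]
  simp only [Complex.add_re, Complex.sub_re]
  rw [inner_ofReal_smul_re, re_inner_comm (val U), re_inner_comm (val U), re_inner_comm (val U),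
    inner_mulOp, ← Complex.ofReal_pow, Complex.re_ofReal_mul]
  ring

/-- The algebraic heart of the modulation equation. Here `q = (-∂ₓₓ + ρ²)⁻¹ W` is a bound state with
energy `E`, and `y` and `κ` are directional derivatives of `W` and `E`. -/
theorem modulation_identity (hρ : ρ ≠ 0) (h : MemLp (fun x => (V x : ℂ)) ⊤ volume)
    {W y : L2C} {E κ : ℝ} {q v η U : H1 ρ} (hq : q = resolventG ρ W) (hv : v = resolventG ρ y)
    (hU : U = q + η)
    (hW : W + mulOp V h (val q) = ((E + ρ ^ 2 : ℝ) : ℂ) • val q + cubic q)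
    (hy : y + mulOp V h (val v) =
      (κ : ℂ) • val q + ((E + ρ ^ 2 : ℝ) : ℂ) • val v + cubicDeriv q v)
    (hη : (inner ℂ (val η) (val q)).re = 0) :
    (inner ℂ (val v) (cubic U)).re -
        (inner ℂ (val U) (y - ((ρ ^ 2 : ℝ) : ℂ) • val v + mulOp V h (val v))).re +
      E * (inner ℂ (val U) (val v)).re = (inner ℂ (cubicRemainder q η) (val v)).re := by
  have hLv : y - ((ρ ^ 2 : ℝ) : ℂ) • val v + mulOp V h (val v) =
      (κ : ℂ) • val q + (E : ℂ) • val v + cubicDeriv q v := by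
    have : y = (κ : ℂ) • val q + ((E + ρ ^ 2 : ℝ) : ℂ) • val v + cubicDeriv q v -
        mulOp V h (val v) := by rw [← hy, add_sub_cancel_right]
    rw [this]; push_cast; module
  have hLq : W - ((ρ ^ 2 : ℝ) : ℂ) • val q + mulOp V h (val q) = (E : ℂ) • val q + cubic q := by
    have : W = ((E + ρ ^ 2 : ℝ) : ℂ) • val q + cubic q - mulOp V h (val q) := by
      rw [← hW, add_sub_cancel_right]
    rw [this]; push_cast; module
  have inner_three : ∀ a b : L2C, (inner ℂ a ((3 : ℂ) • b)).re = 3 * (inner ℂ a b).re := fun a b => by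
    have := inner_ofReal_smul_re 3 a b
    rwa [Complex.ofReal_ofNat] at this
  -- symmetry of the Schrödinger operator, tested on `q` and `v`
  have hsymm : (inner ℂ (val q) (y - ((ρ ^ 2 : ℝ) : ℂ) • val v + mulOp V h (val v))).re =
      (inner ℂ (val v) (W - ((ρ ^ 2 : ℝ) : ℂ) • val q + mulOp V h (val q))).re := by
    simp only [inner_add_right, inner_sub_right, Complex.add_re, Complex.sub_re,
      inner_ofReal_smul_re]
    have e1 : (inner ℂ (val q) y).re = (inner ℂ (val v) W).re := by
      rw [hq, hv, inner_resolventG_symm hρ, re_inner_comm]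
    rw [e1, re_inner_comm (val q) (val v), ← inner_mulOp, re_inner_comm (mulOp V h (val q))]
  rw [hLv, hLq] at hsymm
  rw [hLv]
  simp only [inner_add_right, Complex.add_re, inner_ofReal_smul_re, re_inner_cubicDeriv,
    cubicDeriv_self] at hsymm ⊢
  rw [hU, cubic_add]
  have e3 : (inner ℂ (cubicDeriv q (q + η)) (val v)).re =
      3 * (inner ℂ (val v) (cubic q)).re + (inner ℂ (val v) (cubicDeriv q η)).re := by
    rw [← re_inner_cubicDeriv, map_add, inner_add_left, Complex.add_re, re_inner_cubicDeriv,
      re_inner_cubicDeriv, cubicDeriv_self, re_inner_comm, re_inner_comm (cubicDeriv q η)]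
    congr 1
    exact inner_three (val v) (cubic q)
  have e4 : (inner ℂ ((3 : ℂ) • cubic q) (val v)).re = 3 * (inner ℂ (val v) (cubic q)).re := by
    rw [re_inner_comm]
    exact inner_three (val v) (cubic q)
  rw [e4] at hsymm
  rw [e3]
  simp only [map_add, inner_add_right, inner_add_left, Complex.add_re] at hsymm ⊢
  rw [hη, re_inner_comm (cubicRemainder q η), re_inner_comm (val q) (val v)] at *
  -- By now `hsymm` amounts to `κ ‖q‖² + 2 Re (v, |q|² q) = 0`, which is exactly the order-zero part
  -- of the goal. The part linear in `η` has cancelled by the symmetry of `cubicDeriv` and by `hη`.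
  linear_combination -hsymm

end Modulation

/-- The symplectic orthogonality conditions as the zero set of one complex-valued map. -/
noncomputable def modulationMap (Q : ℂ → L2C) (p : L2C × ℂ) : ℂ :=
  ((inner ℂ (Complex.I • (p.1 - Q p.2)) (fderiv ℝ Q p.2 Complex.I)).re : ℂ) -
    Complex.I * ((inner ℂ (Complex.I • (p.1 - Q p.2)) (fderiv ℝ Q p.2 1)).re : ℂ)

theorem norm_ofReal_sub_I_mul (a b : ℝ) : ‖(a : ℂ) - Complex.I * b‖ = √(b ^ 2 + a ^ 2) := by
  rw [Complex.norm_eq_sqrt_sq_add_sq]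
  simp [add_comm]

theorem modulationMap_eq_zero_iff {Q : ℂ → L2C} {u : L2C} {z : ℂ} :
    modulationMap Q (u, z) = 0 ↔ SymplecticOrth Q z (u - Q z) := by
  have e : (fun x => Complex.I * (u - Q z) x) =ᵐ[volume] (Complex.I • (u - Q z) : L2C) :=
    (Lp.coeFn_smul Complex.I (u - Q z)).symm
  rw [SymplecticOrth, reducedInner_eq_re_inner e, reducedInner_eq_re_inner e, D1, D2,
    modulationMap, Complex.ext_iff]
  simp [and_comm]

/-! ### Solving the orthogonality conditions near the origin -/

section ModulationMap

variable {Q : ℂ → L2C}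

theorem contDiffAt_modulationMap {u : L2C} {z : ℂ} (hQ : ContDiffAt ℝ 2 Q z) :
    ContDiffAt ℝ 1 (modulationMap Q) (u, z) := by
  have hQ1 : ContDiffAt ℝ 1 (fun p : L2C × ℂ => Q p.2) (u, z) :=
    ContDiffAt.comp (u, z) (hQ.of_le (by norm_num)) contDiffAt_snd
  have hη : ContDiffAt ℝ 1 (fun p : L2C × ℂ => Complex.I • (p.1 - Q p.2)) (u, z) :=
    (contDiffAt_fst.sub hQ1).const_smul Complex.I
  have hD : ∀ b : ℂ, ContDiffAt ℝ 1 (fun p : L2C × ℂ => fderiv ℝ Q p.2 b) (u, z) := fun b => by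
    have h1 : ContDiffAt ℝ 1 (fderiv ℝ Q) z := hQ.fderiv_right (by norm_num)
    have h2 : ContDiffAt ℝ 1 (fun p : L2C × ℂ => fderiv ℝ Q p.2) (u, z) :=
      ContDiffAt.comp (u, z) h1 contDiffAt_snd
    exact h2.clm_apply contDiffAt_const
  have hR : ∀ b : ℂ, ContDiffAt ℝ 1 (fun p : L2C × ℂ =>
      ((inner ℂ (Complex.I • (p.1 - Q p.2)) (fderiv ℝ Q p.2 b)).re : ℂ)) (u, z) := fun b =>
    (Complex.ofRealCLM ∘L Complex.reCLM).contDiff.contDiffAt.comp _ (hη.inner ℂ (hD b))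
  exact (hR Complex.I).sub (contDiffAt_const.mul (hR 1))

/-- As `DQ[0] v = v φ`, the map reads `Re (iu, iφ) - i Re (iu, φ)`, whose two parts are the real and
imaginary parts of `(φ, u)`. In particular `‖B(u, 0)‖ ≤ ‖u‖` when `‖φ‖ = 1`. -/
theorem modulationMap_apply_zero {φ : L2C} (h0 : Q 0 = 0) (hd : ∀ v, fderiv ℝ Q 0 v = v • φ)
    (u : L2C) : modulationMap Q (u, 0) = inner ℂ φ u := by
  have hb : ∀ b : ℂ, (inner ℂ (Complex.I • u) (b • φ)).re = (b * -Complex.I * conj (inner ℂ φ u)).re :=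
    fun b => by
      rw [inner_smul_left, inner_smul_right, inner_conj_symm, Complex.conj_I]
      ring_nf
  rw [modulationMap, h0, sub_zero, hd, hd, hb, hb]
  apply Complex.ext
  · simp [re_inner_comm u φ]
  · have := congrArg Complex.im (inner_conj_symm φ u)
    rw [Complex.conj_im] at this
    simpa using! this

/-- At the origin `u - Q[z]` vanishes, so the variation of `DQ` does not contribute. Only the
variation `-v φ` of `-Q[z]` remains, paired with `DQ[0]`. -/
theorem fderiv_modulationMap_zero {φ : L2C} (hQ : ContDiffAt ℝ 2 Q 0) (h0 : Q 0 = 0)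
    (hd : ∀ v, fderiv ℝ Q 0 v = v • φ) (hφ : ‖φ‖ = 1) (v : ℂ) :
    fderiv ℝ (modulationMap Q) (0, 0) (0, v) = -v := by
  have hB : HasFDerivAt (modulationMap Q) (fderiv ℝ (modulationMap Q) (0, 0)) ((0 : L2C), (0 : ℂ)) :=
    ((contDiffAt_modulationMap hQ).differentiableAt one_ne_zero).hasFDerivAt
  have hline : HasDerivAt (fun t : ℝ => t • v) v 0 := by
    simpa using! (hasDerivAt_id (0 : ℝ)).smul_const v
  have hpair : HasDerivAt (fun t : ℝ => ((0 : L2C), t • v)) (0, v) 0 :=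
    (hasDerivAt_const 0 (0 : L2C)).prodMk hline
  have h1 : HasDerivAt (fun t : ℝ => modulationMap Q (0, t • v))
      (fderiv ℝ (modulationMap Q) (0, 0) (0, v)) 0 := by
    have hB' : HasFDerivAt (modulationMap Q) (fderiv ℝ (modulationMap Q) (0, 0))
      ((fun t : ℝ => ((0 : L2C), t • v)) 0) := by simpa using hB
    exact hB'.comp_hasDerivAt (0 : ℝ) hpair
  have hQd : HasDerivAt (fun t : ℝ => Q (t • v)) (v • φ) 0 := by
    rw [← hd]
    exact HasFDerivAt.comp_hasDerivAt (0 : ℝ)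
      (by simpa using (hQ.differentiableAt two_ne_zero).hasFDerivAt) hline
  have hη : HasDerivAt (fun t : ℝ => Complex.I • ((0 : L2C) - Q (t • v)))
      (Complex.I • ((0 : L2C) - v • φ)) 0 :=
    ((hasDerivAt_const 0 (0 : L2C)).sub hQd).const_smul Complex.I
  have hDQ : ∀ b : ℂ, ∃ g, HasDerivAt (fun t : ℝ => fderiv ℝ Q (t • v) b) g 0 := fun b => by
    have g1 : DifferentiableAt ℝ (fderiv ℝ Q) 0 :=
      (hQ.fderiv_right (m := 1) (by norm_num)).differentiableAt one_ne_zero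
    have g2 : HasDerivAt (fun t : ℝ => fderiv ℝ Q (t • v)) (fderiv ℝ (fderiv ℝ Q) 0 v) 0 :=
      HasFDerivAt.comp_hasDerivAt (0 : ℝ) (by simpa using g1.hasFDerivAt) hline
    exact ⟨_, g2.clm_apply (hasDerivAt_const 0 b)⟩
  have hR : ∀ b : ℂ, HasDerivAt (fun t : ℝ =>
      ((inner ℂ (Complex.I • ((0 : L2C) - Q (t • v))) (fderiv ℝ Q (t • v) b)).re : ℂ))
      (((Complex.I * conj v * b).re : ℝ) : ℂ) 0 := fun b => by
    obtain ⟨g, hg⟩ := hDQ b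
    have := (Complex.ofRealCLM ∘L Complex.reCLM).hasFDerivAt.comp_hasDerivAt (0 : ℝ)
      (hη.inner ℂ hg)
    refine this.congr_deriv ?_
    simp only [zero_smul, h0, sub_zero, smul_zero, inner_zero_left, zero_add, hd, zero_sub,
      smul_neg, inner_neg_left, ContinuousLinearMap.comp_apply, Complex.reCLM_apply,
      Complex.ofRealCLM_apply]
    rw [inner_smul_left, inner_smul_left, inner_smul_right, inner_self_eq_norm_sq_to_K, hφ,
      Complex.conj_I]
    congr 2
    simp
    ring
  have h2 := (hR Complex.I).sub ((hR 1).const_mul Complex.I)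
  have h3 := h1.unique h2
  rw [h3]
  apply Complex.ext <;> simp

/-- Near the origin `w ↦ w + B(u, w)` is a contraction. -/
theorem exists_contraction_modulationMap {φ : L2C} (hQ : ContDiffAt ℝ 2 Q 0) (h0 : Q 0 = 0)
    (hd : ∀ v, fderiv ℝ Q 0 v = v • φ) (hφ : ‖φ‖ = 1) :
    ∃ ε : ℝ, 0 < ε ∧ ∀ (u : L2C) (w w' : ℂ), ‖u‖ < ε → ‖w‖ < ε → ‖w'‖ < ε →
      ‖modulationMap Q (u, w) - modulationMap Q (u, w') + (w - w')‖ ≤ 1 / 2 * ‖w - w'‖ := by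
  have hs : HasStrictFDerivAt (modulationMap Q) (fderiv ℝ (modulationMap Q) (0, 0))
      ((0 : L2C), (0 : ℂ)) := (contDiffAt_modulationMap hQ).hasStrictFDerivAt one_ne_zero
  have ho := (isLittleO_iff.1 hs.isLittleO) (show (0 : ℝ) < 1 / 2 by norm_num)
  obtain ⟨ε, hε, hball⟩ := Metric.eventually_nhds_iff.1 ho
  refine ⟨ε, hε, fun u w w' hu hw hw' => ?_⟩
  have hdist : dist (((u, w), (u, w')) : (L2C × ℂ) × (L2C × ℂ)) ((0, 0), (0, 0)) < ε := by
    simp only [Prod.dist_eq, dist_zero_right]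
    exact max_lt (max_lt hu hw) (max_lt hu hw')
  have := hball hdist
  simp only [Prod.mk_sub_mk, sub_self] at this
  rw [fderiv_modulationMap_zero hQ h0 hd hφ, sub_neg_eq_add] at this
  simpa [Prod.norm_mk] using this

/-- Banach's fixed point theorem for `w + B(u, w)` on the closed ball of radius `δ / 2`, which is
mapped into itself because `(1/2)(δ/2) + δ/8 ≤ δ/2`. -/
theorem exists_modulationMap_eq_zero {ε δ : ℝ} (hδ : 0 < δ) (hδε : δ ≤ ε)
    (hcontr : ∀ (u : L2C) (w w' : ℂ), ‖u‖ < ε → ‖w‖ < ε → ‖w'‖ < ε →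
      ‖modulationMap Q (u, w) - modulationMap Q (u, w') + (w - w')‖ ≤ 1 / 2 * ‖w - w'‖)
    {u : L2C} (hu : ‖u‖ ≤ δ / 8) (hu0 : ‖modulationMap Q (u, 0)‖ ≤ ‖u‖) :
    ∃ z : ℂ, ‖z‖ < δ ∧ modulationMap Q (u, z) = 0 := by
  have huε : ‖u‖ < ε := by linarith
  let Ψ : ℂ → ℂ := fun w => w + modulationMap Q (u, w)
  have hΨ : ∀ w w' : ℂ, ‖w‖ < ε → ‖w'‖ < ε → ‖Ψ w - Ψ w'‖ ≤ 1 / 2 * ‖w - w'‖ := fun w w' hw hw' => by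
    have := hcontr u w w' huε hw hw'
    have e : Ψ w - Ψ w' = modulationMap Q (u, w) - modulationMap Q (u, w') + (w - w') := by
      simp only [Ψ]; ring
    rwa [e]
  have hmaps : Set.MapsTo Ψ (Metric.closedBall 0 (δ / 2)) (Metric.closedBall 0 (δ / 2)) := by
    intro w hw
    rw [mem_closedBall_zero_iff] at hw ⊢
    have h1 := hΨ w 0 (by linarith) (by rw [norm_zero]; linarith)
    have h2 : Ψ 0 = modulationMap Q (u, 0) := zero_add _
    rw [sub_zero] at h1
    have h3 : ‖Ψ w‖ ≤ ‖Ψ w - Ψ 0‖ + ‖Ψ 0‖ := by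
      simpa using norm_add_le (Ψ w - Ψ 0) (Ψ 0)
    rw [h2] at h3
    rw [h2] at h1
    linarith
  have hc : ContractingWith (1 / 2) (hmaps.restrict Ψ _ _) := by
    refine ⟨by norm_num, LipschitzWith.of_dist_le_mul fun x y => ?_⟩
    have hx := mem_closedBall_zero_iff.1 x.2
    have hy := mem_closedBall_zero_iff.1 y.2
    have := hΨ x y (by linarith) (by linarith)
    rw [Subtype.dist_eq, Subtype.dist_eq, dist_eq_norm, dist_eq_norm]
    simpa using this
  obtain ⟨z, hz, hfix, -⟩ := hc.exists_fixedPoint' (x := 0) Metric.isClosed_closedBall.isComplete hmaps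
    (Metric.mem_closedBall_self (by linarith)) (edist_ne_top _ _)
  refine ⟨z, ?_, ?_⟩
  · rw [mem_closedBall_zero_iff] at hz
    linarith
  · have : z + modulationMap Q (u, z) = z := hfix
    simpa using this

/-- The contraction bound passes to the derivative as `‖∂_z B + 1‖ ≤ 1/2`. The resulting factor 2 is
the constant `C` of the final estimate. -/
theorem norm_le_two_mul_fderiv_modulationMap {ε : ℝ}
    (hcontr : ∀ (u : L2C) (w w' : ℂ), ‖u‖ < ε → ‖w‖ < ε → ‖w'‖ < ε →
      ‖modulationMap Q (u, w) - modulationMap Q (u, w') + (w - w')‖ ≤ 1 / 2 * ‖w - w'‖)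
    {u : L2C} {z : ℂ} (hu : ‖u‖ < ε) (hz : ‖z‖ < ε) {B' : L2C × ℂ →L[ℝ] ℂ}
    (hB : HasFDerivAt (modulationMap Q) B' (u, z)) (v : ℂ) : ‖v‖ ≤ 2 * ‖B' (0, v)‖ := by
  have h1 : HasFDerivAt (fun w => modulationMap Q (u, w))
      (B' ∘L ContinuousLinearMap.inr ℝ L2C ℂ) z :=
    hB.comp z (hasFDerivAt_prodMk_right u z)
  have h2 := h1.add (hasFDerivAt_id z)
  have h3 := h2.le_of_lip' (C := 1 / 2) (by norm_num) (by
    have : ∀ᶠ w in 𝓝 z, ‖w‖ < ε := continuous_norm.continuousAt.eventually_lt_const hz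
    filter_upwards [this] with w hw
    refine le_trans (le_of_eq ?_) (hcontr u w z hu hw hz)
    congr 1
    simp only [Pi.add_apply, id_eq]
    ring)
  have h4 := ((B' ∘L ContinuousLinearMap.inr ℝ L2C ℂ + ContinuousLinearMap.id ℝ ℂ).le_opNorm v).trans
    (mul_le_mul_of_nonneg_right h3 (norm_nonneg v))
  have h5 : (B' ∘L ContinuousLinearMap.inr ℝ L2C ℂ + ContinuousLinearMap.id ℝ ℂ) v =
      B' (0, v) + v := by simp
  rw [h5] at h4
  have h6 : ‖v‖ ≤ ‖B' (0, v) + v‖ + ‖B' (0, v)‖ := by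
    simpa using norm_sub_le (B' (0, v) + v) (B' (0, v))
  linarith

end ModulationMap

/-! ### Gauge covariance -/

section Gauge

variable {Q : ℂ → L2C} {δ : ℝ}

theorem fderiv_gauge (hQ : ∀ z, ‖z‖ < δ → DifferentiableAt ℝ Q z)
    (hg : ∀ c z : ℂ, ‖c‖ = 1 → Q (c * z) = c • Q z) {c z : ℂ} (hc : ‖c‖ = 1) (hz : ‖z‖ < δ) (b : ℂ) :
    fderiv ℝ Q (c * z) (c * b) = c • fderiv ℝ Q z b := by
  have hcz : ‖c * z‖ < δ := by rwa [norm_mul, hc, one_mul]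
  have h1 : HasFDerivAt (fun w => Q (c * w))
      (fderiv ℝ Q (c * z) ∘L ContinuousLinearMap.mul ℝ ℂ c) z :=
    (hQ _ hcz).hasFDerivAt.comp z (ContinuousLinearMap.mul ℝ ℂ c).hasFDerivAt
  have h2 : HasFDerivAt (fun w => Q (c * w)) (c • fderiv ℝ Q z) z := by
    simp only [fun w => hg c w hc]
    exact (hQ z hz).hasFDerivAt.const_smul c
  exact congrArg (fun L : ℂ →L[ℝ] L2C => L b) (h1.unique h2)

theorem hasDerivAt_exp_mul_I : HasDerivAt (fun θ : ℝ => Complex.exp (θ * Complex.I)) Complex.I 0 := by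
  have := ((Complex.ofRealCLM.hasDerivAt (x := 0)).mul_const Complex.I).cexp
  simpa using! this

/-- Differentiate `Q[e^{iθ} z] = e^{iθ} Q[z]` at `θ = 0`. Thus symplectic orthogonality in the
direction `i z` becomes `Re (η, Q[z]) = 0`. -/
theorem fderiv_gauge_tangent (hQ : ∀ z, ‖z‖ < δ → DifferentiableAt ℝ Q z)
    (hg : ∀ c z : ℂ, ‖c‖ = 1 → Q (c * z) = c • Q z) {z : ℂ} (hz : ‖z‖ < δ) :
    fderiv ℝ Q z (Complex.I * z) = Complex.I • Q z := by
  have h1 : HasDerivAt (fun θ : ℝ => Q (Complex.exp (θ * Complex.I) * z))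
      (fderiv ℝ Q z (Complex.I * z)) 0 :=
    HasFDerivAt.comp_hasDerivAt (0 : ℝ) (by simpa using (hQ z hz).hasFDerivAt)
      (hasDerivAt_exp_mul_I.mul_const z)
  have h2 : HasDerivAt (fun θ : ℝ => Q (Complex.exp (θ * Complex.I) * z)) (Complex.I • Q z) 0 := by
    simp only [fun θ : ℝ => hg (Complex.exp (θ * Complex.I)) z (Complex.norm_exp_ofReal_mul_I θ)]
    exact hasDerivAt_exp_mul_I.smul_const (Q z)
  exact h1.unique h2

theorem re_inner_I_smul_I_smul (a b : L2C) :
    (inner ℂ (Complex.I • a) (Complex.I • b)).re = (inner ℂ a b).re := by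
  rw [inner_smul_left, inner_smul_right, ← mul_assoc, Complex.conj_I]
  simp

/-- The derivative of the modulation map in the gauge direction. -/
theorem fderiv_modulationMap_gauge (hQ : ∀ z, ‖z‖ < δ → ContDiffAt ℝ 2 Q z)
    (hg : ∀ c z : ℂ, ‖c‖ = 1 → Q (c * z) = c • Q z) {u : L2C} {z : ℂ} (hz : ‖z‖ < δ)
    (horth : ∀ b : ℂ, (inner ℂ (Complex.I • (u - Q z)) (fderiv ℝ Q z b)).re = 0)
    {B' : L2C × ℂ →L[ℝ] ℂ} (hB : HasFDerivAt (modulationMap Q) B' (u, z)) :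
    B' (0, Complex.I * z) = ((inner ℂ u (fderiv ℝ Q z Complex.I)).re : ℂ) -
      Complex.I * ((inner ℂ u (fderiv ℝ Q z 1)).re : ℂ) := by
  have hQd : ∀ z, ‖z‖ < δ → DifferentiableAt ℝ Q z := fun z hz =>
    (hQ z hz).differentiableAt two_ne_zero
  have hpair : HasDerivAt (fun θ : ℝ => (u, Complex.exp (θ * Complex.I) * z))
      ((0 : L2C), Complex.I * z) 0 :=
    (hasDerivAt_const 0 u).prodMk (hasDerivAt_exp_mul_I.mul_const z)
  have h1 : HasDerivAt (fun θ : ℝ => modulationMap Q (u, Complex.exp (θ * Complex.I) * z))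
      (B' (0, Complex.I * z)) 0 := by
    have hB₀ : HasFDerivAt (modulationMap Q) B'
      ((fun θ : ℝ => (u, Complex.exp (θ * Complex.I) * z)) 0) := by simpa using hB
    exact hB₀.comp_hasDerivAt (0 : ℝ) hpair
  have hexp : HasDerivAt (fun θ : ℝ => Complex.exp (-(θ * Complex.I))) (-Complex.I) 0 := by
    have := ((Complex.ofRealCLM.hasDerivAt (x := 0)).mul_const Complex.I).neg.cexp
    simpa using! this
  have hR : ∀ b : ℂ, HasDerivAt (fun θ : ℝ =>
      ((inner ℂ (Complex.I • (u - Q (Complex.exp (θ * Complex.I) * z)))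
        (fderiv ℝ Q (Complex.exp (θ * Complex.I) * z) b)).re : ℂ))
      ((inner ℂ u (fderiv ℝ Q z b)).re : ℂ) 0 := fun b => by
    -- Rotating `z` amounts to rotating `u` and `b` backwards. In the derivative at `θ = 0` the
    -- rotation of `b` is removed by orthogonality, and `i (-i) u = u` remains.
    have e : ∀ θ : ℝ, (inner ℂ (Complex.I • (u - Q (Complex.exp (θ * Complex.I) * z)))
        (fderiv ℝ Q (Complex.exp (θ * Complex.I) * z) b) : ℂ) =
        inner ℂ (Complex.I • (Complex.exp (-(θ * Complex.I)) • u - Q z))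
          (fderiv ℝ Q z (Complex.exp (-(θ * Complex.I)) * b)) := fun θ => by
      set c := Complex.exp (θ * Complex.I) with hc
      have hcn : ‖c‖ = 1 := Complex.norm_exp_ofReal_mul_I θ
      have hcc : c * Complex.exp (-(θ * Complex.I)) = 1 := by
        rw [hc, ← Complex.exp_add, add_neg_cancel, Complex.exp_zero]
      have e1 : b = c * (Complex.exp (-(θ * Complex.I)) * b) := by rw [← mul_assoc, hcc, one_mul]
      have e2 : u - Q (c * z) = c • (Complex.exp (-(θ * Complex.I)) • u - Q z) := by
        rw [smul_sub, smul_smul, hcc, one_smul, hg c z hcn]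
      conv_lhs => rw [e1, e2, fderiv_gauge hQd hg hcn hz, smul_comm]
      rw [inner_smul_left, inner_smul_right, ← mul_assoc, mul_comm (conj c), Complex.mul_conj,
        Complex.normSq_eq_norm_sq, hcn]
      simp
    simp only [e]
    have d1 : HasDerivAt (fun θ : ℝ => Complex.I • (Complex.exp (-(θ * Complex.I)) • u - Q z))
        (Complex.I • (-Complex.I) • u) 0 :=
      ((hexp.smul_const u).sub_const _).const_smul Complex.I
    have d2 : HasDerivAt (fun θ : ℝ => fderiv ℝ Q z (Complex.exp (-(θ * Complex.I)) * b))
        (fderiv ℝ Q z (-Complex.I * b)) 0 :=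
      (fderiv ℝ Q z).hasFDerivAt.comp_hasDerivAt 0 (hexp.mul_const b)
    have := (Complex.ofRealCLM ∘L Complex.reCLM).hasFDerivAt.comp_hasDerivAt (0 : ℝ)
      (d1.inner ℂ d2)
    refine this.congr_deriv ?_
    simp only [ContinuousLinearMap.comp_apply, Complex.reCLM_apply, Complex.ofRealCLM_apply,
      Complex.ofReal_zero, zero_mul, neg_zero, Complex.exp_zero, one_smul, one_mul, Complex.add_re,
      horth, smul_smul, mul_neg, Complex.I_mul_I, neg_neg]
    simp
  exact h1.unique ((hR Complex.I).sub ((hR 1).const_mul Complex.I))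

end Gauge

/-! ### The modulation equation -/

section ModulationEquation

open H1

variable {V : ℝ → ℝ} {ρ : ℝ}

/-- The linearized bound-state equation. -/
theorem fderiv_boundState_eq {δ : ℝ} (h : MemLp (fun x => (V x : ℂ)) ⊤ volume) {W : ℂ → L2C}
    {E : ℂ → ℝ}
    (hW : ∀ z, ‖z‖ < δ → W z + mulOp V h (val (resolventG ρ (W z))) =
      ((E z + ρ ^ 2 : ℝ) : ℂ) • val (resolventG ρ (W z)) + cubic (resolventG ρ (W z)))
    {z : ℂ} (hz : ‖z‖ < δ) (hWd : DifferentiableAt ℝ W z) (hE : DifferentiableAt ℝ E z) (b : ℂ) :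
    fderiv ℝ W z b + mulOp V h (val (resolventG ρ (fderiv ℝ W z b))) =
      ((fderiv ℝ E z b : ℝ) : ℂ) • val (resolventG ρ (W z)) +
        ((E z + ρ ^ 2 : ℝ) : ℂ) • val (resolventG ρ (fderiv ℝ W z b)) +
        cubicDeriv (resolventG ρ (W z)) (resolventG ρ (fderiv ℝ W z b)) := by
  have hline : HasDerivAt (fun t : ℝ => z + t • b) b 0 := by
    simpa using! ((hasDerivAt_id (0 : ℝ)).smul_const b).const_add z
  have d1 : HasDerivAt (fun t : ℝ => W (z + t • b)) (fderiv ℝ W z b) 0 :=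
    HasFDerivAt.comp_hasDerivAt (0 : ℝ) (by simpa using hWd.hasFDerivAt) hline
  have dE : HasDerivAt (fun t : ℝ => E (z + t • b)) (fderiv ℝ E z b) 0 :=
    HasFDerivAt.comp_hasDerivAt (0 : ℝ) (by simpa using hE.hasFDerivAt) hline
  have d2 : HasDerivAt (fun t : ℝ => resolventG ρ (W (z + t • b)))
      (resolventG ρ (fderiv ℝ W z b)) 0 :=
    ((resolventG ρ).restrictScalars ℝ).hasFDerivAt.comp_hasDerivAt 0 d1
  have d3 : HasDerivAt (fun t : ℝ => val (resolventG ρ (W (z + t • b))))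
      (val (resolventG ρ (fderiv ℝ W z b))) 0 :=
    ((val : H1 ρ →L[ℂ] L2C).restrictScalars ℝ).hasFDerivAt.comp_hasDerivAt 0 d2
  have d4 : HasDerivAt (fun t : ℝ => mulOp V h (val (resolventG ρ (W (z + t • b)))))
      (mulOp V h (val (resolventG ρ (fderiv ℝ W z b)))) 0 :=
    ((mulOp V h).restrictScalars ℝ).hasFDerivAt.comp_hasDerivAt 0 d3
  have l := d1.add d4
  have r := ((dE.add_const (ρ ^ 2)).ofReal_comp.smul d3).add (hasDerivAt_cubic d2)
  have hev : ∀ᶠ t : ℝ in 𝓝 0, ‖z + t • b‖ < δ :=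
    hline.continuousAt.norm.eventually_lt_const (by simpa using hz)
  have l' := l.congr_of_eventuallyEq (f₁ := fun t : ℝ =>
      ((E (z + t • b) + ρ ^ 2 : ℝ) : ℂ) • val (resolventG ρ (W (z + t • b))) +
        cubic (resolventG ρ (W (z + t • b)))) (by
    filter_upwards [hev] with t ht using (hW _ ht).symm)
  have e := l'.unique r
  rw [e]
  simp only [zero_smul, add_zero, cubicDeriv]
  abel

theorem modulationMap_sub_eq {Q : ℂ → L2C} (u : L2C) (z b : ℂ) :
    (inner ℂ (Complex.I • (u - Q z)) (fderiv ℝ Q z b)).re =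
      (Complex.I * inner ℂ (fderiv ℝ Q z b) u).re -
        (Complex.I * inner ℂ (fderiv ℝ Q z b) (Q z)).re := by
  rw [re_inner_comm, inner_smul_right, inner_sub_right, mul_sub, Complex.sub_re]

/-- The modulation parameter of a solution that is decomposed at each time satisfies the modulation
equation. -/
theorem exists_hasDerivWithinAt_modulation (hρ : 0 < ρ)
    (h : MemLp (fun x => (V x : ℂ)) ⊤ volume) {δ : ℝ} {W : ℂ → L2C} {E : ℂ → ℝ}
    (hWc : ∀ z, ‖z‖ < δ → ContDiffAt ℝ 2 W z) (hEd : ∀ z, ‖z‖ < δ → DifferentiableAt ℝ E z)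
    (hW : ∀ z, ‖z‖ < δ → W z + mulOp V h (val (resolventG ρ (W z))) =
      ((E z + ρ ^ 2 : ℝ) : ℂ) • val (resolventG ρ (W z)) + cubic (resolventG ρ (W z)))
    (hWg : ∀ c z : ℂ, ‖c‖ = 1 → W (c * z) = c • W z) {Q : ℂ → L2C}
    (hQ : ∀ z, Q z = val (resolventG ρ (W z)))
    (hcontr : ∀ (u : L2C) (w w' : ℂ), ‖u‖ < δ → ‖w‖ < δ → ‖w'‖ < δ →
      ‖modulationMap Q (u, w) - modulationMap Q (u, w') + (w - w')‖ ≤ 1 / 2 * ‖w - w'‖)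
    {I : Set ℝ} {u : ℝ → L2C} (hu : IsNLSSolution V I u) (huδ : ∀ t ∈ I, ‖u t‖ < δ) {z : ℝ → ℂ}
    (hzδ : ∀ t ∈ I, ‖z t‖ < δ) (hz0 : ∀ t ∈ I, modulationMap Q (u t, z t) = 0)
    {t : ℝ} (ht : t ∈ I) :
    ∃ z' : ℂ, HasDerivWithinAt z z' I t ∧
      ‖z' - Complex.I * E (z t) * z t‖ ≤ 2 * pairingDQ Q (z t)
        (nonlinearTerms (Q (z t)) (u t - Q (z t) : L2C)) := by
  obtain ⟨U, hU, -, hUd⟩ := hu.exists_h1 hρ h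
  let T : L2C →L[ℝ] L2C := ((val : H1 ρ →L[ℂ] L2C) ∘L resolventG ρ).restrictScalars ℝ
  have hQT : Q = fun z => T (W z) := funext hQ
  have hQc : ∀ z, ‖z‖ < δ → ContDiffAt ℝ 2 Q z := fun z hz => by
    rw [hQT]
    exact T.contDiff.contDiffAt.comp z (hWc z hz)
  have hQg : ∀ c z : ℂ, ‖c‖ = 1 → Q (c * z) = c • Q z := fun c z hc => by
    rw [hQ, hQ, hWg c z hc, map_smul, map_smul]
  have hzt := hzδ t ht
  have hut := huδ t ht
  have hWd := (hWc _ hzt).differentiableAt two_ne_zero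
  have hDQ : ∀ b, fderiv ℝ Q (z t) b = val (resolventG ρ (fderiv ℝ W (z t) b)) := fun b => by
    have : HasFDerivAt Q (T ∘L fderiv ℝ W (z t)) (z t) := by
      rw [hQT]
      exact T.hasFDerivAt.comp (z t) hWd.hasFDerivAt
    rw [this.fderiv]
    rfl
  have horth : ∀ b : ℂ, (inner ℂ (Complex.I • (u t - Q (z t))) (fderiv ℝ Q (z t) b)).re = 0 :=
    symplecticOrth_iff.1 (modulationMap_eq_zero_iff.1 (hz0 t ht))
  have hstrict := (contDiffAt_modulationMap (u := u t) (hQc _ hzt)).hasStrictFDerivAt one_ne_zero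
  set B' := fderiv ℝ (modulationMap Q) (u t, z t) with hB'
  have hA : ∀ v, ‖v‖ ≤ 2 * ‖B' (0, v)‖ :=
    norm_le_two_mul_fderiv_modulationMap hcontr hut hzt hstrict.hasFDerivAt
  have huc : ContinuousWithinAt u I t := by
    obtain ⟨ux, -, hc, -⟩ := hu
    exact hc t ht
  -- The contraction bound with `B(u s, z s) = 0` gives `‖z s - z t‖ ≤ 2 ‖B(u s, z t)‖`, which tends
  -- to 0.
  have hzc : ContinuousWithinAt z I t := by
    have hB0 : Tendsto (fun s => modulationMap Q (u s, z t)) (𝓝[I] t) (𝓝 0) := by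
      rw [← hz0 t ht]
      exact hstrict.hasFDerivAt.continuousAt.tendsto.comp
        (huc.prodMk continuousWithinAt_const).tendsto
    refine tendsto_iff_norm_sub_tendsto_zero.2 (squeeze_zero' (Eventually.of_forall fun _ =>
      norm_nonneg _) ?_ (by simpa using hB0.norm.const_mul 2))
    filter_upwards [self_mem_nhdsWithin] with s hs
    have h1 := hcontr (u s) (z s) (z t) (huδ s hs) (hzδ s hs) hzt
    rw [hz0 s hs, zero_sub] at h1
    have h3 : ‖z s - z t‖ ≤ ‖-modulationMap Q (u s, z t) + (z s - z t)‖ +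
        ‖modulationMap Q (u s, z t)‖ := by
      simpa using norm_add_le (-modulationMap Q (u s, z t) + (z s - z t)) (modulationMap Q (u s, z t))
    linarith
  set q := resolventG ρ (W (z t)) with hq
  set η := U t - q with hη
  have hηv : val η = u t - Q (z t) := by rw [hη, map_sub, hU t ht, hQ]
  have hηq : (inner ℂ (val η) (val q)).re = 0 := by
    have := horth (Complex.I * z t)
    rw [fderiv_gauge_tangent (fun w hw => (hQc w hw).differentiableAt two_ne_zero) hQg hzt,
      re_inner_I_smul_I_smul, hQ] at this
    rwa [hηv, hQ]
  -- The time derivative of the orthogonality pairing in direction `b`, with `z` frozen at `z t`.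
  let β : ℂ → ℝ := fun b => (inner ℂ (fderiv ℝ Q (z t) b) (cubic (U t))).re -
    (inner ℂ (u t) (fderiv ℝ W (z t) b - ((ρ ^ 2 : ℝ) : ℂ) • fderiv ℝ Q (z t) b +
      mulOp V h (fderiv ℝ Q (z t) b))).re
  have hβ : ∀ b : ℂ, HasDerivWithinAt (fun s =>
      (inner ℂ (Complex.I • (u s - Q (z t))) (fderiv ℝ Q (z t) b)).re) (β b) I t := fun b => by
    simp only [modulationMap_sub_eq]
    refine HasDerivWithinAt.sub_const _ ?_
    have d := (hUd t ht (resolventG ρ (fderiv ℝ W (z t) b))).const_mul Complex.I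
    have d' := Complex.reCLM.hasFDerivAt.comp_hasDerivWithinAt t d
    simp only [Complex.reCLM_apply] at d'
    rw [re_inner_schrodinger hρ.ne', ← hDQ, hU t ht] at d'
    exact d'
  let N : ℂ → ℝ := fun b => (inner ℂ (cubicRemainder q η) (fderiv ℝ Q (z t) b)).re
  have hN : ∀ b, β b + E (z t) * (inner ℂ (u t) (fderiv ℝ Q (z t) b)).re = N b := fun b => by
    have := modulation_identity hρ.ne' h hq (rfl : resolventG ρ (fderiv ℝ W (z t) b) = _)
      (add_sub_cancel q (U t)).symm (hW _ hzt)
      (fderiv_boundState_eq h hW hzt hWd (hEd _ hzt) b) hηq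
    rwa [← hDQ, hU t ht] at this
  have hβB : HasDerivWithinAt (fun s => modulationMap Q (u s, z t))
      ((β Complex.I : ℂ) - Complex.I * (β 1 : ℂ)) I t :=
    ((hβ Complex.I).ofReal_comp).sub ((hβ 1).ofReal_comp.const_mul Complex.I)
  -- The partial derivative in `z` is injective by `hA`, hence onto in finite dimension.
  obtain ⟨z', hz'⟩ : ∃ z' : ℂ, B' (0, z') = -((β Complex.I : ℂ) - Complex.I * (β 1 : ℂ)) := by
    have hinj : Function.Injective
        ((B' ∘L ContinuousLinearMap.inr ℝ L2C ℂ : ℂ →L[ℝ] ℂ) : ℂ →ₗ[ℝ] ℂ) := by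
      rw [← LinearMap.ker_eq_bot, LinearMap.ker_eq_bot']
      intro v hv
      have hv' : B' (0, v) = 0 := hv
      have := hA v
      rw [hv', norm_zero, mul_zero] at this
      exact norm_le_zero_iff.1 this
    exact LinearMap.surjective_of_injective hinj _
  refine ⟨z', hasDerivWithinAt_of_implicit hstrict huc hzc ht hz0 hβB hA hz', ?_⟩
  have hgauge := fderiv_modulationMap_gauge hQc hQg hzt horth hstrict.hasFDerivAt
  -- `z'` contributes `-β` and, by the gauge derivative, the drift contributes `-E ⟨u, DQ⟩`. By `hN`
  -- the sum of the two is `-N`.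
  have hcalc : B' (0, z' - Complex.I * E (z t) * z t) =
      -((N Complex.I : ℂ) - Complex.I * (N 1 : ℂ)) := by
    have e : ((0 : L2C), z' - Complex.I * E (z t) * z t) =
        (0, z') - E (z t) • ((0 : L2C), Complex.I * z t) := by
      ext1
      · simp
      · simp only [Prod.snd_sub, Prod.smul_snd, Complex.real_smul]
        ring
    rw [e, map_sub, map_smul, hz', hgauge, ← hN, ← hN, Complex.real_smul]
    push_cast
    ring
  have hpair : pairingDQ Q (z t) (nonlinearTerms (Q (z t)) (u t - Q (z t) : L2C)) =
      ‖(N Complex.I : ℂ) - Complex.I * (N 1 : ℂ)‖ := by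
    have e := cubicRemainder_ae_eq q η
    rw [hηv, ← hQ] at e
    rw [pairingDQ, reducedInner_eq_re_inner e, reducedInner_eq_re_inner e, norm_ofReal_sub_I_mul,
      D1, D2]
  rw [hpair]
  have := hA (z' - Complex.I * E (z t) * z t)
  rwa [hcalc, norm_neg] at this

end ModulationEquation

/-! ### The main theorem -/

theorem corollary3p2 (V : ℝ → ℝ) (ρ : ℝ) (φ : L2C) (hV : PotentialAssumption V ρ φ) :
    ∃ δ : ℝ, 0 < δ ∧ ∃ (Q : ℂ → L2C) (E : ℂ → ℝ), IsBoundStateFamily V ρ φ δ Q E ∧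
      ∃ ε₀ : ℝ, 0 < ε₀ ∧ ∃ C : ℝ, 0 < C ∧
        ∀ I : Set ℝ, I.OrdConnected → (0 : ℝ) ∈ I →
        ∀ u : ℝ → L2C, IsNLSSolution V I u → SmallData (u 0) ε₀ →
          ∃ z z' : ℝ → ℂ, ∀ t ∈ I,
            ‖z t‖ < δ ∧
            HasDerivWithinAt z (z' t) I t ∧
            SymplecticOrth Q (z t) (u t - Q (z t)) ∧
            (∀ w : ℂ, ‖w‖ < δ → SymplecticOrth Q w (u t - Q w) → w = z t) ∧
            ‖z' t - Complex.I * E (z t) * z t‖ ≤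
              C * pairingDQ Q (z t)
                (nonlinearTerms (Q (z t)) (u t - Q (z t) : L2C)) := by
  classical
  obtain ⟨δ₀, hδ₀, W, E, hfam, hWc, hEd, hW, hWg, hW0, hD0⟩ := exists_boundStateFamily hV
  let Q : ℂ → L2C := fun z => H1.val (resolventG ρ (W z))
  have hQ0 : Q 0 = 0 := by simp only [Q, hW0, map_zero]
  have hQc : ContDiffAt ℝ 2 Q 0 :=
    (((H1.val : H1 ρ →L[ℂ] L2C) ∘L resolventG ρ).restrictScalars ℝ).contDiff.contDiffAt.comp 0
      (hWc 0 (by rwa [norm_zero]))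
  obtain ⟨ε, hε, hcontr⟩ := exists_contraction_modulationMap hQc hQ0 hD0 hV.normalized
  set δ := min δ₀ ε with hδdef
  have hδ : 0 < δ := lt_min hδ₀ hε
  have hlt₀ : ∀ {z : ℂ}, ‖z‖ < δ → ‖z‖ < δ₀ := fun hz => hz.trans_le (min_le_left _ _)
  have hδε : δ ≤ ε := min_le_right _ _
  have hcontr' : ∀ (u : L2C) (w w' : ℂ), ‖u‖ < δ → ‖w‖ < δ → ‖w'‖ < δ →
      ‖modulationMap Q (u, w) - modulationMap Q (u, w') + (w - w')‖ ≤ 1 / 2 * ‖w - w'‖ :=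
    fun u w w' hu hw hw' => hcontr u w w' (hu.trans_le hδε) (hw.trans_le hδε) (hw'.trans_le hδε)
  -- `δ / 8` is the size of `u` for which the fixed point argument works in the ball of radius `δ`.
  refine ⟨δ, hδ, Q, E, hfam δ hδ (min_le_left _ _), δ / 8, by positivity, 2, two_pos, ?_⟩
  intro I hI h0I u hu hsmall
  -- Conservation of mass carries the smallness of the initial data to all of `I`.
  have hu8 : ∀ t ∈ I, ‖u t‖ ≤ δ / 8 := fun t ht => by
    rw [hu.norm_eq hV.rho_pos hV.memLp_top hI ht h0I]
    obtain ⟨u₁, m, -, -, hle⟩ := hsmall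
    have h1 : ‖u 0‖ ≤ √(‖u 0‖ ^ 2 + ‖u₁‖ ^ 2) :=
      Real.le_sqrt_of_sq_le (le_add_of_nonneg_right (sq_nonneg _))
    linarith [norm_nonneg m]
  have huδ : ∀ t ∈ I, ‖u t‖ < δ := fun t ht => (hu8 t ht).trans_lt (by linarith)
  have hex : ∀ t : ℝ, ∃ z : ℂ, t ∈ I → ‖z‖ < δ ∧ modulationMap Q (u t, z) = 0 := fun t => by
    by_cases ht : t ∈ I
    · obtain ⟨z, hz⟩ := exists_modulationMap_eq_zero hδ le_rfl hcontr' (hu8 t ht) (by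
        rw [modulationMap_apply_zero hQ0 hD0]
        simpa [hV.normalized] using norm_inner_le_norm (𝕜 := ℂ) φ (u t))
      exact ⟨z, fun _ => hz⟩
    · exact ⟨0, fun h => absurd h ht⟩
  choose z hz using hex
  have hder : ∀ t : ℝ, ∃ z' : ℂ, t ∈ I → HasDerivWithinAt z z' I t ∧
      ‖z' - Complex.I * E (z t) * z t‖ ≤ 2 * pairingDQ Q (z t)
        (nonlinearTerms (Q (z t)) (u t - Q (z t) : L2C)) := fun t => by
    by_cases ht : t ∈ I
    · obtain ⟨z', hz'⟩ := exists_hasDerivWithinAt_modulation hV.rho_pos hV.memLp_top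
        (fun z hz => hWc z (hlt₀ hz)) (fun z hz => hEd z (hlt₀ hz)) (fun z hz => hW z (hlt₀ hz))
        hWg (fun _ => rfl) hcontr' hu huδ (fun t ht => (hz t ht).1) (fun t ht => (hz t ht).2) ht
      exact ⟨z', fun _ => hz'⟩
    · exact ⟨0, fun h => absurd h ht⟩
  choose z' hz' using hder
  refine ⟨z, z', fun t ht => ⟨(hz t ht).1, (hz' t ht).1,
    modulationMap_eq_zero_iff.1 (hz t ht).2, fun w hw horth => ?_, (hz' t ht).2⟩⟩
  -- For two zeros of `B(u t, ·)` the contraction inequality reads `‖w - z t‖ ≤ (1/2) ‖w - z t‖`.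
  have := hcontr' (u t) w (z t) (huδ t ht) hw (hz t ht).1
  rw [modulationMap_eq_zero_iff.2 horth, (hz t ht).2, sub_self, zero_add] at this
  have h0 : ‖w - z t‖ ≤ 0 := by linarith [norm_nonneg (w - z t)]
  exact sub_eq_zero.1 (norm_le_zero_iff.1 h0)
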